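/- Let $\Sigma$ be a connected smooth manifold (Hausdorff, second countable, without boundary) of dimension $n\ge 1$, let $g,g'$ be two complete smooth Riemannian metrics on $\Sigma$, and let $\Omega\subset\Sigma$ be a closed $n$-dimensional embedded submanifold with boundary. Identify the unit tangent bundles of $g$ and $g'$ by the rescaling $(x,v)\mapsto(x,v/|v|_{g'})$ and write $S\Sigma$ for both. Let $\varphi^g,\varphi^{g'}:\mathbb{R}\times S\Sigma\to S\Sigma$ be the geodesic flows. Put $M=S(\Sigma\setminus\mathring\Omega)$, $\partial M=(S\Sigma)|_{\partial\Omega}$, $\mathring M=S(\Sigma\setminus\Omega)$, let $\partial_{\mathrm g}M=\partial M\cap T(\partial\Omega)$ be the grazing boundary and $\partial_{\mathrm{in}}M\subset\partial M$ the set of vectors pointing strictly into $\Omega$ (these sets are the same for $g$ and $g'$). For $x\in\partial\Omega$ let $R_{g(x)}v=v-2g_x(v,n_x)n_x$, where $n_x$ is the inward $g$-unit normal, be the $g$-reflection at $T_x(\partial\Omega)$, and define $R_{g'(x)}$ likewise with respect to $g'$. The model space $\mathcal M_g$ is the topological quotient of $M\setminus\partial_{\mathrm g}M$ by the identification of $(x,v)$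 with $(x,R_{g(x)}v)$ for $(x,v)\in\partial M\setminus\partial_{\mathrm g}M$; let $\pi_g:M\setminus\partial_{\mathrm g}M\to\mathcal M_g$ be the projection. Its smooth structure is given by the chart $(\pi_g|_{\mathring M})^{-1}$ on $\pi_g(\mathring M)$ and the charts $\Phi^{-1}$ on $\Phi(N_{\mathrm{in}})$, where $N_{\mathrm{in}}$ is a sufficiently small open neighborhood of $\{0\}\times\partial_{\mathrm{in}}M$ in $\mathbb{R}\times\partial_{\mathrm{in}}M$ and $\Phi(t,x,v)=\pi_g(\varphi^g(t,x,v))$ for $t\le 0$, $\Phi(t,x,v)=\pi_g(\varphi^g(t,x,R_{g(x)}v))$ for $t>0$. (Sufficiently small means that $\Phi$ is injective on $N_{\mathrm{in}}$ and the trajectory pieces between time $0$ and time $t$ do not meet $\Omega$ at nonzero times.) Define $\mathcal M_{g'}$, $\pi_{g'}$ in the same way from $g'$. For an open neighborhood $N$ of $\{0\}\times(\partial M\setminus\partial_{\mathrm g}M)$ in $\mathbb{R}\times(\partial M\setminus\partial_{\mathrm g}M)$ on which $\varphi^g$ and $\varphi^{g'}$ are diffeomorphisms onto open subsets of $S\Sigma$,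 define $\tilde R_g:\varphi^g(N)\to S\Sigma$ by $\tilde R_g(\varphi^g(t,x_0,v_0))=\varphi^g(t,x_0,R_{g(x_0)}v_0)$ for $(t,x_0,v_0)\in N$, and define $\tilde R_{g'}:\varphi^{g'}(N)\to S\Sigma$ likewise with respect to $g'$. Then the following two statements are equivalent: 1. There is a diffeomorphism $F:\mathcal M_g\to\mathcal M_{g'}$ with $F\circ\pi_g=\pi_{g'}$. 2. There is an open neighborhood $N$ as above such that the two maps $N\cap(\mathbb{R}\times\partial_{\mathrm{in}}M)\to S\Sigma$ given by $$(t,x,v)\mapsto\begin{cases}\varphi^g(t,x,v),&t\le 0,\\ \tilde R_{g'}\big(\varphi^g(t,x,R_{g(x)}v)\big),&t>0,\end{cases}\qquad (t,x,v)\mapsto\begin{cases}\varphi^{g'}(t,x,v),&t\le 0,\\ \tilde R_{g}\big(\varphi^{g'}(t,x,R_{g'(x)}v)\big),&t>0,\end{cases}$$ are well-defined (that is, for $t>0$ one has $\varphi^g(t,x,R_{g(x)}v)\in\varphi^{g'}(N)$ and $\varphi^{g'}(t,x,R_{g'(x)}v)\in\varphi^{g}(N)$, respectively) and smooth. If (1),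 or equivalently (2), holds, then the diffeomorphism in (1) is unique. -/

import Mathlib

open Set Topology
open scoped Manifold ContDiff

noncomputable section

namespace Billiard

/-- Smooth Riemannian metrics on a (boundaryless) smooth `n`-manifold `X`. -/
abbrev Metric (n : ℕ) (X : Type*) [TopologicalSpace X]
    [ChartedSpace (EuclideanSpace ℝ (Fin n)) X] [IsManifold (𝓡 n) ∞ X] :=
  Bundle.ContMDiffRiemannianMetric (𝓡 n) ∞ (EuclideanSpace ℝ (Fin n))
    (fun x : X => TangentSpace (𝓡 n) x)

section Smooth

/-! ### Smooth maps between subsets of manifolds -/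

variable {E₁ H₁ W₁ E₂ H₂ W₂ : Type*}
  [NormedAddCommGroup E₁] [NormedSpace ℝ E₁] [TopologicalSpace H₁]
  [TopologicalSpace W₁] [ChartedSpace H₁ W₁]
  [NormedAddCommGroup E₂] [NormedSpace ℝ E₂] [TopologicalSpace H₂]
  [TopologicalSpace W₂] [ChartedSpace H₂ W₂]

/-- Smoothness of `f : D → W₂` for a subset `D` (in practice an embedded submanifold) of a manifold:
locally around each point of `D`, the map extends to a smooth map on an open set of the ambient
manifold. -/
def SmoothOn (I₁ : ModelWithCorners ℝ E₁ H₁) (I₂ : ModelWithCorners ℝ E₂ H₂)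
    (f : W₁ → W₂) (D : Set W₁) : Prop :=
  ∀ w ∈ D, ∃ U : Set W₁, IsOpen U ∧ w ∈ U ∧
    ∃ h : W₁ → W₂, ContMDiffOn I₁ I₂ ∞ h U ∧ ∀ z ∈ U ∩ D, h z = f z

/-- `f` restricts to a diffeomorphism of `D` onto its image, which is an open subset of `S`. -/
def IsDiffeoOntoOpenImage (I₁ : ModelWithCorners ℝ E₁ H₁) (I₂ : ModelWithCorners ℝ E₂ H₂)
    (f : W₁ → W₂) (D : Set W₁) (S : Set W₂) : Prop :=
  SmoothOn I₁ I₂ f D ∧ (∃ O : Set W₂, IsOpen O ∧ f '' D = O ∩ S) ∧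
    ∃ k : W₂ → W₁, (∀ w ∈ D, k (f w) = w) ∧ SmoothOn I₂ I₁ k (f '' D)

/-- Let `P` and `P'` be graphs of local parametrizations of spaces `Q` and `Q'` by subsets of the
manifolds `W₁` and `W₂` (`P w q` means that `w` is in the domain of the parametrization and is sent
to `q`). The map `F : Q → Q'` is smooth when read in these: near each point at which it makes sense,
`(P')⁻¹ ∘ F ∘ P` is given by a smooth map. -/
def ReadsSmoothly {Q Q' : Type*} (I₁ : ModelWithCorners ℝ E₁ H₁) (I₂ : ModelWithCorners ℝ E₂ H₂)
    (P : W₁ → Q → Prop) (P' : W₂ → Q' → Prop) (F : Q → Q') : Prop :=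
  ∀ w q w', P w q → P' w' (F q) →
    ∃ U : Set W₁, IsOpen U ∧ w ∈ U ∧
      ∃ θ : W₁ → W₂, ContMDiffOn I₁ I₂ ∞ θ U ∧ θ w = w' ∧
        ∀ z ∈ U, ∀ r, P z r → P' (θ z) (F r)

end Smooth

variable {n : ℕ} {X : Type*} [TopologicalSpace X] [ChartedSpace (EuclideanSpace ℝ (Fin n)) X]
  [IsManifold (𝓡 n) ∞ X]

/-- The model with corners of the manifold `ℝ × TX`. -/
abbrev timeModel (n : ℕ) := (𝓘(ℝ, ℝ)).prod ((𝓡 n).tangent)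

/-! ### Geodesics and the geodesic flow -/

/-- The metric `g` in the preferred chart around `x₀`:
`metricInChart g x₀ y u w = ∑ g_{ij}(y) uⁱ wʲ`. -/
def metricInChart (g : Metric n X) (x₀ : X) (y u w : EuclideanSpace ℝ (Fin n)) : ℝ :=
  g.inner ((extChartAt (𝓡 n) x₀).symm y)
    (mfderiv 𝓘(ℝ, EuclideanSpace ℝ (Fin n)) (𝓡 n) (extChartAt (𝓡 n) x₀).symm y u)
    (mfderiv 𝓘(ℝ, EuclideanSpace ℝ (Fin n)) (𝓡 n) (extChartAt (𝓡 n) x₀).symm y w)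

/-- Geodesics: smooth curves `γ : ℝ → X` which satisfy in local coordinates `c = (c¹, …, cⁿ)` the
geodesic equation `d/dt (∑ⱼ g_{ij}(c) ċʲ) = ½ ∑ⱼₖ ∂ᵢ g_{jk}(c) ċʲ ċᵏ` (contracted below with an
arbitrary constant vector `w`). -/
def IsGeodesic (g : Metric n X) (γ : ℝ → X) : Prop :=
  ContMDiff 𝓘(ℝ, ℝ) (𝓡 n) ∞ γ ∧
    ∀ (x₀ : X) (t : ℝ), γ t ∈ (extChartAt (𝓡 n) x₀).source →
      ∀ w : EuclideanSpace ℝ (Fin n),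
        let c : ℝ → EuclideanSpace ℝ (Fin n) := fun s => extChartAt (𝓡 n) x₀ (γ s)
        HasDerivAt (fun s => metricInChart g x₀ (c s) (deriv c s) w)
          (1 / 2 * fderiv ℝ (fun y => metricInChart g x₀ y (deriv c t) (deriv c t)) (c t) w) t

/-- The velocity `(γ t, γ' t)` of a curve. -/
def velocity (γ : ℝ → X) (t : ℝ) : TangentBundle (𝓡 n) X :=
  ⟨γ t, mfderiv 𝓘(ℝ, ℝ) (𝓡 n) γ t (1 : ℝ)⟩

/-- (Geodesic) completeness: every tangent vector is the initial velocity of a geodesic which is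
defined for all times. -/
def IsComplete (g : Metric n X) : Prop :=
  ∀ p : TangentBundle (𝓡 n) X, ∃ γ : ℝ → X, IsGeodesic g γ ∧ velocity γ 0 = p

open Classical in
/-- The geodesic flow `(t, x, v) ↦ φ^g_t(x, v)` of a complete metric (on all of `TX`; it preserves
the unit tangent bundle). -/
def geodesicFlow (g : Metric n X) (w : ℝ × TangentBundle (𝓡 n) X) : TangentBundle (𝓡 n) X :=
  if h : ∃ γ : ℝ → X, IsGeodesic g γ ∧ velocity γ 0 = w.2 then velocity h.choose w.1 else w.2

/-- The unit tangent bundle. -/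
def unitBundle (g : Metric n X) : Set (TangentBundle (𝓡 n) X) :=
  {p | g.inner p.proj p.snd p.snd = 1}

/-- The rescaling `(x, v) ↦ (x, v / |v|_g)`. It restricts to the canonical diffeomorphism from the
unit tangent bundle of any other metric onto that of `g`. -/
def rescale (g : Metric n X) (p : TangentBundle (𝓡 n) X) : TangentBundle (𝓡 n) X :=
  ⟨p.proj, (√(g.inner p.proj p.snd p.snd))⁻¹ • p.snd⟩

/-! ### The obstacles -/

/-- The derivative `dρ(x)(u)` of a real function. -/
def dirDeriv {n : ℕ} {X : Type*} [TopologicalSpace X]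
    [ChartedSpace (EuclideanSpace ℝ (Fin n)) X] (ρ : X → ℝ) (x : X)
    (u : TangentSpace (𝓡 n) x) : ℝ :=
  mfderiv (𝓡 n) 𝓘(ℝ, ℝ) ρ x u

/-- `ρ` is a smooth function near `x` with `dρ(x) ≠ 0` and `Ω = {ρ ≤ 0}` near `x`. -/
def IsDefiningFunctionAt (n : ℕ) {X : Type*} [TopologicalSpace X]
    [ChartedSpace (EuclideanSpace ℝ (Fin n)) X] (Ω : Set X) (x : X) (ρ : X → ℝ) : Prop :=
  (∃ U : Set X, IsOpen U ∧ x ∈ U ∧ ContMDiffOn (𝓡 n) 𝓘(ℝ, ℝ) ∞ ρ U ∧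
    ∀ y ∈ U, (y ∈ Ω ↔ ρ y ≤ 0)) ∧
  mfderiv (𝓡 n) 𝓘(ℝ, ℝ) ρ x ≠ 0

/-- `Ω` is a (closed, embedded) `n`-dimensional submanifold with boundary of `X`. Its manifold
boundary is then `frontier Ω` and its manifold interior is `interior Ω`. -/
def IsObstacle (n : ℕ) {X : Type*} [TopologicalSpace X]
    [ChartedSpace (EuclideanSpace ℝ (Fin n)) X] (Ω : Set X) : Prop :=
  IsClosed Ω ∧ ∀ x ∈ frontier Ω, ∃ ρ : X → ℝ, IsDefiningFunctionAt n Ω x ρ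

/-- The tangent hyperplane `T_x(∂Ω)`, `x ∈ ∂Ω`. -/
def boundaryTangent (Ω : Set X) (x : X) : Set (TangentSpace (𝓡 n) x) :=
  {u | ∃ ρ : X → ℝ, IsDefiningFunctionAt n Ω x ρ ∧ dirDeriv ρ x u = 0}

/-- `ν` is the inward unit normal at `x ∈ ∂Ω` (inward: pointing into `Ω`). -/
def IsInwardNormal (g : Metric n X) (Ω : Set X) (x : X) (ν : TangentSpace (𝓡 n) x) : Prop :=
  g.inner x ν ν = 1 ∧ (∀ u ∈ boundaryTangent Ω x, g.inner x ν u = 0) ∧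
    ∃ ρ : X → ℝ, IsDefiningFunctionAt n Ω x ρ ∧ dirDeriv ρ x ν < 0

open Classical in
/-- The inward unit normal `n_x` (with the junk value `0` if `x ∉ ∂Ω`). -/
def inwardNormal (g : Metric n X) (Ω : Set X) (x : X) : TangentSpace (𝓡 n) x :=
  if h : ∃ ν, IsInwardNormal g Ω x ν then h.choose else 0

/-- The tangential reflection `R_g : (x, v) ↦ (x, v - 2 g_x(v, n_x) n_x)`. -/
def reflect (g : Metric n X) (Ω : Set X) (p : TangentBundle (𝓡 n) X) : TangentBundle (𝓡 n) X :=
  ⟨p.proj, p.snd - (2 * g.inner p.proj p.snd (inwardNormal g Ω p.proj)) •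
    inwardNormal g Ω p.proj⟩

/-! ### The phase space and its boundary -/

/-- The phase space `M = S(X \ Ω°)`. -/
def phaseSpace (g : Metric n X) (Ω : Set X) : Set (TangentBundle (𝓡 n) X) :=
  {p | p ∈ unitBundle g ∧ p.proj ∉ interior Ω}

/-- The interior `S(X \ Ω)` of `M`. -/
def phaseInterior (g : Metric n X) (Ω : Set X) : Set (TangentBundle (𝓡 n) X) :=
  {p | p ∈ unitBundle g ∧ p.proj ∉ Ω}

/-- The boundary `∂M = (SX)|_{∂Ω}`. -/
def phaseBoundary (g : Metric n X) (Ω : Set X) : Set (TangentBundle (𝓡 n) X) :=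
  {p | p ∈ unitBundle g ∧ p.proj ∈ frontier Ω}

/-- The grazing boundary `∂_g M = ∂M ∩ T(∂Ω)`. -/
def grazingBoundary (g : Metric n X) (Ω : Set X) : Set (TangentBundle (𝓡 n) X) :=
  {p | p ∈ phaseBoundary g Ω ∧ p.snd ∈ boundaryTangent Ω p.proj}

/-- The inward boundary `∂_in M`. -/
def inBoundary (g : Metric n X) (Ω : Set X) : Set (TangentBundle (𝓡 n) X) :=
  {p | p ∈ phaseBoundary g Ω ∧ 0 < g.inner p.proj p.snd (inwardNormal g Ω p.proj)}

/-- `M \ ∂_g M`. -/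
abbrev NonGrazing (g : Metric n X) (Ω : Set X) : Type _ :=
  {p : TangentBundle (𝓡 n) X // p ∈ phaseSpace g Ω \ grazingBoundary g Ω}

theorem rescale_mem (g g' : Metric n X) (Ω : Set X) {p : TangentBundle (𝓡 n) X}
    (hp : p ∈ phaseSpace g Ω \ grazingBoundary g Ω) :
    rescale g' p ∈ phaseSpace g' Ω \ grazingBoundary g' Ω := by
  obtain ⟨x, v⟩ := p
  obtain ⟨⟨h1, h2⟩, h3⟩ := hp
  have h1' : g.inner x v v = 1 := h1
  have hv : v ≠ 0 := by
    rintro rfl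
    simp at h1'
  have hpos : 0 < g'.inner x v v := g'.pos x v hv
  have hs : 0 < √(g'.inner x v v) := Real.sqrt_pos.2 hpos
  refine ⟨⟨?_, h2⟩, ?_⟩
  · change g'.inner x ((√(g'.inner x v v))⁻¹ • v) ((√(g'.inner x v v))⁻¹ • v) = 1
    simp only [map_smul, smul_apply, smul_eq_mul]
    rw [← mul_assoc, ← mul_inv, Real.mul_self_sqrt hpos.le]
    exact inv_mul_cancel₀ hpos.ne'
  · rintro ⟨⟨-, h4⟩, ρ, h5, h6⟩
    refine h3 ⟨⟨h1, h4⟩, ρ, h5, ?_⟩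
    change mfderiv (𝓡 n) 𝓘(ℝ, ℝ) ρ x ((√(g'.inner x v v))⁻¹ • v) = 0 at h6
    rw [map_smul] at h6
    exact (smul_eq_zero.1 h6).resolve_left (inv_pos.2 hs).ne'

/-- The canonical identification of `M \ ∂_g M` for the metrics `g` and `g'`. -/
def identify (g g' : Metric n X) (Ω : Set X) (p : NonGrazing g Ω) : NonGrazing g' Ω :=
  ⟨rescale g' p.1, rescale_mem g g' Ω p.2⟩

/-! ### The model space `𝓜_g` -/

/-- The model space `𝓜_g = (M \ ∂_g M) / ∼` with the quotient topology, where each boundary point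
is glued to its tangential reflection. -/
abbrev Model (g : Metric n X) (Ω : Set X) : Type _ :=
  Quot (fun p q : NonGrazing g Ω => p.1 ∈ phaseBoundary g Ω ∧ q.1 = reflect g Ω p.1)

/-- The projection `π_g : M \ ∂_g M → 𝓜_g`. -/
def Model.proj (g : Metric n X) (Ω : Set X) (p : NonGrazing g Ω) : Model g Ω := Quot.mk _ p

/-- The billiard flow `φ_t(x, v)` started at an inward boundary point, for times before
the next boundary intersection. -/
def localFlow (g : Metric n X) (Ω : Set X) (w : ℝ × TangentBundle (𝓡 n) X) :
    TangentBundle (𝓡 n) X :=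
  open Classical in
  if w.1 ≤ 0 then geodesicFlow g w else geodesicFlow g (w.1, reflect g Ω w.2)

/-- (The graph of) the parametrization of the complement of the gluing region of `𝓜_g` by the
interior of `M`. -/
def interiorParam (g : Metric n X) (Ω : Set X) (p : TangentBundle (𝓡 n) X) (q : Model g Ω) : Prop :=
  p ∈ phaseInterior g Ω ∧ ∃ h, q = Model.proj g Ω ⟨p, h⟩

/-- (The graph of) the map `Φ : N → 𝓜_g`, `Φ(t, x, v) = π_g(φ_t(x, v))`. -/
def flowParam (g : Metric n X) (Ω : Set X) (N : Set (ℝ × TangentBundle (𝓡 n) X))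
    (w : ℝ × TangentBundle (𝓡 n) X) (q : Model g Ω) : Prop :=
  w ∈ N ∧ ∃ h, q = Model.proj g Ω ⟨localFlow g Ω w, h⟩

/-- `N` is an open neighborhood of `{0} × B` in `ℝ × B`. -/
def IsOpenNhdZero {W : Type*} [TopologicalSpace W] (B : Set W) (N : Set (ℝ × W)) : Prop :=
  (∃ V : Set (ℝ × W), IsOpen V ∧ N = V ∩ (univ ×ˢ B)) ∧ ∀ p ∈ B, ((0 : ℝ), p) ∈ N

/-- `N` is a set on which `Φ` is a flow chart: an open neighborhood of `{0} × ∂_in M` in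
`ℝ × ∂_in M` such that the trajectories corresponding to points in `N` meet no obstacle (except at
time zero) and such that `Φ` is injective on `N`. -/
def IsFlowChartDomain (g : Metric n X) (Ω : Set X) (N : Set (ℝ × TangentBundle (𝓡 n) X)) : Prop :=
  IsOpenNhdZero (inBoundary g Ω) N ∧
  (∀ w ∈ N, ∀ s : ℝ, s ≠ 0 → s ∈ uIcc 0 w.1 → (localFlow g Ω (s, w.2)).proj ∉ Ω) ∧
  ∀ w₁ w₂ q, flowParam g Ω N w₁ q → flowParam g Ω N w₂ q → w₁ = w₂

/-- Smoothness of a map `F : 𝓜_g → 𝓜_{g'}` between model spaces: `F` is continuous and is smooth in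
the charts that define the smooth structures of `𝓜_g` and `𝓜_{g'}`, which are the inverse of `π`
on the interior of `M`, and the inverses of the maps `Φ` around the gluing region. -/
def IsSmoothMap (g g' : Metric n X) (Ω : Set X) (F : Model g Ω → Model g' Ω) : Prop :=
  Continuous F ∧
  ReadsSmoothly (𝓡 n).tangent (𝓡 n).tangent (interiorParam g Ω) (interiorParam g' Ω) F ∧
  (∀ N', IsFlowChartDomain g' Ω N' →
    ReadsSmoothly (𝓡 n).tangent (timeModel n) (interiorParam g Ω) (flowParam g' Ω N') F) ∧
  (∀ N, IsFlowChartDomain g Ω N →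
    ReadsSmoothly (timeModel n) (𝓡 n).tangent (flowParam g Ω N) (interiorParam g' Ω) F) ∧
  (∀ N N', IsFlowChartDomain g Ω N → IsFlowChartDomain g' Ω N' →
    ReadsSmoothly (timeModel n) (timeModel n) (flowParam g Ω N) (flowParam g' Ω N') F)

/-- `F : 𝓜_g → 𝓜_{g'}` is a diffeomorphism with `F ∘ π_g = π_{g'}` (under the canonical
identification of the unit tangent bundles). -/
def IsCompatibleDiffeo (g g' : Metric n X) (Ω : Set X) (F : Model g Ω ≃ Model g' Ω) : Prop :=
  IsSmoothMap g g' Ω F ∧ IsSmoothMap g' g Ω F.symm ∧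
    ∀ p : NonGrazing g Ω, F (Model.proj g Ω p) = Model.proj g' Ω (identify g g' Ω p)

/-! ### The regularity condition -/

open Classical in
/-- The geometric reflection map `R̃_g : φ^g(N) → SX`, sending `φ^g(t, x₀, v₀)`, `(t, x₀, v₀) ∈ N`,
to `φ^g(t, x₀, R_g v₀)`. -/
def geometricReflection (g : Metric n X) (Ω : Set X) (N : Set (ℝ × TangentBundle (𝓡 n) X))
    (p : TangentBundle (𝓡 n) X) : TangentBundle (𝓡 n) X :=
  if h : ∃ w ∈ N, geodesicFlow g w = p then
    geodesicFlow g (h.choose.1, reflect g Ω h.choose.2)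
  else p

/-- A set `N ⊆ ℝ × SX`, transported to the unit tangent bundle of the metric `g'`. -/
def transport (g' : Metric n X) (N : Set (ℝ × TangentBundle (𝓡 n) X)) :
    Set (ℝ × TangentBundle (𝓡 n) X) :=
  (fun w => (w.1, rescale g' w.2)) '' N

/-- The map `(t, x, v) ↦ φ^g(t, x, v)` for `t ≤ 0`, `(t, x, v) ↦ R̃_{g'}(φ^g(t, x, R_g v))` for
`t > 0`, where `R̃_{g'}` is defined through the set `N'` and the rescalings identify the unit tangent
bundles of `g` and `g'`. -/
def mixedMap (g g' : Metric n X) (Ω : Set X) (N' : Set (ℝ × TangentBundle (𝓡 n) X))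
    (w : ℝ × TangentBundle (𝓡 n) X) : TangentBundle (𝓡 n) X :=
  open Classical in
  if w.1 ≤ 0 then geodesicFlow g w
  else rescale g (geometricReflection g' Ω N'
    (rescale g' (geodesicFlow g (w.1, reflect g Ω w.2))))

/-- The map `mixedMap g g' Ω N'` is well-defined and smooth on `N ∩ (ℝ × ∂_in M)`. -/
def MixedMapRegular (g g' : Metric n X) (Ω : Set X)
    (N N' : Set (ℝ × TangentBundle (𝓡 n) X)) : Prop :=
  (∀ w ∈ N ∩ (univ ×ˢ inBoundary g Ω), 0 < w.1 →
    rescale g' (geodesicFlow g (w.1, reflect g Ω w.2)) ∈ geodesicFlow g' '' N') ∧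
  SmoothOn (timeModel n) (𝓡 n).tangent (mixedMap g g' Ω N') (N ∩ (univ ×ˢ inBoundary g Ω))

/-- `N` is an open neighborhood of `{0} × (∂M \ ∂_g M)` in `ℝ × (∂M \ ∂_g M)` on which both geodesic
flows are diffeomorphisms onto open subsets of the unit tangent bundle, and for which both
combined maps are well-defined and smooth on `N ∩ (ℝ × ∂_in M)`. -/
def IsRegularNhd (g g' : Metric n X) (Ω : Set X) (N : Set (ℝ × TangentBundle (𝓡 n) X)) : Prop :=
  IsOpenNhdZero (phaseBoundary g Ω \ grazingBoundary g Ω) N ∧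
  IsDiffeoOntoOpenImage (timeModel n) (𝓡 n).tangent (geodesicFlow g) N (unitBundle g) ∧
  IsDiffeoOntoOpenImage (timeModel n) (𝓡 n).tangent (geodesicFlow g') (transport g' N)
    (unitBundle g') ∧
  MixedMapRegular g g' Ω N (transport g' N) ∧
  MixedMapRegular g' g Ω (transport g' N) N

end Billiard

end

set_option maxSynthPendingDepth 3
set_option linter.unusedSectionVars false

noncomputable section

namespace Billiard

open Filter Bundle

/-! ### Implicit functions and smooth dependence of solutions of differential equations -/

section Implicit

/-! Since `π_g` is surjective, `F ∘ π_g = π_{g'}` determines `F`, which gives uniqueness; such an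
`F` exists as soon as the rescaling carries the `g`-reflection to the `g'`-reflection at nongrazing
boundary vectors. On the interior `F` is the rescaling, and nongrazing vectors are transversal to
`∂Ω`, so the flow charts at nonzero times are smoothly related to the interior chart. Hence every
reading of `F` in charts is automatically smooth, except between two flow charts at time zero. The
theorem is about one germ: the reading `θ = Φ_{g'}⁻¹ ∘ F ∘ Φ_g` near `(0, y)` with `y ∈ ∂_in M`.

This reading is the mixed map in disguise. Let `θ(t, x, v) = (s, q)`. For `t ≤ 0` one has `s ≤ 0`
and `φ^{g'}(s, q) = φ^g(t, x, v)`. For `t > 0` one has `s > 0` and `φ^{g'}(s, R_{g'} q) = φ^g(t, x,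
R_g v)`, so `R̃_{g'}` sends this point to `φ^{g'}(s, q)`. In both cases `φ^{g'} ∘ θ` is the mixed
map up to rescaling. As `φ^{g'}` has smooth local inverses on `ℝ × (∂M \ ∂_g M)`, one of the two is
smooth if the other is: `exists_smoothNear_flow_flow` and `exists_smoothNear_mixedMap_zero` are the
two directions. The signs of `s` and `t` match because transversal trajectories are inside `Ω` on
one side of time zero and outside on the other, or because inward and outward vectors stay apart.

From (2) to (1), continuity of the mixed map at time zero already forces the reflections to agree
(`reflectionsAgree_of_mixedMapRegular`), so `F` exists. From (1) to (2), a neighborhood `N` on which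
everything is defined must also be built (`exists_regular_nhd`).

The analytic input is the smoothness of the geodesic flow (`smoothNear_geodesicFlow`), derived from
the implicit function theorem in `C([0, 1], E)`; the smooth hitting time of `∂Ω`
(`exists_hitting_time`), which inverts the flow locally (`exists_flow_inverse`); and smooth local
extensions of the reflection (`exists_smoothNear_reflect`). -/

theorem eventually_contDiffAt_implicitFunction {E₁ E₂ F : Type*}
    [NormedAddCommGroup E₁] [NormedSpace ℝ E₁] [CompleteSpace E₁]
    [NormedAddCommGroup E₂] [NormedSpace ℝ E₂] [CompleteSpace E₂]
    [NormedAddCommGroup F] [NormedSpace ℝ F] [CompleteSpace F]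
    {f : E₁ × E₂ → F} {u : E₁ × E₂} (hf : ∀ᶠ v in 𝓝 u, ContDiffAt ℝ ∞ f v)
    (hinv : (fderiv ℝ f u ∘L .inr ℝ E₁ E₂).IsInvertible) :
    ∃ ψ : E₁ → E₂, ψ u.1 = u.2 ∧ (∀ᶠ x in 𝓝 u.1, ContDiffAt ℝ ∞ ψ x) ∧
      ∀ᶠ v in 𝓝 u, (f v = f u ↔ ψ v.1 = v.2) := by
  have h0 : (∞ : WithTop ℕ∞) ≠ 0 := by simp
  have hu := hf.self_of_nhds
  set ψ := hu.implicitFunction h0 hinv with hψ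
  have hψu : ψ u.1 = u.2 := hu.implicitFunction_apply_self h0 hinv
  have hiff := hu.eventually_apply_eq_iff_implicitFunction h0 hinv
  refine ⟨ψ, hψu, ?_, hiff⟩
  -- Smoothness of order `∞` at the single point `u.1` only gives, for each finite order, a
  -- neighborhood depending on that order. Smoothness at nearby `x` comes from the implicit function
  -- theorem at `(x, ψ x)`, whose implicit function coincides with `ψ` near `x`.
  have hsm := hu.contDiffAt_implicitFunction h0 hinv
  have hsm1 : ∀ᶠ x in 𝓝 u.1, ContDiffAt ℝ 1 ψ x :=
    (hsm.of_le (by norm_cast)).eventually (by norm_num)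
  have hinv' : ∀ᶠ v in 𝓝 u, (fderiv ℝ f v ∘L .inr ℝ E₁ E₂).IsInvertible := by
    have hc : ContinuousAt (fun v => fderiv ℝ f v ∘L .inr ℝ E₁ E₂) u := by
      have := (hu.fderiv_right (m := 0) (by norm_cast)).continuousAt
      exact this.clm_comp continuousAt_const
    obtain ⟨e, he⟩ := hinv
    have ho : range ((↑) : (E₂ ≃L[ℝ] F) → (E₂ →L[ℝ] F)) ∈ 𝓝 (fderiv ℝ f u ∘L .inr ℝ E₁ E₂) := by
      rw [← he]; exact ContinuousLinearEquiv.nhds e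
    exact hc.eventually ho
  have hcont : ContinuousAt (fun x => (x, ψ x)) u.1 :=
    continuousAt_id.prodMk hsm.continuousAt
  have hev : ∀ᶠ v in 𝓝 u, ContDiffAt ℝ ∞ f v ∧ (fderiv ℝ f v ∘L .inr ℝ E₁ E₂).IsInvertible ∧
      ∀ᶠ v' in 𝓝 v, (f v' = f u ↔ ψ v'.1 = v'.2) :=
    hf.and (hinv'.and hiff.eventually_nhds)
  have hu' : (u.1, ψ u.1) = u := by rw [hψu]
  have hev' := hcont.eventually (p := fun v => ContDiffAt ℝ ∞ f v ∧
      (fderiv ℝ f v ∘L .inr ℝ E₁ E₂).IsInvertible ∧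
      ∀ᶠ v' in 𝓝 v, (f v' = f u ↔ ψ v'.1 = v'.2)) (by
      beta_reduce; rw [hu']; exact hev)
  filter_upwards [hev', hsm1] with x hx hx1
  obtain ⟨hc, hi, hn⟩ := hx
  have hfx : f (x, ψ x) = f u := hn.self_of_nhds.2 rfl
  have hiff' := hc.eventually_apply_eq_iff_implicitFunction h0 hi
  have hcx : ContinuousAt (fun x => (x, ψ x)) x := continuousAt_id.prodMk hx1.continuousAt
  have hsx := hc.contDiffAt_implicitFunction h0 hi
  refine hsx.congr_of_eventuallyEq ?_
  filter_upwards [hcx.eventually hiff', hcx.eventually hn] with y hy hy'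
  exact (hy.1 ((hy'.2 rfl).trans hfx.symm)).symm

end Implicit

/-! ### Smoothness of superposition operators on spaces of continuous functions -/

section Superposition

universe u

/-- The superposition operator `α ↦ f ∘ α` on continuous functions. -/
def superposition (K : Type*) [TopologicalSpace K] {E F : Type*} [TopologicalSpace E]
    [TopologicalSpace F] (f : C(E, F)) (α : C(K, E)) : C(K, F) := f.comp α

/-- Pointwise application of a continuous family of operators, as a bounded bilinear operation. -/
def pointwiseApply (K : Type*) [TopologicalSpace K] [CompactSpace K] (E F : Type*)
    [NormedAddCommGroup E] [NormedSpace ℝ E] [NormedAddCommGroup F] [NormedSpace ℝ F] :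
    C(K, E →L[ℝ] F) →L[ℝ] C(K, E) →L[ℝ] C(K, F) :=
  LinearMap.mkContinuous₂
    (LinearMap.mk₂ ℝ (fun (A : C(K, E →L[ℝ] F)) (α : C(K, E)) =>
        (⟨fun k => A k (α k), A.continuous.clm_apply α.continuous⟩ : C(K, F)))
      (fun _ _ _ => by ext; simp) (fun _ _ _ => by ext; simp)
      (fun _ _ _ => by ext; simp) (fun _ _ _ => by ext; simp)) 1
    (fun A α => by
      rw [one_mul]
      refine (ContinuousMap.norm_le _ (by positivity)).2 fun k => ?_
      have h1 := A.norm_coe_le_norm k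
      have h2 := α.norm_coe_le_norm k
      exact ((A k).le_opNorm _).trans (by gcongr))

variable {K : Type*} [TopologicalSpace K] [CompactSpace K]

/-- The remainder is pointwise a Taylor remainder of `f`. It is at most `c ‖h‖` uniformly in `k` by
the mean value inequality on balls around `α k`, because `f'` is uniformly continuous near the
compact set `range α`. -/
theorem hasFDerivAt_superposition {E F : Type*}
    [NormedAddCommGroup E] [NormedSpace ℝ E] [NormedAddCommGroup F] [NormedSpace ℝ F]
    (f : C(E, F)) (f' : C(E, E →L[ℝ] F)) (hf : ∀ x, HasFDerivAt f (f' x) x) (α : C(K, E)) :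
    HasFDerivAt (superposition K f) (pointwiseApply K E F (superposition K f' α)) α := by
  rw [hasFDerivAt_iff_isLittleO_nhds_zero, Asymptotics.isLittleO_iff]
  intro c hc
  have hK : IsCompact (range α) := isCompact_range α.continuous
  have hU := hK.uniformContinuousAt_of_continuousAt f' (fun a _ => f'.continuous.continuousAt)
    (Metric.dist_mem_uniformity hc)
  obtain ⟨δ, hδ, hball⟩ := Metric.mem_uniformity_dist.1 hU
  filter_upwards [Metric.ball_mem_nhds (0 : C(K, E)) hδ] with h hh
  rw [mem_ball_zero_iff] at hh
  refine (ContinuousMap.norm_le _ (by positivity)).2 fun k => ?_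
  have hk : ‖h k‖ ≤ ‖h‖ := h.norm_coe_le_norm k
  have key := (convex_ball (α k) δ).norm_image_sub_le_of_norm_hasFDerivWithin_le' (f := f)
    (f' := f') (φ := f' (α k)) (C := c) (x := α k) (y := α k + h k)
    (fun x _ => (hf x).hasFDerivWithinAt)
    (fun x hx => by
      have := hball (a := α k) (b := x) (by rw [dist_comm]; exact hx) (mem_range_self k)
      rw [← dist_eq_norm, dist_comm]
      exact le_of_lt this)
    (Metric.mem_ball_self hδ)
    (by simp only [Metric.mem_ball, dist_self_add_left]; exact hk.trans_lt hh)
  rw [add_sub_cancel_left] at key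
  exact key.trans (mul_le_mul_of_nonneg_left hk hc.le)

/-- Induction on the order: the derivative is the superposition operator of `fderiv ℝ f` followed by
the bounded linear map `pointwiseApply`. A single universe for `E` and `F` lets the induction pass
from `F` to `E →L[ℝ] F`. -/
theorem contDiff_superposition_nat (m : ℕ) : ∀ {E F : Type u}
    [NormedAddCommGroup E] [NormedSpace ℝ E] [NormedAddCommGroup F] [NormedSpace ℝ F]
    (f : C(E, F)), ContDiff ℝ ∞ f → ContDiff ℝ m (superposition K f) := by
  induction m with
  | zero =>
    intro E F _ _ _ _ f hf
    exact contDiff_zero.2 (ContinuousMap.continuous_postcomp f)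
  | succ m ih =>
    intro E F _ _ _ _ f hf
    have hd : ContDiff ℝ ∞ (fderiv ℝ f) := hf.fderiv_right (by norm_cast)
    have h1 := ih ⟨fderiv ℝ f, hd.continuous⟩ hd
    push_cast
    refine contDiff_succ_iff_hasFDerivAt.2
      ⟨_, (pointwiseApply K E F).contDiff.comp h1, fun α => ?_⟩
    exact hasFDerivAt_superposition f ⟨fderiv ℝ f, hd.continuous⟩
      (fun x => (hf.differentiable (by simp) x).hasFDerivAt) α

theorem contDiff_superposition {E F : Type u}
    [NormedAddCommGroup E] [NormedSpace ℝ E] [NormedAddCommGroup F] [NormedSpace ℝ F]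
    (f : C(E, F)) (hf : ContDiff ℝ ∞ f) : ContDiff ℝ ∞ (superposition K f) :=
  contDiff_infty.2 fun m => contDiff_superposition_nat m f hf

end Superposition

/-! ### Integration as a bounded operator on `C([0, 1], E)` -/

section Primitive

variable {E : Type*} [NormedAddCommGroup E]

/-- Extension of a function on `[0, 1]` to a continuous function on `ℝ`. -/
def extendUnit (α : C(Icc (0 : ℝ) 1, E)) : ℝ → E := IccExtend zero_le_one α

theorem continuous_extendUnit (α : C(Icc (0 : ℝ) 1, E)) : Continuous (extendUnit α) :=
  α.continuous.Icc_extend'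

theorem extendUnit_of_mem (α : C(Icc (0 : ℝ) 1, E)) {s : ℝ} (hs : s ∈ Icc (0 : ℝ) 1) :
    extendUnit α s = α ⟨s, hs⟩ := IccExtend_of_mem _ _ hs

/-- The primitive `s ↦ ∫₀ˢ α` as a bounded operator. -/
def primitive (E : Type*) [NormedAddCommGroup E] [NormedSpace ℝ E] [CompleteSpace E] :
    C(Icc (0 : ℝ) 1, E) →L[ℝ] C(Icc (0 : ℝ) 1, E) :=
  LinearMap.mkContinuous
    { toFun := fun α => ⟨fun s => ∫ τ in (0 : ℝ)..s, extendUnit α τ,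
        (intervalIntegral.continuous_primitive
          (fun a b => (continuous_extendUnit α).intervalIntegrable a b) 0).comp
          continuous_subtype_val⟩
      map_add' := fun α β => by
        ext s
        exact intervalIntegral.integral_add
          ((continuous_extendUnit α).intervalIntegrable _ _)
          ((continuous_extendUnit β).intervalIntegrable _ _)
      map_smul' := fun c α => by
        ext s
        exact intervalIntegral.integral_smul c (extendUnit α) } 1
    (fun α => by
      rw [one_mul]
      refine (ContinuousMap.norm_le _ (norm_nonneg _)).2 fun s => ?_
      have := intervalIntegral.norm_integral_le_of_norm_le_const (a := 0) (b := (s : ℝ))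
        (f := extendUnit α) (C := ‖α‖) (fun x _ => α.norm_coe_le_norm _)
      refine this.trans (mul_le_of_le_one_right (norm_nonneg _) ?_)
      rw [sub_zero, abs_of_nonneg s.2.1]
      exact s.2.2)

end Primitive

/-! ### Smooth dependence of solutions on time and initial value -/

section ODE

universe u
variable {E : Type u} [NormedAddCommGroup E] [NormedSpace ℝ E] [FiniteDimensional ℝ E]

/-- With time rescaled to `[0, 1]`, solutions are zeros `α` of `x + t ∫ V(α) - α` in `C([0, 1], E)`.
At `t = 0` the derivative in `α` is `-id`, so the implicit function theorem gives `α` as a smooth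
function of `(t, x)`, for both signs of `t`. -/
theorem exists_smooth_local_solution_of_contDiff (V : E → E) (hV : ContDiff ℝ ∞ V) (x₀ : E)
    {O : Set E} (hO : O ∈ 𝓝 x₀) :
    ∃ A : ℝ × E → ℝ → E, (∀ᶠ w in 𝓝 ((0 : ℝ), x₀), ContDiffAt ℝ ∞ (fun w => A w 1) w) ∧
      ∀ᶠ w in 𝓝 ((0 : ℝ), x₀), A w 0 = w.2 ∧ ∀ s ∈ Icc (0 : ℝ) 1, A w s ∈ O ∧
        HasDerivWithinAt (A w) (w.1 • V (A w s)) (Icc 0 1) s := by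
  have : CompleteSpace E := FiniteDimensional.complete ℝ E
  let I := Icc (0 : ℝ) 1
  let S : C(I, E) → C(I, E) := superposition I ⟨V, hV.continuous⟩
  have hS : ContDiff ℝ ∞ S := contDiff_superposition _ hV
  let f : (ℝ × E) × C(I, E) → C(I, E) := fun v =>
    ContinuousLinearMap.const (R := ℝ) I v.1.2 + v.1.1 • primitive E (S v.2) - v.2
  have hf : ContDiff ℝ ∞ f := by
    have h1 : ContDiff ℝ ∞ fun v : (ℝ × E) × C(I, E) => primitive E (S v.2) :=
      (primitive E).contDiff.comp (hS.comp contDiff_snd)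
    have h2 : ContDiff ℝ ∞ fun v : (ℝ × E) × C(I, E) =>
        ContinuousLinearMap.const (R := ℝ) I v.1.2 :=
      (ContinuousLinearMap.contDiff (E := E) (F := C(I, E))
        (ContinuousLinearMap.const (R := ℝ) I)).comp (contDiff_snd.comp contDiff_fst)
    exact (h2.add ((contDiff_fst.comp contDiff_fst).smul h1)).sub contDiff_snd
  let u : (ℝ × E) × C(I, E) := ((0, x₀), .const I x₀)
  have hu : f u = 0 := by
    ext s
    simp [f, u]
  have hinv : (fderiv ℝ f u ∘L .inr ℝ (ℝ × E) C(I, E)).IsInvertible := by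
    have h1 : HasFDerivAt (fun α : C(I, E) => f ((0, x₀), α))
        (fderiv ℝ f u ∘L .inr ℝ (ℝ × E) C(I, E)) (.const I x₀) := by
      have h2 := (hf.differentiable (by simp) u).hasFDerivAt
      exact h2.comp (ContinuousMap.const I x₀) (hasFDerivAt_prodMk_right (𝕜 := ℝ) (0, x₀) _)
    have h3 : (fun α : C(I, E) => f ((0, x₀), α)) = fun α => .const I x₀ - α := by
      ext α s
      simp [f]
    rw [h3] at h1
    have h4 : HasFDerivAt (fun α : C(I, E) => .const I x₀ - α)
        (-(ContinuousLinearMap.id ℝ C(I, E))) (.const I x₀) :=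
      (hasFDerivAt_id _).const_sub _
    rw [h1.unique h4]
    exact ⟨ContinuousLinearEquiv.neg ℝ, by ext; simp⟩
  obtain ⟨ψ, hψ0, hψ, hiff⟩ := eventually_contDiffAt_implicitFunction
    (Eventually.of_forall fun v => hf.contDiffAt) hinv
  refine ⟨fun w => extendUnit (ψ w), ?_, ?_⟩
  · refine hψ.mono fun w hw => ?_
    have : (fun w => extendUnit (ψ w) 1) =
        (ContinuousMap.evalCLM (M := E) ℝ (⟨1, right_mem_Icc.2 zero_le_one⟩ : I)) ∘ ψ := by
      ext w
      exact extendUnit_of_mem _ _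
    rw [this]
    exact (ContinuousLinearMap.contDiff _).contDiffAt.comp w hw
  · have hψc : ContinuousAt ψ ((0 : ℝ), x₀) := hψ.self_of_nhds.continuousAt
    obtain ⟨ε, hε, hball⟩ := Metric.mem_nhds_iff.1 hO
    have hclose : ∀ᶠ w in 𝓝 ((0 : ℝ), x₀), ψ w ∈ Metric.ball (ContinuousMap.const I x₀) ε := by
      refine hψc.eventually (Metric.isOpen_ball.mem_nhds ?_)
      rw [show ψ (0, x₀) = _ from hψ0]
      exact Metric.mem_ball_self hε
    have hc2 : ContinuousAt (fun w => (w, ψ w)) ((0 : ℝ), x₀) := continuousAt_id.prodMk hψc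
    have hiff' := hc2.eventually (p := fun v => (f v = f u ↔ ψ v.1 = v.2)) (by
      have hu' : u = ((0, x₀), ψ (0, x₀)) := Prod.ext rfl hψ0.symm
      rw [hu'] at hiff ⊢; exact hiff)
    filter_upwards [hclose, hiff'] with w hw hw'
    have hfw : f (w, ψ w) = 0 := (hw'.2 rfl).trans hu
    have heq : ∀ s : I, ψ w s = w.2 + w.1 • ∫ τ in (0 : ℝ)..s, V (extendUnit (ψ w) τ) := by
      intro s
      have := DFunLike.congr_fun hfw s
      simp only [f, ContinuousMap.sub_apply, ContinuousMap.add_apply,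
        ContinuousMap.smul_apply] at this
      exact (sub_eq_zero.1 this).symm
    have hVc : Continuous fun τ => V (extendUnit (ψ w) τ) :=
      hV.continuous.comp (continuous_extendUnit _)
    refine ⟨?_, fun s hs => ⟨?_, ?_⟩⟩
    · rw [extendUnit_of_mem _ (left_mem_Icc.2 zero_le_one), heq]
      simp
    · rw [extendUnit_of_mem _ hs]
      refine hball ?_
      have := ContinuousMap.dist_apply_le_dist (f := ψ w) (g := .const I x₀) ⟨s, hs⟩
      exact this.trans_lt hw
    · have h1 : HasDerivAt (fun s => w.2 + w.1 • ∫ τ in (0 : ℝ)..s, V (extendUnit (ψ w) τ))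
          (w.1 • V (extendUnit (ψ w) s)) s := by
        refine HasDerivAt.const_add _ (HasDerivAt.const_smul _ ?_)
        exact intervalIntegral.integral_hasDerivAt_right (hVc.intervalIntegrable _ _)
          hVc.stronglyMeasurable.stronglyMeasurableAtFilter hVc.continuousAt
      refine h1.hasDerivWithinAt.congr_of_mem (fun s hs => ?_) hs
      rw [extendUnit_of_mem _ hs, heq]

theorem exists_smooth_local_solution {V : E → E} {O : Set E} (hO : IsOpen O)
    (hV : ContDiffOn ℝ ∞ V O) {x₀ : E} (hx₀ : x₀ ∈ O) :
    ∃ A : ℝ × E → ℝ → E, (∀ᶠ w in 𝓝 ((0 : ℝ), x₀), ContDiffAt ℝ ∞ (fun w => A w 1) w) ∧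
      ∀ᶠ w in 𝓝 ((0 : ℝ), x₀), A w 0 = w.2 ∧ ∀ s ∈ Icc (0 : ℝ) 1, A w s ∈ O ∧
        HasDerivWithinAt (A w) (w.1 • V (A w s)) (Icc 0 1) s := by
  obtain ⟨ε, hε, hball⟩ := Metric.isOpen_iff.1 hO x₀ hx₀
  -- `χ` is `1` on the ball of radius `ε / 3`, in which the solutions are kept, and vanishes outside
  -- the ball of radius `ε / 2`, so that `χ • V` is smooth on all of `E`.
  let χ : ContDiffBump x₀ := ⟨ε / 3, ε / 2, by positivity, by linarith⟩
  have hW : ContDiff ℝ ∞ fun x => χ x • V x := by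
    refine contDiff_iff_contDiffAt.2 fun x => ?_
    by_cases hx : x ∈ O
    · exact χ.contDiff.contDiffAt.smul (hV.contDiffAt (hO.mem_nhds hx))
    · have hx' : x ∈ (Metric.closedBall x₀ (ε / 2))ᶜ := fun h =>
        hx (hball (Metric.closedBall_subset_ball (by linarith) h))
      refine (contDiffAt_const (c := (0 : E))).congr_of_eventuallyEq ?_
      filter_upwards [Metric.isClosed_closedBall.isOpen_compl.mem_nhds hx'] with y hy
      rw [χ.zero_of_le_dist (le_of_lt (not_le.1 hy)), zero_smul]
  obtain ⟨A, h1, h2⟩ := exists_smooth_local_solution_of_contDiff _ hW x₀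
    (Metric.ball_mem_nhds x₀ (show 0 < ε / 3 by positivity))
  refine ⟨A, h1, h2.mono fun w hw => ⟨hw.1, fun s hs => ?_⟩⟩
  obtain ⟨hm, hd⟩ := hw.2 s hs
  refine ⟨hball (Metric.ball_subset_ball (by linarith) hm), ?_⟩
  rwa [χ.one_of_mem_closedBall (Metric.ball_subset_closedBall hm), one_smul] at hd

end ODE

/-! ### Geodesics in coordinates -/

/-- The Euclidean space `ℝⁿ`. -/
abbrev Euc (n : ℕ) := EuclideanSpace ℝ (Fin n)

section Spray

variable {E : Type*} [NormedAddCommGroup E] [NormedSpace ℝ E] [FiniteDimensional ℝ E]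

/-- A positive form is injective as a map from `E` to its dual, which has the same finite dimension.
-/
theorem isInvertible_of_pos {B : E →L[ℝ] E →L[ℝ] ℝ} (hB : ∀ u, u ≠ 0 → 0 < B u u) :
    B.IsInvertible := by
  have hinj : Function.Injective (B : E →ₗ[ℝ] E →L[ℝ] ℝ) := by
    refine (injective_iff_map_eq_zero _).2 fun u hu => ?_
    by_contra h
    have h1 := hB u h
    have h2 : B u = 0 := hu
    rw [h2] at h1
    simp at h1
  have hdim : Module.finrank ℝ E = Module.finrank ℝ (E →L[ℝ] ℝ) := by
    rw [← (LinearMap.toContinuousLinearMap (𝕜 := ℝ) (E := E) (F' := ℝ)).finrank_eq,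
      Module.finrank_linearMap, Module.finrank_self, mul_one]
  exact ⟨(LinearMap.linearEquivOfInjective _ hinj hdim).toContinuousLinearEquiv, by ext; rfl⟩

theorem contDiffOn_inverse {D : Type*} [NormedAddCommGroup D] [NormedSpace ℝ D]
    {F : Type*} [NormedAddCommGroup F] [NormedSpace ℝ F]
    {G : D → E →L[ℝ] F} {T : Set D} (hG : ContDiffOn ℝ ∞ G T)
    (hinv : ∀ y ∈ T, (G y).IsInvertible) : ContDiffOn ℝ ∞ (fun y => (G y).inverse) T := by
  have : CompleteSpace E := FiniteDimensional.complete ℝ E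
  intro y hy
  obtain ⟨e, he⟩ := hinv y hy
  have h := contDiffAt_map_inverse (𝕜 := ℝ) (n := ∞) e
  rw [he] at h
  exact h.comp_contDiffWithinAt y (hG y hy)

/-- The vector field on `E × E` of the geodesic equation of the metric `G` on `E`. -/
def sprayField (G : E → E →L[ℝ] E →L[ℝ] ℝ) (z : E × E) : E × E :=
  (z.2, (G z.1).inverse ((1 / 2 : ℝ) • ((fderiv ℝ G z.1).flip z.2).flip z.2 -
    fderiv ℝ G z.1 z.2 z.2))

theorem contDiffOn_sprayField {G : E → E →L[ℝ] E →L[ℝ] ℝ} {T : Set E} (hT : IsOpen T)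
    (hG : ContDiffOn ℝ ∞ G T) (hinv : ∀ y ∈ T, (G y).IsInvertible) :
    ContDiffOn ℝ ∞ (sprayField G) (T ×ˢ univ) := by
  have hm : MapsTo (Prod.fst : E × E → E) (T ×ˢ univ) T := fun z hz => hz.1
  have hfst : ContDiffOn ℝ ∞ (Prod.fst : E × E → E) (T ×ˢ univ) := contDiff_fst.contDiffOn
  have hsnd : ContDiffOn ℝ ∞ (Prod.snd : E × E → E) (T ×ˢ univ) := contDiff_snd.contDiffOn
  have hi := (contDiffOn_inverse hG hinv).comp hfst hm
  have hd : ContDiffOn ℝ ∞ (fun z : E × E => fderiv ℝ G z.1) (T ×ˢ univ) :=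
    (hG.fderiv_of_isOpen hT (by norm_cast)).comp hfst hm
  refine hsnd.prodMk (hi.clm_apply (ContDiffOn.sub (ContDiffOn.const_smul _ ?_) ?_))
  · refine contDiffOn_clm_apply.2 fun w => ?_
    exact ((hd.clm_apply contDiffOn_const).clm_apply hsnd).clm_apply hsnd
  · exact (hd.clm_apply hsnd).clm_apply hsnd

variable {G : E → E →L[ℝ] E →L[ℝ] ℝ} {c : ℝ → E} {t : ℝ}

/-- The second derivative of a geodesic. -/
theorem geodesic_equation (hc : ContDiffAt ℝ ∞ c t) (hG : ContDiffAt ℝ ∞ G (c t))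
    (heq : ∀ w, HasDerivAt (fun s => G (c s) (deriv c s) w)
      (1 / 2 * fderiv ℝ (fun y => G y (deriv c t) (deriv c t)) (c t) w) t) :
    HasDerivAt c (deriv c t) t ∧ HasDerivAt (deriv c) (deriv (deriv c) t) t ∧
    HasDerivAt (fun s => G (c s)) (fderiv ℝ G (c t) (deriv c t)) t ∧
    fderiv ℝ G (c t) (deriv c t) (deriv c t) + G (c t) (deriv (deriv c) t) =
      (1 / 2 : ℝ) • ((fderiv ℝ G (c t)).flip (deriv c t)).flip (deriv c t) := by
  have hc1 : HasDerivAt c (deriv c t) t := (hc.differentiableAt (by simp)).hasDerivAt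
  have hsm2 : ContDiffAt ℝ ∞ (deriv c) t :=
    (hc.fderiv_right (m := ∞) (by norm_cast)).clm_apply (contDiffAt_const (c := (1 : ℝ)))
  have hc2 : HasDerivAt (deriv c) (deriv (deriv c) t) t :=
    (hsm2.differentiableAt (by simp)).hasDerivAt
  have hG' : HasFDerivAt G (fderiv ℝ G (c t)) (c t) := (hG.differentiableAt (by simp)).hasFDerivAt
  have hGc : HasDerivAt (fun s => G (c s)) (fderiv ℝ G (c t) (deriv c t)) t :=
    hG'.comp_hasDerivAt t hc1
  refine ⟨hc1, hc2, hGc, ?_⟩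
  ext w
  have h1 : HasDerivAt (fun s => G (c s) (deriv c s) w)
      ((fderiv ℝ G (c t) (deriv c t) (deriv c t) + G (c t) (deriv (deriv c) t)) w) t := by
    have h2 := (hGc.clm_apply hc2).clm_apply (hasDerivAt_const t w)
    simpa using h2
  have h4 : fderiv ℝ (fun y => G y (deriv c t) (deriv c t)) (c t) w =
      fderiv ℝ G (c t) w (deriv c t) (deriv c t) := by
    rw [((hG'.clm_apply (hasFDerivAt_const (deriv c t) (c t))).clm_apply
      (hasFDerivAt_const (deriv c t) (c t))).fderiv]
    simp
  have h3 := heq w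
  rw [h4] at h3
  exact h1.unique h3

theorem hasDerivAt_sprayField (hc : ContDiffAt ℝ ∞ c t) (hG : ContDiffAt ℝ ∞ G (c t))
    (hinv : (G (c t)).IsInvertible)
    (heq : ∀ w, HasDerivAt (fun s => G (c s) (deriv c s) w)
      (1 / 2 * fderiv ℝ (fun y => G y (deriv c t) (deriv c t)) (c t) w) t) :
    HasDerivAt (fun s => (c s, deriv c s)) (sprayField G (c t, deriv c t)) t := by
  obtain ⟨hc1, hc2, -, h⟩ := geodesic_equation hc hG heq
  have h2 : deriv (deriv c) t = (sprayField G (c t, deriv c t)).2 := by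
    obtain ⟨e, he⟩ := hinv
    simp only [sprayField]
    rw [← h, ← he, ContinuousLinearMap.inverse_equiv]
    simp
  rw [h2] at hc2
  exact hc1.prodMk hc2

/-- Conservation of energy: evaluated on `ċ`, the geodesic equation reads `DG(ċ)(ċ, ċ) + 2 G(c̈, ċ)
= 0`, and the left side is the derivative in question. -/
theorem hasDerivAt_metric_deriv_self (hc : ContDiffAt ℝ ∞ c t) (hG : ContDiffAt ℝ ∞ G (c t))
    (hsymm : ∀ u w, G (c t) u w = G (c t) w u)
    (heq : ∀ w, HasDerivAt (fun s => G (c s) (deriv c s) w)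
      (1 / 2 * fderiv ℝ (fun y => G y (deriv c t) (deriv c t)) (c t) w) t) :
    HasDerivAt (fun s => G (c s) (deriv c s) (deriv c s)) 0 t := by
  obtain ⟨-, hc2, hGc, h⟩ := geodesic_equation hc hG heq
  refine ((hGc.clm_apply hc2).clm_apply hc2).congr_deriv ?_
  have h1 := congrArg (fun L : E →L[ℝ] ℝ => L (deriv c t)) h
  simp only [add_apply, smul_apply, ContinuousLinearMap.flip_apply, smul_eq_mul] at h1 ⊢
  rw [hsymm (deriv c t) (deriv (deriv c) t)]
  linarith

end Spray

/-! ### The tangent bundle and the metric in charts -/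

section Charts

variable {n : ℕ} {X : Type*} [TopologicalSpace X] [ChartedSpace (Euc n) X] [IsManifold (𝓡 n) ∞ X]

/-- The chart of the tangent bundle over the preferred chart around `x₀`. -/
def tanChart (x₀ : X) : PartialEquiv (TangentBundle (𝓡 n) X) (Euc n × Euc n) :=
  extChartAt (𝓡 n).tangent (⟨x₀, 0⟩ : TangentBundle (𝓡 n) X)

theorem mem_tanChart_source {x₀ : X} {q : TangentBundle (𝓡 n) X} :
    q ∈ (tanChart (n := n) x₀).source ↔ q.proj ∈ (extChartAt (𝓡 n) x₀).source := by
  rw [tanChart, extChartAt_source, TangentBundle.mem_chart_source_iff, extChartAt_source]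

theorem mem_tanChart_target {x₀ : X} {z : Euc n × Euc n} :
    z ∈ (tanChart (n := n) x₀).target ↔ z.1 ∈ (extChartAt (𝓡 n) x₀).target := by
  rw [tanChart, extChartAt_target, extChartAt_target]
  have h := TangentBundle.mem_chart_target_iff (I := 𝓡 n) z (⟨x₀, 0⟩ : TangentBundle (𝓡 n) X)
  simp only [mfld_simps]
  exact ⟨fun hz => h.1 hz.1, fun hz => ⟨h.2 hz, z, rfl⟩⟩

theorem isOpen_tanChart_source (x₀ : X) : IsOpen (tanChart (n := n) x₀).source :=
  isOpen_extChartAt_source _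

theorem isOpen_tanChart_target (x₀ : X) : IsOpen (tanChart (n := n) x₀).target :=
  isOpen_extChartAt_target _

theorem tanChart_apply {x₀ : X} {q : TangentBundle (𝓡 n) X}
    (h : q.proj ∈ (extChartAt (𝓡 n) x₀).source) :
    tanChart x₀ q = (extChartAt (𝓡 n) x₀ q.proj,
      mfderiv (𝓡 n) 𝓘(ℝ, Euc n) (extChartAt (𝓡 n) x₀) q.proj q.snd) := by
  rw [extChartAt_source] at h
  have h1 := tangentMap_chart (I := 𝓡 n) (p := (⟨x₀, 0⟩ : TangentBundle (𝓡 n) X)) h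
  have h2 := congrArg (Bundle.TotalSpace.toProd _ _) h1
  rw [Equiv.apply_symm_apply] at h2
  exact h2.symm

theorem tanChart_symm_apply {x₀ : X} {z : Euc n × Euc n}
    (h : z.1 ∈ (extChartAt (𝓡 n) x₀).target) :
    (tanChart x₀).symm z = ⟨(extChartAt (𝓡 n) x₀).symm z.1,
      mfderiv 𝓘(ℝ, Euc n) (𝓡 n) (extChartAt (𝓡 n) x₀).symm z.1 z.2⟩ := by
  have h' : z.1 ∈ (chartAt (Euc n) x₀).target := by
    rw [extChartAt_target] at h; exact h.1
  exact (tangentMap_chart_symm (I := 𝓡 n) (p := (⟨x₀, 0⟩ : TangentBundle (𝓡 n) X))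
    (q := ⟨z.1, z.2⟩) h').symm

theorem contMDiffOn_tanChart (x₀ : X) :
    ContMDiffOn (𝓡 n).tangent 𝓘(ℝ, Euc n × Euc n) ∞ (tanChart (n := n) x₀)
      (tanChart (n := n) x₀).source := by
  have h := contMDiffOn_extChartAt (I := (𝓡 n).tangent) (n := ∞)
    (x := (⟨x₀, 0⟩ : TangentBundle (𝓡 n) X))
  rw [tanChart, extChartAt_source]
  exact h

theorem contMDiffOn_tanChart_symm (x₀ : X) :
    ContMDiffOn 𝓘(ℝ, Euc n × Euc n) (𝓡 n).tangent ∞ (tanChart (n := n) x₀).symm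
      (tanChart (n := n) x₀).target :=
  contMDiffOn_extChartAt_symm _

/-- The quadratic form `p ↦ g(p, p)` on the tangent bundle. -/
def energy (g : Metric n X) (p : TangentBundle (𝓡 n) X) : ℝ := g.inner p.proj p.snd p.snd

theorem contMDiff_energy (g : Metric n X) : ContMDiff (𝓡 n).tangent 𝓘(ℝ, ℝ) ∞ (energy g) := by
  intro p
  have h1 : ContMDiffAt (𝓡 n).tangent ((𝓡 n).prod 𝓘(ℝ, Euc n →L[ℝ] Euc n →L[ℝ] ℝ)) ∞
      (fun q : TangentBundle (𝓡 n) X => TotalSpace.mk' (Euc n →L[ℝ] Euc n →L[ℝ] ℝ)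
        (E := fun x : X => TangentSpace (𝓡 n) x →L[ℝ] TangentSpace (𝓡 n) x →L[ℝ] ℝ)
        q.proj (g.inner q.proj)) p :=
    g.contMDiff.contMDiffAt.comp p (contMDiff_proj (TangentSpace (𝓡 n))).contMDiffAt
  have : ContMDiffAt (𝓡 n).tangent ((𝓡 n).prod 𝓘(ℝ)) ∞
      (fun m : TangentBundle (𝓡 n) X ↦
        TotalSpace.mk' ℝ (E := Bundle.Trivial X ℝ) m.proj (g.inner m.proj m.snd m.snd)) p := by
    apply ContMDiffAt.clm_bundle_apply₂ (F₁ := Euc n) (F₂ := Euc n)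
      (E₁ := fun x : X => TangentSpace (𝓡 n) x) (E₂ := fun x : X => TangentSpace (𝓡 n) x) h1
    · exact contMDiffAt_id
    · exact contMDiffAt_id
  simp only [Bundle.contMDiffAt_totalSpace] at this
  exact this.2

/-- The derivative of the inverse of the preferred chart around `x₀`. -/
def chartDeriv (x₀ : X) (y : Euc n) : Euc n →L[ℝ] Euc n :=
  mfderiv 𝓘(ℝ, Euc n) (𝓡 n) (extChartAt (𝓡 n) x₀).symm y

/-- The metric at `x`, as a bilinear form on `ℝⁿ`. -/
def innerForm (g : Metric n X) (x : X) : Euc n →L[ℝ] Euc n →L[ℝ] ℝ := g.inner x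

/-- The matrix `g_{ij}(y)` in the preferred chart around `x₀`, as a bilinear form. -/
def metricForm (g : Metric n X) (x₀ : X) (y : Euc n) : Euc n →L[ℝ] Euc n →L[ℝ] ℝ :=
  (innerForm g ((extChartAt (𝓡 n) x₀).symm y)).bilinearComp (chartDeriv x₀ y) (chartDeriv x₀ y)

theorem metricForm_symm (g : Metric n X) (x₀ : X) (y u w : Euc n) :
    metricForm g x₀ y u w = metricForm g x₀ y w u := g.symm _ _ _

theorem metricForm_self (g : Metric n X) {x₀ : X} {y : Euc n}
    (hy : y ∈ (extChartAt (𝓡 n) x₀).target) (u : Euc n) :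
    metricForm g x₀ y u u = energy g ((tanChart x₀).symm (y, u)) := by
  rw [tanChart_symm_apply (z := (y, u)) hy]
  rfl

theorem metricForm_tanChart (g : Metric n X) {x₀ : X} {p : TangentBundle (𝓡 n) X}
    (hp : p.proj ∈ (extChartAt (𝓡 n) x₀).source) :
    metricForm g x₀ (tanChart x₀ p).1 (tanChart x₀ p).2 (tanChart x₀ p).2 = energy g p := by
  have h := mem_tanChart_source.2 hp
  rw [metricForm_self g (mem_tanChart_target.1 ((tanChart x₀).map_source h)), Prod.mk.eta,
    (tanChart x₀).left_inv h]

/-- The diagonal values are the energy read in the bundle chart, hence smooth in `y`. Polarization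
gives all entries, which suffices in finite dimension. -/
theorem contDiffOn_metricForm (g : Metric n X) (x₀ : X) :
    ContDiffOn ℝ ∞ (metricForm g x₀) (extChartAt (𝓡 n) x₀).target := by
  have hQ : ∀ u, ContDiffOn ℝ ∞ (fun y => metricForm g x₀ y u u) (extChartAt (𝓡 n) x₀).target := by
    intro u
    have h1 : ContMDiffOn 𝓘(ℝ, Euc n × Euc n) 𝓘(ℝ, ℝ) ∞ (energy g ∘ (tanChart x₀).symm)
        (tanChart (n := n) x₀).target :=
      (contMDiff_energy g).comp_contMDiffOn (contMDiffOn_tanChart_symm x₀)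
    have h2 : ContDiffOn ℝ ∞ (fun y : Euc n => (y, u)) (extChartAt (𝓡 n) x₀).target :=
      (contDiff_id.prodMk contDiff_const).contDiffOn
    refine (h1.contDiffOn.comp h2 fun y hy => mem_tanChart_target.2 hy).congr fun y hy => ?_
    exact metricForm_self g hy u
  refine contDiffOn_clm_apply.2 fun u => contDiffOn_clm_apply.2 fun w => ?_
  refine ((((hQ (u + w)).sub (hQ u)).sub (hQ w)).const_smul (1 / 2 : ℝ)).congr fun y _ => ?_
  simp only [map_add, add_apply, metricForm_symm g x₀ y w u, smul_eq_mul]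
  ring

/-- If the chart derivative killed `u`, then the inverse bundle chart would send `(y, u)` and `(y,
0)` to the same vector, but it is injective on its target. -/
theorem metricForm_pos (g : Metric n X) {x₀ : X} {y : Euc n}
    (hy : y ∈ (extChartAt (𝓡 n) x₀).target) {u : Euc n} (hu : u ≠ 0) :
    0 < metricForm g x₀ y u u := by
  refine g.pos _ _ fun h => hu ?_
  have h1 := tanChart_symm_apply (x₀ := x₀) (z := (y, u)) hy
  have h2 := tanChart_symm_apply (x₀ := x₀) (z := (y, 0)) hy
  have h3 : (tanChart (n := n) x₀).symm (y, u) = (tanChart x₀).symm (y, 0) := by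
    rw [h1, h2]
    exact congrArg (fun v : TangentSpace (𝓡 n) ((extChartAt (𝓡 n) x₀).symm y) =>
      (⟨_, v⟩ : TangentBundle (𝓡 n) X)) (h.trans (map_zero (chartDeriv x₀ y)).symm)
  have h4 := (tanChart (n := n) x₀).symm.injOn (mem_tanChart_target.2 hy)
    (mem_tanChart_target.2 hy) h3
  exact congrArg Prod.snd h4

theorem metricForm_isInvertible (g : Metric n X) {x₀ : X} {y : Euc n}
    (hy : y ∈ (extChartAt (𝓡 n) x₀).target) : (metricForm g x₀ y).IsInvertible :=
  isInvertible_of_pos fun _ hu => metricForm_pos g hy hu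

/-- The vector field on `ℝⁿ × ℝⁿ` of the geodesic equation in the preferred chart around `x₀`. -/
def geodesicField (g : Metric n X) (x₀ : X) : Euc n × Euc n → Euc n × Euc n :=
  sprayField (metricForm g x₀)

theorem contDiffOn_geodesicField (g : Metric n X) (x₀ : X) :
    ContDiffOn ℝ ∞ (geodesicField g x₀) (tanChart (n := n) x₀).target :=
  (contDiffOn_sprayField (isOpen_extChartAt_target x₀) (contDiffOn_metricForm g x₀)
    fun _ hy => metricForm_isInvertible g hy).mono fun _ hz => ⟨mem_tanChart_target.1 hz, trivial⟩

end Charts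

/-! ### Velocity curves of geodesics -/

section Geodesics

variable {n : ℕ} {X : Type*} [TopologicalSpace X] [ChartedSpace (Euc n) X] [IsManifold (𝓡 n) ∞ X]

theorem tanChart_velocity {γ : ℝ → X} {t : ℝ} (hγ : MDifferentiableAt 𝓘(ℝ, ℝ) (𝓡 n) γ t)
    {x₀ : X} (ht : γ t ∈ (extChartAt (𝓡 n) x₀).source) :
    tanChart x₀ (velocity γ t) = (extChartAt (𝓡 n) x₀ (γ t),
      deriv (fun s => extChartAt (𝓡 n) x₀ (γ s)) t) := by
  rw [tanChart_apply (q := velocity γ t) ht]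
  refine Prod.ext rfl ?_
  have h1 : MDifferentiableAt (𝓡 n) 𝓘(ℝ, Euc n) (extChartAt (𝓡 n) x₀) (γ t) :=
    mdifferentiableAt_extChartAt (by rwa [extChartAt_source] at ht)
  have h2 := mfderiv_comp t h1 hγ
  rw [mfderiv_eq_fderiv] at h2
  have h3 := congrArg (fun L : ℝ →L[ℝ] Euc n => L 1) h2
  exact h3.symm

variable {g : Metric n X} {γ : ℝ → X}

theorem IsGeodesic.mdifferentiableAt (h : IsGeodesic g γ) (t : ℝ) :
    MDifferentiableAt 𝓘(ℝ, ℝ) (𝓡 n) γ t := (h.1 t).mdifferentiableAt (by simp)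

theorem IsGeodesic.continuous (h : IsGeodesic g γ) : Continuous γ := h.1.continuous

theorem IsGeodesic.contDiffAt_coord (h : IsGeodesic g γ) {x₀ : X} {t : ℝ}
    (ht : γ t ∈ (extChartAt (𝓡 n) x₀).source) :
    ContDiffAt ℝ ∞ (fun s => extChartAt (𝓡 n) x₀ (γ s)) t := by
  have h1 : ContMDiffAt (𝓡 n) 𝓘(ℝ, Euc n) ∞ (extChartAt (𝓡 n) x₀) (γ t) :=
    contMDiffAt_extChartAt' (by rwa [extChartAt_source] at ht)
  exact (h1.comp t (h.1 t)).contDiffAt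

theorem contDiffAt_metricForm (g : Metric n X) {x₀ x : X}
    (hx : x ∈ (extChartAt (𝓡 n) x₀).source) :
    ContDiffAt ℝ ∞ (metricForm g x₀) (extChartAt (𝓡 n) x₀ x) :=
  (contDiffOn_metricForm g x₀).contDiffAt
    ((isOpen_extChartAt_target x₀).mem_nhds ((extChartAt (𝓡 n) x₀).map_source hx))

theorem IsGeodesic.tanChart_eventuallyEq (h : IsGeodesic g γ) {x₀ : X} {t : ℝ}
    (ht : γ t ∈ (extChartAt (𝓡 n) x₀).source) :
    ∀ᶠ s in 𝓝 t, γ s ∈ (extChartAt (𝓡 n) x₀).source ∧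
      tanChart x₀ (velocity γ s) =
        (extChartAt (𝓡 n) x₀ (γ s), deriv (fun s => extChartAt (𝓡 n) x₀ (γ s)) s) := by
  filter_upwards [h.continuous.continuousAt.preimage_mem_nhds
    ((isOpen_extChartAt_source x₀).mem_nhds ht)] with s hs
  exact ⟨hs, tanChart_velocity (h.mdifferentiableAt s) hs⟩

/-- The second order equation becomes a first order autonomous one for the velocity, to which
uniqueness and smooth dependence apply. -/
theorem IsGeodesic.hasDerivAt_tanChart (h : IsGeodesic g γ) {x₀ : X} {t : ℝ}
    (ht : γ t ∈ (extChartAt (𝓡 n) x₀).source) :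
    HasDerivAt (fun s => tanChart x₀ (velocity γ s))
      (geodesicField g x₀ (tanChart x₀ (velocity γ t))) t := by
  have hev := h.tanChart_eventuallyEq ht
  refine HasDerivAt.congr_of_eventuallyEq ?_ (hev.mono fun s hs => hs.2)
  rw [hev.self_of_nhds.2]
  exact hasDerivAt_sprayField (h.contDiffAt_coord ht) (contDiffAt_metricForm g ht)
    (metricForm_isInvertible g ((extChartAt (𝓡 n) x₀).map_source ht)) (h.2 x₀ t ht)

theorem IsGeodesic.energy_velocity (h : IsGeodesic g γ) (s t : ℝ) :
    energy g (velocity γ s) = energy g (velocity γ t) := by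
  have key : ∀ t, HasDerivAt (fun s => energy g (velocity γ s)) 0 t := by
    intro t
    have ht : γ t ∈ (extChartAt (𝓡 n) (γ t)).source := mem_extChartAt_source _
    refine (hasDerivAt_metric_deriv_self (h.contDiffAt_coord ht)
      (contDiffAt_metricForm g ht) (fun u w => metricForm_symm g _ _ u w)
      (h.2 _ t ht)).congr_of_eventuallyEq ?_
    filter_upwards [h.tanChart_eventuallyEq ht] with s hs
    rw [← metricForm_tanChart g (p := velocity γ s) hs.1, hs.2]
  exact is_const_of_deriv_eq_zero (fun t => (key t).differentiableAt) (fun t => (key t).deriv) s t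

end Geodesics

/-! ### Germs of smooth maps -/

section Germs

variable {E₁ H₁ M₁ E₂ H₂ M₂ E₃ H₃ M₃ : Type*}
  [NormedAddCommGroup E₁] [NormedSpace ℝ E₁] [TopologicalSpace H₁]
  [TopologicalSpace M₁] [ChartedSpace H₁ M₁]
  [NormedAddCommGroup E₂] [NormedSpace ℝ E₂] [TopologicalSpace H₂]
  [TopologicalSpace M₂] [ChartedSpace H₂ M₂]
  [NormedAddCommGroup E₃] [NormedSpace ℝ E₃] [TopologicalSpace H₃]
  [TopologicalSpace M₃] [ChartedSpace H₃ M₃]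
  {I₁ : ModelWithCorners ℝ E₁ H₁} {I₂ : ModelWithCorners ℝ E₂ H₂} {I₃ : ModelWithCorners ℝ E₃ H₃}

/-- `f` is smooth in a neighborhood of `z`. -/
def SmoothNear (I₁ : ModelWithCorners ℝ E₁ H₁) (I₂ : ModelWithCorners ℝ E₂ H₂) (f : M₁ → M₂)
    (z : M₁) : Prop := ∀ᶠ z' in 𝓝 z, ContMDiffAt I₁ I₂ ∞ f z'

variable {f : M₁ → M₂} {z : M₁}

theorem SmoothNear.contMDiffAt (h : SmoothNear I₁ I₂ f z) : ContMDiffAt I₁ I₂ ∞ f z :=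
  Eventually.self_of_nhds h

theorem SmoothNear.continuousAt (h : SmoothNear I₁ I₂ f z) : ContinuousAt f z :=
  h.contMDiffAt.continuousAt

theorem SmoothNear.eventually (h : SmoothNear I₁ I₂ f z) : ∀ᶠ z' in 𝓝 z, SmoothNear I₁ I₂ f z' :=
  Eventually.eventually_nhds h

theorem SmoothNear.congr {f' : M₁ → M₂} (h : SmoothNear I₁ I₂ f z) (hf : f' =ᶠ[𝓝 z] f) :
    SmoothNear I₁ I₂ f' z := by
  filter_upwards [h, hf.eventually_nhds] with z' h1 h2
  exact h1.congr_of_eventuallyEq h2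

theorem SmoothNear.comp {k : M₂ → M₃} (hk : SmoothNear I₂ I₃ k (f z))
    (hf : SmoothNear I₁ I₂ f z) : SmoothNear I₁ I₃ (fun x => k (f x)) z := by
  filter_upwards [hf.continuousAt.eventually hk, hf] with z' h1 h2
  exact ContMDiffAt.comp z' h1 h2

theorem SmoothNear.prodMk {k : M₁ → M₃} (hf : SmoothNear I₁ I₂ f z)
    (hk : SmoothNear I₁ I₃ k z) : SmoothNear I₁ (I₂.prod I₃) (fun x => (f x, k x)) z := by
  filter_upwards [hf, hk] with z' h1 h2
  exact h1.prodMk h2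

theorem _root_.ContMDiff.smoothNear (h : ContMDiff I₁ I₂ ∞ f) : SmoothNear I₁ I₂ f z :=
  Eventually.of_forall h

theorem _root_.ContMDiffOn.smoothNear {U : Set M₁} (h : ContMDiffOn I₁ I₂ ∞ f U) (hU : IsOpen U)
    (hz : z ∈ U) : SmoothNear I₁ I₂ f z := by
  filter_upwards [hU.mem_nhds hz] with z' hz'
  exact h.contMDiffAt (hU.mem_nhds hz')

theorem SmoothNear.exists_open (h : SmoothNear I₁ I₂ f z) {p : M₁ → Prop} (hp : ∀ᶠ x in 𝓝 z, p x) :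
    ∃ U, IsOpen U ∧ z ∈ U ∧ ContMDiffOn I₁ I₂ ∞ f U ∧ ∀ x ∈ U, p x := by
  obtain ⟨U, hU, ho, hz⟩ := eventually_nhds_iff.1 (Eventually.and h hp)
  exact ⟨U, ho, hz, fun x hx => (hU x hx).1.contMDiffWithinAt, fun x hx => (hU x hx).2⟩

/-- With germs in place of open sets, local extensions can be composed and restricted by filter
arguments alone. -/
theorem smoothOn_iff {D : Set M₁} : SmoothOn I₁ I₂ f D ↔
    ∀ w ∈ D, ∃ h : M₁ → M₂, SmoothNear I₁ I₂ h w ∧ ∀ᶠ z in 𝓝 w, z ∈ D → h z = f z := by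
  refine forall₂_congr fun w _ => ⟨?_, ?_⟩
  · rintro ⟨U, hU, hw, h, hs, he⟩
    refine ⟨h, hs.smoothNear hU hw, ?_⟩
    filter_upwards [hU.mem_nhds hw] with z hz hD
    exact he z ⟨hz, hD⟩
  · rintro ⟨h, hs, he⟩
    obtain ⟨U, hU, hw, hs', he'⟩ := hs.exists_open he
    exact ⟨U, hU, hw, h, hs', fun z hz => he' z hz.1 hz.2⟩

theorem readsSmoothly_iff {Q Q' : Type*} {P : M₁ → Q → Prop} {P' : M₂ → Q' → Prop} {F : Q → Q'} :
    ReadsSmoothly I₁ I₂ P P' F ↔ ∀ w q w', P w q → P' w' (F q) →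
      ∃ θ : M₁ → M₂, SmoothNear I₁ I₂ θ w ∧ θ w = w' ∧
        ∀ᶠ z in 𝓝 w, ∀ r, P z r → P' (θ z) (F r) := by
  refine forall₅_congr fun w q w' _ _ => ⟨?_, ?_⟩
  · rintro ⟨U, hU, hw, θ, hs, h0, he⟩
    exact ⟨θ, hs.smoothNear hU hw, h0, by filter_upwards [hU.mem_nhds hw] using he⟩
  · rintro ⟨θ, hs, h0, he⟩
    obtain ⟨U, hU, hw, hs', he'⟩ := hs.exists_open he
    exact ⟨U, hU, hw, θ, hs', h0, he'⟩

end Germs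

/-! ### The geodesic flow -/

section Uniqueness

/-- A `C¹` field is Lipschitz on a neighborhood `W` of the common initial value, and both solutions
stay in `W` for a short time. Only right derivatives enter, so that solutions on `[0, 1]` can be
handled at the left endpoint too. -/
theorem eventually_eq_of_hasDerivWithinAt {E : Type*} [NormedAddCommGroup E] [NormedSpace ℝ E]
    {V : E → E} {f g : ℝ → E} {a : ℝ} (hV : ContDiffAt ℝ 1 V (f a)) {r : ℝ}
    (hf : ∀ᶠ s in 𝓝[≥] a, ContinuousWithinAt f (Ici a) s ∧
      HasDerivWithinAt f (r • V (f s)) (Ici s) s)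
    (hg : ∀ᶠ s in 𝓝[≥] a, ContinuousWithinAt g (Ici a) s ∧
      HasDerivWithinAt g (r • V (g s)) (Ici s) s) (hfg : f a = g a) :
    ∀ᶠ s in 𝓝[≥] a, f s = g s := by
  obtain ⟨K, W, hW, hK⟩ := hV.exists_lipschitzOnWith
  have hfW : ∀ᶠ s in 𝓝[≥] a, f s ∈ W := (hf.self_of_nhdsWithin self_mem_Ici).1 hW
  have hgW : ∀ᶠ s in 𝓝[≥] a, g s ∈ W :=
    (hg.self_of_nhdsWithin self_mem_Ici).1 (by rwa [← hfg])
  obtain ⟨b, hab, hb⟩ := (mem_nhdsGE_iff_exists_Icc_subset (a := a)).1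
    ((hf.and hg).and (hfW.and hgW))
  have hsub : Icc a b ⊆ Ici a := fun _ h => h.1
  have hres := ODE_solution_unique_of_mem_Icc_right (v := fun _ x => r • V x) (s := fun _ => W)
    (K := ‖r‖₊ * K) (f := f) (g := g) (a := a) (b := b)
    (fun t _ => LipschitzOnWith.of_dist_le_mul fun x hx y hy => by
      have h1 := hK.dist_le_mul x hx y hy
      rw [dist_smul₀, NNReal.coe_mul, coe_nnnorm, mul_assoc]
      exact mul_le_mul_of_nonneg_left h1 (norm_nonneg r))
    (fun t ht => (hb ht).1.1.1.mono hsub) (fun t ht => (hb (Ico_subset_Icc_self ht)).1.1.2)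
    (fun t ht => (hb (Ico_subset_Icc_self ht)).2.1)
    (fun t ht => (hb ht).1.2.1.mono hsub) (fun t ht => (hb (Ico_subset_Icc_self ht)).1.2.2)
    (fun t ht => (hb (Ico_subset_Icc_self ht)).2.2) hfg
  filter_upwards [Icc_mem_nhdsGE hab] with s hs using hres hs

end Uniqueness

/-! ### Uniqueness of geodesics and smoothness of the geodesic flow -/

section Flow

variable {n : ℕ} {X : Type*} [TopologicalSpace X] [ChartedSpace (Euc n) X] [IsManifold (𝓡 n) ∞ X]

theorem continuous_proj_tangentBundle :
    Continuous (TotalSpace.proj : TangentBundle (𝓡 n) X → X) :=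
  FiberBundle.continuous_proj (Euc n) _

/-- Vectors over distinct points are separated by the projection, vectors over the same point by a
chart. This makes sets of agreement closed and limits in the tangent bundle unique. -/
instance t2Space_tangentBundle [T2Space X] : T2Space (TangentBundle (𝓡 n) X) := by
  refine ⟨fun p q hpq => ?_⟩
  by_cases h : p.proj = q.proj
  · have hp : p ∈ (tanChart (n := n) p.proj).source :=
      mem_tanChart_source.2 (mem_extChartAt_source _)
    have hq : q ∈ (tanChart (n := n) p.proj).source :=
      mem_tanChart_source.2 (h ▸ mem_extChartAt_source _)
    obtain ⟨u, v, hu, hv, hpu, hqv, huv⟩ := t2_separation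
      (fun he => hpq ((tanChart (n := n) p.proj).injOn hp hq he))
    have hc := (contMDiffOn_tanChart (n := n) p.proj).continuousOn
    have ho := isOpen_tanChart_source (n := n) p.proj
    refine ⟨_, _, hc.isOpen_inter_preimage ho hu, hc.isOpen_inter_preimage ho hv,
      ⟨hp, hpu⟩, ⟨hq, hqv⟩, ?_⟩
    exact (huv.preimage _).mono inter_subset_right inter_subset_right
  · exact separated_by_continuous continuous_proj_tangentBundle h

variable {g : Metric n X} {γ : ℝ → X}

theorem IsGeodesic.continuous_velocity (h : IsGeodesic g γ) : Continuous (velocity (n := n) γ) := by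
  refine continuous_iff_continuousAt.2 fun t => ?_
  have ht : γ t ∈ (extChartAt (𝓡 n) (γ t)).source := mem_extChartAt_source _
  have hs : velocity (n := n) γ t ∈ (tanChart (n := n) (γ t)).source := mem_tanChart_source.2 ht
  have hc := (h.hasDerivAt_tanChart ht).continuousAt
  have hsymm : ContinuousAt (tanChart (n := n) (γ t)).symm
      (tanChart (γ t) (velocity γ t)) :=
    (contMDiffOn_tanChart_symm (γ t)).continuousOn.continuousAt
      ((isOpen_tanChart_target (γ t)).mem_nhds ((tanChart (γ t)).map_source hs))
  refine (ContinuousAt.comp (f := fun s => tanChart (γ t) (velocity γ s)) hsymm hc).congr ?_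
  filter_upwards [h.tanChart_eventuallyEq ht] with s hs
  exact (tanChart (γ t)).left_inv (mem_tanChart_source.2 hs.1)

/-- Solutions of the geodesic equation in charts agree with (rescaled) geodesics. -/
theorem IsGeodesic.eqOn_of_hasDerivWithinAt [T2Space X] (h : IsGeodesic g γ) {r : ℝ}
    {c : ℝ → TangentBundle (𝓡 n) X} (hc : ContinuousOn c (Icc 0 1))
    (hloc : ∀ s ∈ Ico (0 : ℝ) 1, ∃ x₀, ∀ᶠ s' in 𝓝[≥] s, (c s').proj ∈ (extChartAt (𝓡 n) x₀).source ∧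
      HasDerivWithinAt (fun s => tanChart x₀ (c s)) (r • geodesicField g x₀ (tanChart x₀ (c s')))
        (Ici s') s') (h0 : c 0 = velocity γ 0) :
    ∀ s ∈ Icc (0 : ℝ) 1, c s = velocity γ (r * s) := by
  have hv : Continuous fun s => velocity (n := n) γ (r * s) :=
    h.continuous_velocity.comp (continuous_const.mul continuous_id)
  have hcl : IsClosed ({s | c s = velocity γ (r * s)} ∩ Icc (0 : ℝ) 1) := by
    rw [inter_comm]
    exact (hc.prodMk hv.continuousOn).preimage_isClosed_of_isClosed isClosed_Icc isClosed_diagonal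
  -- Continuous induction on `[0, 1]`: the set of agreement is closed, contains `0`, and extends to
  -- the right of each of its points below `1` by local uniqueness in a chart.
  refine hcl.Icc_subset_of_forall_exists_gt (by simpa using h0) fun s hs y hy => ?_
  obtain ⟨x₀, hx⟩ := hloc s hs.2
  have hsrc : (c s).proj ∈ (extChartAt (𝓡 n) x₀).source :=
    (hx.self_of_nhdsWithin self_mem_Ici).1
  have hcs : c s = velocity γ (r * s) := hs.1
  have hsrc' : γ (r * s) ∈ (extChartAt (𝓡 n) x₀).source := by
    rw [hcs] at hsrc; exact hsrc
  have hV : ContDiffAt ℝ 1 (geodesicField g x₀) (tanChart x₀ (c s)) :=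
    ((contDiffOn_geodesicField g x₀).contDiffAt ((isOpen_tanChart_target x₀).mem_nhds
      ((tanChart x₀).map_source (mem_tanChart_source.2 hsrc)))).of_le (by norm_cast)
  have hmul : Tendsto (fun s => r * s) (𝓝[≥] s) (𝓝 (r * s)) :=
    ((continuous_const.mul continuous_id).tendsto s).mono_left nhdsWithin_le_nhds
  have hev2 : ∀ᶠ s' in 𝓝[≥] s, γ (r * s') ∈ (extChartAt (𝓡 n) x₀).source :=
    hmul.eventually (h.continuous.continuousAt.preimage_mem_nhds
      ((isOpen_extChartAt_source x₀).mem_nhds hsrc'))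
  have hIcc : ∀ᶠ s' in 𝓝[≥] s, s' ∈ Ico s 1 := Ico_mem_nhdsGE hs.2.2
  have hdsol : ∀ᶠ s' in 𝓝[≥] s, HasDerivAt (fun s => tanChart x₀ (velocity γ (r * s)))
      (r • geodesicField g x₀ (tanChart x₀ (velocity γ (r * s')))) s' := by
    filter_upwards [hev2] with s' hs'
    have h1 := h.hasDerivAt_tanChart hs'
    have h2 : HasDerivAt (fun s : ℝ => r * s) r s' := by
      simpa using (hasDerivAt_id s').const_mul r
    exact h1.scomp s' h2
  have hkey := eventually_eq_of_hasDerivWithinAt (f := fun s => tanChart x₀ (c s))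
    (g := fun s => tanChart x₀ (velocity γ (r * s))) hV (r := r) (a := s)
    (by
      filter_upwards [hx, hIcc] with s' h1 h2
      refine ⟨?_, h1.2⟩
      have hct : ContinuousWithinAt c (Ici s) s' := by
        refine (hc s' ⟨hs.2.1.trans h2.1, h2.2.le⟩).mono_of_mem_nhdsWithin ?_
        refine mem_nhdsWithin.2 ⟨Iio 1, isOpen_Iio, h2.2, fun a ha => ⟨hs.2.1.trans ha.2, ha.1.le⟩⟩
      have hK : ContinuousAt (tanChart (n := n) x₀) (c s') :=
        (contMDiffOn_tanChart x₀).continuousOn.continuousAt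
          ((isOpen_tanChart_source x₀).mem_nhds (mem_tanChart_source.2 h1.1))
      exact hK.comp_continuousWithinAt hct)
    (by
      filter_upwards [hdsol] with s' h1
      exact ⟨h1.continuousAt.continuousWithinAt, h1.hasDerivWithinAt⟩)
    (by simp only [hcs])
  have hfin : ∀ᶠ s' in 𝓝[≥] s, c s' = velocity γ (r * s') := by
    filter_upwards [hkey, hx, hev2] with s' h1 h2 h3
    exact (tanChart (n := n) x₀).injOn (mem_tanChart_source.2 h2.1) (mem_tanChart_source.2 h3) h1
  have hfin' : ∀ᶠ s' in 𝓝[>] s, c s' = velocity γ (r * s') :=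
    hfin.filter_mono (nhdsWithin_mono s Ioi_subset_Ici_self)
  obtain ⟨s', h1, h2⟩ := (hfin'.and (Ioc_mem_nhdsGT hy)).exists
  exact ⟨s', h1, h2⟩

/-- Multiplying time by `t` reduces the claim at time `t`, of either sign, to curves on `[0, 1]`. It
makes the choice in `geodesicFlow` immaterial. -/
theorem IsGeodesic.velocity_eq [T2Space X] (h : IsGeodesic g γ) {σ : ℝ → X} (hσ : IsGeodesic g σ)
    (h0 : velocity (n := n) σ 0 = velocity γ 0) (t : ℝ) :
    velocity (n := n) σ t = velocity γ t := by
  have hmul : Continuous fun s : ℝ => t * s := continuous_const.mul continuous_id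
  have := h.eqOn_of_hasDerivWithinAt (r := t) (c := fun s => velocity σ (t * s))
    (hσ.continuous_velocity.comp hmul).continuousOn (fun s _ => ⟨σ (t * s), ?_⟩)
    (by simpa using h0) 1 (right_mem_Icc.2 zero_le_one)
  · simpa using this
  · have hsrc : ∀ᶠ s' in 𝓝 s, σ (t * s') ∈ (extChartAt (𝓡 n) (σ (t * s))).source :=
      (hσ.continuous.comp hmul).continuousAt.preimage_mem_nhds (extChartAt_source_mem_nhds _)
    filter_upwards [hsrc.filter_mono nhdsWithin_le_nhds] with s' hs'
    refine ⟨hs', HasDerivAt.hasDerivWithinAt ?_⟩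
    have h2 : HasDerivAt (fun s : ℝ => t * s) t s' := by
      simpa using (hasDerivAt_id s').const_mul t
    exact (hσ.hasDerivAt_tanChart hs').scomp s' h2

theorem velocity_comp_add (hγ : ContMDiff 𝓘(ℝ, ℝ) (𝓡 n) ∞ γ) (a t : ℝ) :
    velocity (n := n) (fun s => γ (s + a)) t = velocity γ (t + a) := by
  have h1 : HasMFDerivAt 𝓘(ℝ, ℝ) 𝓘(ℝ, ℝ) (fun s : ℝ => s + a) t (ContinuousLinearMap.id ℝ ℝ) :=
    ((hasFDerivAt_id t).add_const a).hasMFDerivAt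
  have h2 : HasMFDerivAt 𝓘(ℝ, ℝ) (𝓡 n) γ (t + a) _ :=
    ((hγ (t + a)).mdifferentiableAt (by simp)).hasMFDerivAt
  have h3 := (h2.comp t h1).mfderiv
  simp only [velocity]
  congr 1
  exact congrArg (fun L : ℝ →L[ℝ] Euc n => L 1) h3

theorem IsGeodesic.comp_add (h : IsGeodesic g γ) (a : ℝ) : IsGeodesic g fun s => γ (s + a) := by
  refine ⟨h.1.comp (contDiff_id.add contDiff_const).contMDiff, fun x₀ t ht w => ?_⟩
  have h1 := h.2 x₀ (t + a) ht w
  simp only at h1 ⊢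
  have hd : ∀ s, deriv (fun s => extChartAt (𝓡 n) x₀ (γ (s + a))) s =
      deriv (fun s => extChartAt (𝓡 n) x₀ (γ s)) (s + a) := fun s =>
    deriv_comp_add_const (fun s => extChartAt (𝓡 n) x₀ (γ s)) a s
  simp only [hd]
  exact h1.comp_add_const t a

theorem IsGeodesic.geodesicFlow_eq [T2Space X] (h : IsGeodesic g γ) {p : TangentBundle (𝓡 n) X}
    (hp : velocity γ 0 = p) (t : ℝ) : geodesicFlow g (t, p) = velocity γ t := by
  have hex : ∃ γ : ℝ → X, IsGeodesic g γ ∧ velocity γ 0 = p := ⟨γ, h, hp⟩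
  simp only [geodesicFlow, dif_pos hex]
  exact h.velocity_eq hex.choose_spec.1 (hex.choose_spec.2.trans hp.symm) t

variable [T2Space X]

theorem geodesicFlow_zero (hg : IsComplete g) (p : TangentBundle (𝓡 n) X) :
    geodesicFlow g (0, p) = p := by
  obtain ⟨γ, hγ, hp⟩ := hg p
  rw [hγ.geodesicFlow_eq hp, hp]

theorem geodesicFlow_add (hg : IsComplete g) (s t : ℝ) (p : TangentBundle (𝓡 n) X) :
    geodesicFlow g (s + t, p) = geodesicFlow g (s, geodesicFlow g (t, p)) := by
  obtain ⟨γ, hγ, hp⟩ := hg p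
  rw [hγ.geodesicFlow_eq hp, hγ.geodesicFlow_eq hp, (hγ.comp_add t).geodesicFlow_eq,
    velocity_comp_add hγ.1]
  rw [velocity_comp_add hγ.1, zero_add]

theorem geodesicFlow_neg (hg : IsComplete g) (t : ℝ) (p : TangentBundle (𝓡 n) X) :
    geodesicFlow g (-t, geodesicFlow g (t, p)) = p := by
  rw [← geodesicFlow_add hg, neg_add_cancel, geodesicFlow_zero hg]

theorem geodesicFlow_neg' (hg : IsComplete g) (t : ℝ) (p : TangentBundle (𝓡 n) X) :
    geodesicFlow g (t, geodesicFlow g (-t, p)) = p := by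
  rw [← geodesicFlow_add hg, add_neg_cancel, geodesicFlow_zero hg]

theorem energy_geodesicFlow (hg : IsComplete g) (t : ℝ) (p : TangentBundle (𝓡 n) X) :
    energy g (geodesicFlow g (t, p)) = energy g p := by
  obtain ⟨γ, hγ, hp⟩ := hg p
  rw [hγ.geodesicFlow_eq hp, hγ.energy_velocity t 0, hp]

theorem geodesicFlow_mem_unitBundle (hg : IsComplete g) {t : ℝ} {p : TangentBundle (𝓡 n) X} :
    geodesicFlow g (t, p) ∈ unitBundle g ↔ p ∈ unitBundle g := by
  change energy g _ = 1 ↔ energy g p = 1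
  rw [energy_geodesicFlow hg]

theorem hasDerivAt_comp_geodesicFlow (hg : IsComplete g) {t : ℝ} {p : TangentBundle (𝓡 n) X}
    {ρ : X → ℝ} (hρ : MDifferentiableAt (𝓡 n) 𝓘(ℝ, ℝ) ρ (geodesicFlow g (t, p)).proj) :
    HasDerivAt (fun s => ρ (geodesicFlow g (s, p)).proj)
      (dirDeriv ρ (geodesicFlow g (t, p)).proj (geodesicFlow g (t, p)).snd) t := by
  obtain ⟨γ, hγ, hp⟩ := hg p
  have hfun : (fun s => ρ (geodesicFlow g (s, p)).proj) = ρ ∘ γ := by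
    ext s
    rw [hγ.geodesicFlow_eq hp]
    rfl
  rw [hγ.geodesicFlow_eq hp] at hρ ⊢
  rw [hfun]
  obtain ⟨L, hL, hL1⟩ : ∃ L : ℝ →L[ℝ] ℝ, HasFDerivAt (ρ ∘ γ) L t ∧
      L 1 = dirDeriv ρ (velocity (n := n) γ t).proj (velocity (n := n) γ t).snd :=
    ⟨_, (hρ.hasMFDerivAt.comp t (hγ.mdifferentiableAt t).hasMFDerivAt).hasFDerivAt, rfl⟩
  rw [← hL1]
  exact hL.hasDerivAt

/-- For short times the trajectory stays in one chart. There the flow at time `t` is the time-one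
value of the solution for the field scaled by `t`, as provided by `exists_smooth_local_solution`. -/
theorem smoothNear_geodesicFlow_zero (hg : IsComplete g) (p : TangentBundle (𝓡 n) X) :
    SmoothNear (timeModel n) (𝓡 n).tangent (geodesicFlow g) (0, p) := by
  set x₀ := p.proj with hx₀
  set K := tanChart (n := n) x₀ with hK
  have hp : p ∈ K.source := mem_tanChart_source.2 (mem_extChartAt_source _)
  obtain ⟨A, hA, hsol⟩ := exists_smooth_local_solution (isOpen_tanChart_target x₀)
    (contDiffOn_geodesicField g x₀) (K.map_source hp)
  have hKs : SmoothNear (𝓡 n).tangent 𝓘(ℝ, Euc n × Euc n) K p :=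
    (contMDiffOn_tanChart x₀).smoothNear (isOpen_tanChart_source x₀) hp
  have hpair : SmoothNear (timeModel n) 𝓘(ℝ, ℝ × (Euc n × Euc n))
      (fun w : ℝ × TangentBundle (𝓡 n) X => (w.1, K w.2)) (0, p) := by
    have h2 : SmoothNear (timeModel n) 𝓘(ℝ, Euc n × Euc n)
        (fun w : ℝ × TangentBundle (𝓡 n) X => K w.2) (0, p) :=
      SmoothNear.comp (f := fun w : ℝ × TangentBundle (𝓡 n) X => w.2) hKs
        contMDiff_snd.smoothNear
    filter_upwards [h2] with z hz
    exact contMDiffAt_fst.prodMk_space hz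
  have hA' : SmoothNear 𝓘(ℝ, ℝ × (Euc n × Euc n)) 𝓘(ℝ, Euc n × Euc n) (fun w => A w 1) (0, K p) :=
    hA.mono fun w hw => hw.contMDiffAt
  have hA0 : A (0, K p) 1 ∈ K.target :=
    (hsol.self_of_nhds.2 1 (right_mem_Icc.2 zero_le_one)).1
  have hsymm : SmoothNear 𝓘(ℝ, Euc n × Euc n) (𝓡 n).tangent K.symm (A (0, K p) 1) :=
    (contMDiffOn_tanChart_symm x₀).smoothNear (isOpen_tanChart_target x₀) hA0
  have hcomp := SmoothNear.comp (f := fun w : ℝ × TangentBundle (𝓡 n) X => A (w.1, K w.2) 1) hsymm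
    (SmoothNear.comp (k := fun w => A w 1) hA' hpair)
  refine hcomp.congr ?_
  have hsrc : ∀ᶠ w : ℝ × TangentBundle (𝓡 n) X in 𝓝 (0, p), w.2 ∈ K.source :=
    continuousAt_snd.preimage_mem_nhds ((isOpen_tanChart_source x₀).mem_nhds hp)
  filter_upwards [hpair.continuousAt.eventually hsol, hsrc] with w hw hws
  obtain ⟨γ, hγ, hγ0⟩ := hg w.2
  have hKc : ∀ s ∈ Icc (0 : ℝ) 1, K (K.symm (A (w.1, K w.2) s)) = A (w.1, K w.2) s :=
    fun s hs => K.right_inv (hw.2 s hs).1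
  have key := hγ.eqOn_of_hasDerivWithinAt (r := w.1) (c := fun s => K.symm (A (w.1, K w.2) s))
    (fun s hs => ?_) (fun s hs => ⟨x₀, ?_⟩) ?_ 1 (right_mem_Icc.2 zero_le_one)
  · rw [mul_one, ← hγ.geodesicFlow_eq hγ0] at key
    exact key.symm
  · have h1 : ContinuousAt K.symm (A (w.1, K w.2) s) :=
      (contMDiffOn_tanChart_symm x₀).continuousOn.continuousAt
        ((isOpen_tanChart_target x₀).mem_nhds (hw.2 s hs).1)
    exact h1.comp_continuousWithinAt (hw.2 s hs).2.continuousWithinAt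
  · filter_upwards [Ico_mem_nhdsGE hs.2] with s' hs'
    have hs1 : s' ∈ Icc (0 : ℝ) 1 := ⟨hs.1.trans hs'.1, hs'.2.le⟩
    refine ⟨mem_tanChart_source.1 (K.map_target (hw.2 s' hs1).1), ?_⟩
    rw [← hK, hKc s' hs1]
    have h1 : HasDerivWithinAt (fun s => K (K.symm (A (w.1, K w.2) s)))
        (w.1 • geodesicField g x₀ (A (w.1, K w.2) s')) (Icc 0 1) s' :=
      (hw.2 s' hs1).2.congr (fun a ha => hKc a ha) (hKc s' hs1)
    refine h1.mono_of_mem_nhdsWithin ?_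
    exact mem_nhdsWithin.2 ⟨Iio 1, isOpen_Iio, hs'.2, fun a ha => ⟨hs1.1.trans ha.2, ha.1.le⟩⟩
  · rw [hγ0]
    rw [hw.1]
    exact K.left_inv hws

/-- For fixed `p`, the times `t` such that the flow is smooth near `(t, p)` form a clopen subset of
`ℝ` containing `0`. -/
theorem smoothNear_geodesicFlow (hg : IsComplete g) (w : ℝ × TangentBundle (𝓡 n) X) :
    SmoothNear (timeModel n) (𝓡 n).tangent (geodesicFlow g) w := by
  obtain ⟨t, p⟩ := w
  let S : Set ℝ := {t | SmoothNear (timeModel n) (𝓡 n).tangent (geodesicFlow g) (t, p)}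
  have hopen : IsOpen S := isOpen_iff_mem_nhds.2 fun t ht =>
    (Continuous.prodMk_left p).continuousAt.eventually (SmoothNear.eventually ht)
  have hclosed : IsClosed S := by
    refine isClosed_iff_frequently.2 fun t ht => ?_
    obtain ⟨γ, hγ, hγ0⟩ := hg p
    -- For `t'` in the set and close to `t`, the point `(t - t', φ_{t'}(p))` is close to `(0,
    -- φ_t(p))`, where the flow is smooth. The group law `φ_τ = φ_{τ - t'} ∘ φ_{t'}` then gives
    -- smoothness near `(t, p)`.
    have hcont : Tendsto (fun t' => (t - t', geodesicFlow g (t', p))) (𝓝 t)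
        (𝓝 (0, geodesicFlow g (t, p))) := by
      refine Tendsto.prodMk_nhds ?_ ?_
      · have : Continuous fun t' : ℝ => t - t' := by fun_prop
        simpa using this.tendsto t
      · simp only [hγ.geodesicFlow_eq hγ0]
        exact hγ.continuous_velocity.tendsto t
    have hev := hcont.eventually (smoothNear_geodesicFlow_zero hg (geodesicFlow g (t, p))).eventually
    obtain ⟨t', h1, h2⟩ := (ht.and_eventually hev).exists
    have h3 : SmoothNear (timeModel n) (𝓡 n).tangent
        (fun w : ℝ × TangentBundle (𝓡 n) X => geodesicFlow g (t', w.2)) (t, p) := by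
      refine SmoothNear.comp (f := fun w : ℝ × TangentBundle (𝓡 n) X => ((t', w.2) : ℝ × _)) h1 ?_
      exact (contMDiff_const.prodMk contMDiff_snd).smoothNear
    have h4 : SmoothNear (timeModel n) 𝓘(ℝ, ℝ)
        (fun w : ℝ × TangentBundle (𝓡 n) X => w.1 - t') (t, p) :=
      ContMDiff.smoothNear fun w => contMDiffAt_fst.sub contMDiffAt_const
    refine (SmoothNear.comp (k := geodesicFlow g)
      (f := fun w : ℝ × TangentBundle (𝓡 n) X => (w.1 - t', geodesicFlow g (t', w.2))) h2
      (h4.prodMk h3)).congr ?_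
    refine Eventually.of_forall fun w => ?_
    change geodesicFlow g w = geodesicFlow g (w.1 - t', geodesicFlow g (t', w.2))
    rw [← geodesicFlow_add hg, sub_add_cancel]
  have huniv := IsClopen.eq_univ ⟨hclosed, hopen⟩ ⟨0, smoothNear_geodesicFlow_zero hg p⟩
  have ht : t ∈ S := by rw [huniv]; trivial
  exact ht

theorem continuous_geodesicFlow (hg : IsComplete g) : Continuous (geodesicFlow g) :=
  continuous_iff_continuousAt.2 fun w => (smoothNear_geodesicFlow hg w).continuousAt

end Flow

/-! ### Fiberwise operations on the tangent bundle -/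

section Fiberwise

variable {n : ℕ} {X : Type*} [TopologicalSpace X] [ChartedSpace (Euc n) X] [IsManifold (𝓡 n) ∞ X]

theorem tanChart_fst {x₀ : X} {p : TangentBundle (𝓡 n) X}
    (hp : p.proj ∈ (extChartAt (𝓡 n) x₀).source) :
    (tanChart x₀ p).1 = extChartAt (𝓡 n) x₀ p.proj := by rw [tanChart_apply hp]

theorem tanChart_snd_sub_smul {x₀ y : X} (hy : y ∈ (extChartAt (𝓡 n) x₀).source)
    (v w : TangentSpace (𝓡 n) y) (c : ℝ) :
    (tanChart (n := n) x₀ ⟨y, v - c • w⟩).2 = (tanChart (n := n) x₀ ⟨y, v⟩).2 -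
      c • (tanChart (n := n) x₀ ⟨y, w⟩).2 := by
  rw [tanChart_apply hy, tanChart_apply hy, tanChart_apply hy]
  exact (map_sub _ v (c • w)).trans (congrArg _ (map_smul _ c w))

theorem tanChart_snd_add {x₀ y : X} (hy : y ∈ (extChartAt (𝓡 n) x₀).source)
    (v w : TangentSpace (𝓡 n) y) :
    (tanChart (n := n) x₀ ⟨y, v + w⟩).2 = (tanChart (n := n) x₀ ⟨y, v⟩).2 +
      (tanChart (n := n) x₀ ⟨y, w⟩).2 := by
  rw [tanChart_apply hy, tanChart_apply hy, tanChart_apply hy]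
  exact map_add _ v w

theorem tanChart_snd_smul {x₀ y : X} (hy : y ∈ (extChartAt (𝓡 n) x₀).source)
    (v : TangentSpace (𝓡 n) y) (c : ℝ) :
    (tanChart (n := n) x₀ ⟨y, c • v⟩).2 = c • (tanChart (n := n) x₀ ⟨y, v⟩).2 := by
  rw [tanChart_apply hy, tanChart_apply hy]
  exact map_smul _ c v

theorem exists_tanChart_eq {x₀ y : X} (hy : y ∈ (extChartAt (𝓡 n) x₀).source) (w : Euc n) :
    ∃ v : TangentSpace (𝓡 n) y, (tanChart (n := n) x₀ ⟨y, v⟩).2 = w := by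
  have ht : (extChartAt (𝓡 n) x₀ y, w) ∈ (tanChart (n := n) x₀).target :=
    mem_tanChart_target.2 ((extChartAt (𝓡 n) x₀).map_source hy)
  have h1 := (tanChart (n := n) x₀).right_inv ht
  have h2 : ((tanChart (n := n) x₀).symm (extChartAt (𝓡 n) x₀ y, w)).proj = y := by
    rw [tanChart_symm_apply (mem_tanChart_target.1 ht)]
    exact (extChartAt (𝓡 n) x₀).left_inv hy
  generalize (tanChart (n := n) x₀).symm (extChartAt (𝓡 n) x₀ y, w) = q at h1 h2
  obtain ⟨y', v⟩ := q
  obtain rfl : y' = y := h2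
  exact ⟨v, congrArg Prod.snd h1⟩

theorem metricForm_tanChart_pair (g : Metric n X) {x₀ y : X}
    (hy : y ∈ (extChartAt (𝓡 n) x₀).source) (v w : TangentSpace (𝓡 n) y) :
    metricForm g x₀ (extChartAt (𝓡 n) x₀ y) (tanChart (n := n) x₀ ⟨y, v⟩).2
      (tanChart (n := n) x₀ ⟨y, w⟩).2 = g.inner y v w := by
  have h : ∀ u : TangentSpace (𝓡 n) y, metricForm g x₀ (extChartAt (𝓡 n) x₀ y)
      (tanChart (n := n) x₀ ⟨y, u⟩).2 (tanChart (n := n) x₀ ⟨y, u⟩).2 = g.inner y u u := by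
    intro u
    have := metricForm_tanChart g (x₀ := x₀) (p := ⟨y, u⟩) hy
    rwa [tanChart_fst (p := (⟨y, u⟩ : TangentBundle (𝓡 n) X)) hy] at this
  have h1 := h (v + w)
  have h2 := h v
  have h3 := h w
  rw [tanChart_snd_add hy] at h1
  simp only [map_add, add_apply] at h1
  rw [metricForm_symm g x₀ _ (tanChart (n := n) x₀ ⟨y, w⟩).2, g.symm y w v] at h1
  linarith

theorem smoothNear_of_tanChart {E H M : Type*} [NormedAddCommGroup E] [NormedSpace ℝ E]
    [TopologicalSpace H] [TopologicalSpace M] [ChartedSpace H M] {I : ModelWithCorners ℝ E H}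
    {f : M → TangentBundle (𝓡 n) X} {z : M} (x₀ : X) {k : M → Euc n × Euc n}
    (hk : SmoothNear I 𝓘(ℝ, Euc n × Euc n) k z)
    (hf : ∀ᶠ z' in 𝓝 z, (f z').proj ∈ (extChartAt (𝓡 n) x₀).source ∧ tanChart x₀ (f z') = k z') :
    SmoothNear I (𝓡 n).tangent f z := by
  have h0 := hf.self_of_nhds
  have hs : SmoothNear 𝓘(ℝ, Euc n × Euc n) (𝓡 n).tangent (tanChart (n := n) x₀).symm (k z) := by
    refine (contMDiffOn_tanChart_symm x₀).smoothNear (isOpen_tanChart_target x₀) ?_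
    rw [← h0.2]
    exact (tanChart x₀).map_source (mem_tanChart_source.2 h0.1)
  refine (SmoothNear.comp (f := k) hs hk).congr ?_
  filter_upwards [hf] with z' hz'
  rw [← hz'.2, (tanChart x₀).left_inv (mem_tanChart_source.2 hz'.1)]

theorem smoothNear_tanChart {x₀ : X} {p : TangentBundle (𝓡 n) X}
    (hp : p.proj ∈ (extChartAt (𝓡 n) x₀).source) :
    SmoothNear (𝓡 n).tangent 𝓘(ℝ, Euc n × Euc n) (tanChart (n := n) x₀) p :=
  (contMDiffOn_tanChart x₀).smoothNear (isOpen_tanChart_source x₀) (mem_tanChart_source.2 hp)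

theorem eventually_proj_mem {U : Set X} (hU : IsOpen U) {p : TangentBundle (𝓡 n) X}
    (hp : p.proj ∈ U) : ∀ᶠ q : TangentBundle (𝓡 n) X in 𝓝 p, q.proj ∈ U :=
  continuous_proj_tangentBundle.continuousAt.preimage_mem_nhds (hU.mem_nhds hp)

theorem energy_pos (g : Metric n X) {p : TangentBundle (𝓡 n) X} (hp : p.snd ≠ 0) :
    0 < energy g p := g.pos _ _ hp

theorem snd_ne_zero_of_mem_unitBundle {g : Metric n X} {p : TangentBundle (𝓡 n) X}
    (hp : p ∈ unitBundle g) : p.snd ≠ 0 := by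
  intro h
  have h1 : g.inner p.proj p.snd p.snd = 1 := hp
  rw [h] at h1
  simp at h1

theorem smoothNear_rescale (g : Metric n X) {p : TangentBundle (𝓡 n) X} (hp : p.snd ≠ 0) :
    SmoothNear (𝓡 n).tangent (𝓡 n).tangent (rescale g) p := by
  have hsrc : p.proj ∈ (extChartAt (𝓡 n) p.proj).source := mem_extChartAt_source _
  have hK := smoothNear_tanChart hsrc
  have hpos := energy_pos g hp
  have hE : ∀ᶠ q in 𝓝 p, 0 < energy g q :=
    (contMDiff_energy g).continuous.continuousAt.eventually (lt_mem_nhds hpos)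
  refine smoothNear_of_tanChart p.proj
    (k := fun q => ((tanChart p.proj q).1, (√(energy g q))⁻¹ • (tanChart p.proj q).2)) ?_ ?_
  · filter_upwards [hK, hE] with q hq hq'
    have hc : ContMDiffAt (𝓡 n).tangent 𝓘(ℝ, ℝ) ∞ (fun q => (√(energy g q))⁻¹) q := by
      have h1 : ContDiffAt ℝ ∞ (fun x : ℝ => (√x)⁻¹) (energy g q) :=
        (Real.contDiffAt_sqrt hq'.ne').inv (Real.sqrt_ne_zero'.2 hq')
      exact h1.contMDiffAt.comp q (contMDiff_energy g q)
    have h1 : ContMDiffAt (𝓡 n).tangent 𝓘(ℝ, Euc n) ∞ (fun q => (tanChart p.proj q).1) q :=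
      contDiff_fst.contMDiff.contMDiffAt.comp q hq
    have h2 : ContMDiffAt (𝓡 n).tangent 𝓘(ℝ, Euc n) ∞ (fun q => (tanChart p.proj q).2) q :=
      contDiff_snd.contMDiff.contMDiffAt.comp q hq
    exact h1.prodMk_space (hc.smul h2)
  · filter_upwards [eventually_proj_mem (isOpen_extChartAt_source p.proj) hsrc] with q hq
    refine ⟨hq, Prod.ext ?_ (tanChart_snd_smul hq _ _)⟩
    exact (tanChart_fst (p := rescale g q) hq).trans (tanChart_fst hq).symm

theorem rescale_of_mem_unitBundle {g : Metric n X} {p : TangentBundle (𝓡 n) X}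
    (hp : p ∈ unitBundle g) : rescale g p = p := by
  have h1 : g.inner p.proj p.snd p.snd = 1 := hp
  simp [rescale, h1]

theorem rescale_mem_unitBundle (g : Metric n X) {p : TangentBundle (𝓡 n) X} (hp : p.snd ≠ 0) :
    rescale g p ∈ unitBundle g := by
  have hpos : 0 < g.inner p.proj p.snd p.snd := energy_pos g hp
  change g.inner p.proj ((√(g.inner p.proj p.snd p.snd))⁻¹ • p.snd)
    ((√(g.inner p.proj p.snd p.snd))⁻¹ • p.snd) = 1
  simp only [map_smul, smul_apply, smul_eq_mul]
  rw [← mul_assoc, ← mul_inv, Real.mul_self_sqrt hpos.le]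
  exact inv_mul_cancel₀ hpos.ne'

theorem rescale_smul (g : Metric n X) {x : X} (v : TangentSpace (𝓡 n) x) {c : ℝ} (hc : 0 < c) :
    rescale g ⟨x, c • v⟩ = rescale g ⟨x, v⟩ := by
  have h1 : g.inner x (c • v) (c • v) = c ^ 2 * g.inner x v v := by
    simp only [map_smul, smul_apply, smul_eq_mul]; ring
  simp only [rescale, h1]
  rw [Real.sqrt_mul (by positivity), Real.sqrt_sq hc.le, smul_smul, mul_inv, mul_right_comm,
    inv_mul_cancel₀ hc.ne', one_mul]

theorem rescale_eq_smul (g : Metric n X) {p : TangentBundle (𝓡 n) X} (hp : p.snd ≠ 0) :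
    ∃ c : ℝ, 0 < c ∧ rescale g p = ⟨p.proj, c • p.snd⟩ :=
  ⟨_, inv_pos.2 (Real.sqrt_pos.2 (energy_pos g hp)), rfl⟩

theorem rescale_rescale (g g' : Metric n X) {p : TangentBundle (𝓡 n) X} (hp : p.snd ≠ 0) :
    rescale g' (rescale g p) = rescale g' p := by
  obtain ⟨c, hc, h⟩ := rescale_eq_smul g hp
  rw [h, rescale_smul g' p.snd hc]

theorem rescale_rescale_of_mem {g g' : Metric n X} {p : TangentBundle (𝓡 n) X}
    (hp : p ∈ unitBundle g) : rescale g (rescale g' p) = p := by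
  rw [rescale_rescale g' g (snd_ne_zero_of_mem_unitBundle hp), rescale_of_mem_unitBundle hp]

end Fiberwise

/-! ### Defining functions -/

section Defining

variable {n : ℕ} {X : Type*} [TopologicalSpace X] [ChartedSpace (Euc n) X] [IsManifold (𝓡 n) ∞ X]

theorem dirDeriv_eq_fderiv {ρ : X → ℝ} {x₀ y : X} (hy : y ∈ (extChartAt (𝓡 n) x₀).source)
    (hρ : MDifferentiableAt (𝓡 n) 𝓘(ℝ, ℝ) ρ y) (v : TangentSpace (𝓡 n) y) :
    dirDeriv ρ y v = fderiv ℝ (ρ ∘ (extChartAt (𝓡 n) x₀).symm) (extChartAt (𝓡 n) x₀ y)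
      (tanChart (n := n) x₀ ⟨y, v⟩).2 := by
  have h1 : MDifferentiableAt (𝓡 n) 𝓘(ℝ, Euc n) (extChartAt (𝓡 n) x₀) y :=
    mdifferentiableAt_extChartAt (by rwa [extChartAt_source] at hy)
  have h2 : MDifferentiableAt 𝓘(ℝ, Euc n) 𝓘(ℝ, ℝ) (ρ ∘ (extChartAt (𝓡 n) x₀).symm)
      (extChartAt (𝓡 n) x₀ y) := by
    have h3 : MDifferentiableAt 𝓘(ℝ, Euc n) (𝓡 n) (extChartAt (𝓡 n) x₀).symm
        (extChartAt (𝓡 n) x₀ y) :=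
      ((contMDiffOn_extChartAt_symm (I := 𝓡 n) (n := ∞) x₀).contMDiffAt
        ((isOpen_extChartAt_target x₀).mem_nhds
          ((extChartAt (𝓡 n) x₀).map_source hy))).mdifferentiableAt (by simp)
    refine MDifferentiableAt.comp _ ?_ h3
    rwa [(extChartAt (𝓡 n) x₀).left_inv hy]
  have h4 := mfderiv_comp y h2 h1
  have h5 : ρ =ᶠ[𝓝 y] (ρ ∘ (extChartAt (𝓡 n) x₀).symm) ∘ extChartAt (𝓡 n) x₀ := by
    filter_upwards [(isOpen_extChartAt_source x₀).mem_nhds hy] with y' hy'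
    exact (congrArg ρ ((extChartAt (𝓡 n) x₀).left_inv hy')).symm
  rw [← h5.mfderiv_eq, mfderiv_eq_fderiv] at h4
  rw [tanChart_apply hy]
  exact congrArg (fun L : Euc n →L[ℝ] ℝ => L v) h4

theorem smoothNear_dirDeriv {ρ : X → ℝ} {U : Set X} (hU : IsOpen U)
    (hρ : ContMDiffOn (𝓡 n) 𝓘(ℝ, ℝ) ∞ ρ U) {p : TangentBundle (𝓡 n) X} (hp : p.proj ∈ U) :
    SmoothNear (𝓡 n).tangent 𝓘(ℝ, ℝ)
      (fun q : TangentBundle (𝓡 n) X => dirDeriv ρ q.proj q.snd) p := by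
  have hsrc : p.proj ∈ (extChartAt (𝓡 n) p.proj).source := mem_extChartAt_source _
  have hK := smoothNear_tanChart hsrc
  let D : Euc n × Euc n → ℝ := fun z =>
    fderiv ℝ (ρ ∘ (extChartAt (𝓡 n) p.proj).symm) z.1 z.2
  have hD : ∀ᶠ q : TangentBundle (𝓡 n) X in 𝓝 p, ContDiffAt ℝ ∞ D (tanChart p.proj q) := by
    filter_upwards [eventually_proj_mem (isOpen_extChartAt_source p.proj) hsrc,
      eventually_proj_mem hU hp] with q h1 h2
    have h3 : ContMDiffAt 𝓘(ℝ, Euc n) 𝓘(ℝ, ℝ) ∞ (ρ ∘ (extChartAt (𝓡 n) p.proj).symm)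
        (extChartAt (𝓡 n) p.proj q.proj) := by
      have h4 := (contMDiffOn_extChartAt_symm (I := 𝓡 n) (n := ∞) p.proj).contMDiffAt
        ((isOpen_extChartAt_target p.proj).mem_nhds ((extChartAt (𝓡 n) p.proj).map_source h1))
      refine ContMDiffAt.comp _ ?_ h4
      rw [(extChartAt (𝓡 n) p.proj).left_inv h1]
      exact hρ.contMDiffAt (hU.mem_nhds h2)
    have h5 : ContDiffAt ℝ ∞ (fderiv ℝ (ρ ∘ (extChartAt (𝓡 n) p.proj).symm))
        (tanChart p.proj q).1 := by
      rw [tanChart_fst h1]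
      exact h3.contDiffAt.fderiv_right (by norm_cast)
    exact (h5.comp _ contDiffAt_fst).clm_apply contDiffAt_snd
  have hs : SmoothNear (𝓡 n).tangent 𝓘(ℝ, ℝ) (fun q => D (tanChart p.proj q)) p := by
    filter_upwards [hD, hK] with q h1 h2
    exact h1.contMDiffAt.comp q h2
  refine hs.congr ?_
  filter_upwards [eventually_proj_mem (isOpen_extChartAt_source p.proj) hsrc,
    eventually_proj_mem hU hp] with q h1 h2
  rw [dirDeriv_eq_fderiv h1 ((hρ.contMDiffAt (hU.mem_nhds h2)).mdifferentiableAt (by simp)),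
    ← tanChart_fst h1]

/-- `ρ` is a smooth function on the open set `U`, without critical points, and `Ω = {ρ ≤ 0}`
in `U`. -/
structure IsDefiningOn (n : ℕ) {X : Type*} [TopologicalSpace X] [ChartedSpace (Euc n) X]
    (Ω : Set X) (ρ : X → ℝ) (U : Set X) : Prop where
  isOpen : IsOpen U
  contMDiffOn : ContMDiffOn (𝓡 n) 𝓘(ℝ, ℝ) ∞ ρ U
  mem_iff : ∀ y ∈ U, (y ∈ Ω ↔ ρ y ≤ 0)
  mfderiv_ne_zero : ∀ y ∈ U, mfderiv (𝓡 n) 𝓘(ℝ, ℝ) ρ y ≠ 0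

/-- If `dρ(v) ≠ 0`, the same holds for all vectors near `v`. The projection of the bundle is open,
so their base points form an open set without critical points. -/
theorem IsObstacle.exists_isDefiningOn {Ω : Set X} (hΩ : IsObstacle n Ω) {x : X}
    (hx : x ∈ frontier Ω) : ∃ (ρ : X → ℝ) (U : Set X), x ∈ U ∧ IsDefiningOn n Ω ρ U := by
  obtain ⟨ρ, ⟨U, hU, hxU, hρ, hmem⟩, hne⟩ := hΩ.2 x hx
  obtain ⟨v, hv⟩ : ∃ v : TangentSpace (𝓡 n) x, dirDeriv ρ x v ≠ 0 := by
    by_contra! h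
    exact hne (ContinuousLinearMap.ext h)
  let p : TangentBundle (𝓡 n) X := ⟨x, v⟩
  have h1 : ∀ᶠ q : TangentBundle (𝓡 n) X in 𝓝 p, dirDeriv ρ q.proj q.snd ≠ 0 :=
    (smoothNear_dirDeriv hU hρ (p := p) hxU).continuousAt.eventually_ne hv
  have hopen : IsOpenMap (TotalSpace.proj : TangentBundle (𝓡 n) X → X) :=
    FiberBundle.isOpenMap_proj (Euc n) _
  obtain ⟨W, hW, hWo, hpW⟩ := eventually_nhds_iff.1 h1
  refine ⟨ρ, U ∩ TotalSpace.proj '' W, ⟨hxU, p, hpW, rfl⟩, hU.inter (hopen W hWo),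
    hρ.mono inter_subset_left, fun y hy => hmem y hy.1, ?_⟩
  rintro y ⟨-, q, hq, rfl⟩ h0
  refine hW q hq ?_
  simp only [dirDeriv, h0]
  rfl

variable {Ω : Set X} {ρ : X → ℝ} {U : Set X} {y : X}

theorem IsDefiningOn.contMDiffAt (h : IsDefiningOn n Ω ρ U) (hy : y ∈ U) :
    ContMDiffAt (𝓡 n) 𝓘(ℝ, ℝ) ∞ ρ y := h.contMDiffOn.contMDiffAt (h.isOpen.mem_nhds hy)

theorem IsDefiningOn.mdifferentiableAt (h : IsDefiningOn n Ω ρ U) (hy : y ∈ U) :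
    MDifferentiableAt (𝓡 n) 𝓘(ℝ, ℝ) ρ y := (h.contMDiffAt hy).mdifferentiableAt (by simp)

theorem IsDefiningOn.isDefiningFunctionAt (h : IsDefiningOn n Ω ρ U) (hy : y ∈ U) :
    IsDefiningFunctionAt n Ω y ρ :=
  ⟨⟨U, h.isOpen, hy, h.contMDiffOn, h.mem_iff⟩, h.mfderiv_ne_zero y hy⟩

theorem IsDefiningOn.exists_dirDeriv_ne_zero (h : IsDefiningOn n Ω ρ U) (hy : y ∈ U) :
    ∃ v : TangentSpace (𝓡 n) y, dirDeriv ρ y v ≠ 0 := by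
  by_contra! h'
  exact h.mfderiv_ne_zero y hy (ContinuousLinearMap.ext h')

theorem dirDeriv_add_smul (ρ : X → ℝ) (y : X) (v w : TangentSpace (𝓡 n) y) (c : ℝ) :
    dirDeriv ρ y (v + c • w) = dirDeriv ρ y v + c * dirDeriv ρ y w := by
  simp only [dirDeriv]
  refine (map_add _ v (c • w)).trans ?_
  congr 1
  exact map_smul _ c w

theorem dirDeriv_smul (ρ : X → ℝ) (y : X) (w : TangentSpace (𝓡 n) y) (c : ℝ) :
    dirDeriv ρ y (c • w) = c * dirDeriv ρ y w := map_smul _ c w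

end Defining

/-! ### The boundary, the normal and the tangential reflection -/

section Boundary

variable {n : ℕ} {X : Type*} [TopologicalSpace X] [ChartedSpace (Euc n) X] [IsManifold (𝓡 n) ∞ X]
  [T2Space X] {g : Metric n X} {Ω : Set X} {y : X}

theorem IsDefiningFunctionAt.mdifferentiableAt {ρ : X → ℝ} (h : IsDefiningFunctionAt n Ω y ρ) :
    MDifferentiableAt (𝓡 n) 𝓘(ℝ, ℝ) ρ y := by
  obtain ⟨⟨U, hU, hy, hρ, -⟩, -⟩ := h
  exact (hρ.contMDiffAt (hU.mem_nhds hy)).mdifferentiableAt (by simp)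

theorem IsDefiningFunctionAt.eventually_mem_iff {ρ : X → ℝ} (h : IsDefiningFunctionAt n Ω y ρ) :
    ∀ᶠ z in 𝓝 y, (z ∈ Ω ↔ ρ z ≤ 0) := by
  obtain ⟨⟨U, hU, hy, -, hm⟩, -⟩ := h
  filter_upwards [hU.mem_nhds hy] with z hz using hm z hz

theorem IsDefiningFunctionAt.eq_zero {ρ : X → ℝ} (h : IsDefiningFunctionAt n Ω y ρ)
    (hΩ : IsClosed Ω) (hy : y ∈ frontier Ω) : ρ y = 0 := by
  have h1 := h.eventually_mem_iff
  refine le_antisymm (h1.self_of_nhds.1 (hΩ.frontier_subset hy)) ?_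
  by_contra! hlt
  have h2 : ∀ᶠ z in 𝓝 y, z ∈ Ω := by
    filter_upwards [h1, h.mdifferentiableAt.continuousAt.eventually (gt_mem_nhds hlt)] with z h3 h4
    exact h3.2 h4.le
  exact hy.2 (mem_interior_iff_mem_nhds.2 h2)

theorem eventually_pos_of_hasDerivAt {f : ℝ → ℝ} {d : ℝ} (hf : HasDerivAt f d 0) (h0 : f 0 = 0)
    (hd : 0 < d) : ∀ᶠ s in 𝓝[>] (0 : ℝ), 0 < f s := by
  have h1 := (hasDerivAt_iff_tendsto_slope.1 hf).eventually (lt_mem_nhds hd)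
  have h2 := h1.filter_mono (nhdsWithin_mono (0 : ℝ) (fun s (hs : (0 : ℝ) < s) => hs.ne'))
  filter_upwards [h2, self_mem_nhdsWithin] with s hs hs0
  have hs0' : (0 : ℝ) < s := hs0
  rw [slope_def_field, h0, sub_zero, sub_zero] at hs
  exact (div_pos_iff_of_pos_right hs0').1 hs

theorem eventually_geodesic (hg : IsComplete g) {P : X → Prop} (hP : ∀ᶠ z in 𝓝 y, P z)
    (v : TangentSpace (𝓡 n) y) :
    ∀ᶠ s in 𝓝[>] (0 : ℝ), P (geodesicFlow g (s, (⟨y, v⟩ : TangentBundle (𝓡 n) X))).proj := by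
  have hc : Continuous fun s : ℝ =>
      (geodesicFlow g (s, (⟨y, v⟩ : TangentBundle (𝓡 n) X))).proj :=
    continuous_proj_tangentBundle.comp
      ((continuous_geodesicFlow hg).comp (Continuous.prodMk_left _))
  refine (hc.continuousAt.eventually ?_).filter_mono nhdsWithin_le_nhds
  beta_reduce
  rwa [geodesicFlow_zero hg]

theorem eventually_pos_geodesic (hg : IsComplete g) {ρ : X → ℝ}
    (hρ : MDifferentiableAt (𝓡 n) 𝓘(ℝ, ℝ) ρ y) (h0 : ρ y = 0) {v : TangentSpace (𝓡 n) y}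
    (hv : 0 < dirDeriv ρ y v) :
    ∀ᶠ s in 𝓝[>] (0 : ℝ),
      0 < ρ (geodesicFlow g (s, (⟨y, v⟩ : TangentBundle (𝓡 n) X))).proj := by
  have h1 := hasDerivAt_comp_geodesicFlow hg (t := 0) (p := ⟨y, v⟩) (ρ := ρ)
    (by rw [geodesicFlow_zero hg]; exact hρ)
  rw [geodesicFlow_zero hg] at h1
  exact eventually_pos_of_hasDerivAt h1 (by rw [geodesicFlow_zero hg]; exact h0) hv

theorem dirDeriv_neg (ρ : X → ℝ) (y : X) (w : TangentSpace (𝓡 n) y) :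
    dirDeriv ρ y (-w) = -dirDeriv ρ y w := map_neg _ w

/-- The geodesic in direction `v` is a test curve: if `ρ'` increases along it, it is outside `Ω` for
small positive times, whereas decreasing `ρ` would put it inside. -/
theorem IsDefiningFunctionAt.dirDeriv_nonpos (hg : IsComplete g) (hΩ : IsClosed Ω)
    (hy : y ∈ frontier Ω) {ρ ρ' : X → ℝ} (h : IsDefiningFunctionAt n Ω y ρ)
    (h' : IsDefiningFunctionAt n Ω y ρ') {v : TangentSpace (𝓡 n) y} (hv : 0 ≤ dirDeriv ρ' y v)
    (hv' : dirDeriv ρ' y v ≠ 0) : 0 ≤ dirDeriv ρ y v := by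
  by_contra! hlt
  have h1 := eventually_pos_geodesic hg h'.mdifferentiableAt (h'.eq_zero hΩ hy)
    (hv.lt_of_ne' hv')
  have h2 : MDifferentiableAt (𝓡 n) 𝓘(ℝ, ℝ) (-ρ) y := h.mdifferentiableAt.neg
  have h3 : dirDeriv (-ρ) y v = -dirDeriv ρ y v := by
    simp only [dirDeriv]
    rw [mfderiv_neg]
    rfl
  have h4 := eventually_pos_geodesic hg h2 (by simp [h.eq_zero hΩ hy]) (v := v)
    (by rw [h3]; linarith)
  obtain ⟨s, hs1, hs2, hs3, hs4⟩ := (h1.and (h4.and ((eventually_geodesic hg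
    h.eventually_mem_iff v).and (eventually_geodesic hg h'.eventually_mem_iff v)))).exists
  rw [Pi.neg_apply, Left.neg_pos_iff] at hs2
  exact absurd (hs4.1 (hs3.2 hs2.le)) (not_le.2 hs1)

/-- If `dρ(v) = 0`, then `v + ε w` with `dρ(w) < 0` and small `ε > 0` violates the weak inequality.
Consequently the sign of `dρ(v)`, and with it the tangent hyperplane and the inward side, do not
depend on the defining function. -/
theorem IsDefiningFunctionAt.dirDeriv_pos (hg : IsComplete g) (hΩ : IsClosed Ω)
    (hy : y ∈ frontier Ω) {ρ ρ' : X → ℝ} (h : IsDefiningFunctionAt n Ω y ρ)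
    (h' : IsDefiningFunctionAt n Ω y ρ') {v : TangentSpace (𝓡 n) y} (hv : 0 < dirDeriv ρ' y v) :
    0 < dirDeriv ρ y v := by
  refine (h.dirDeriv_nonpos hg hΩ hy h' hv.le hv.ne').lt_of_ne' fun h0 => ?_
  obtain ⟨w, hw⟩ : ∃ w : TangentSpace (𝓡 n) y, dirDeriv ρ y w < 0 := by
    obtain ⟨w, hw⟩ : ∃ w : TangentSpace (𝓡 n) y, dirDeriv ρ y w ≠ 0 := by
      by_contra! hcon
      exact h.2 (ContinuousLinearMap.ext hcon)
    rcases hw.lt_or_gt with hw | hw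
    · exact ⟨w, hw⟩
    · exact ⟨-w, by rw [dirDeriv_neg]; linarith⟩
  have hc : ∀ᶠ ε in 𝓝[>] (0 : ℝ), 0 < dirDeriv ρ' y v + ε * dirDeriv ρ' y w := by
    have : Continuous fun ε : ℝ => dirDeriv ρ' y v + ε * dirDeriv ρ' y w := by fun_prop
    exact (this.continuousAt.eventually (lt_mem_nhds (by simpa using hv))).filter_mono
      nhdsWithin_le_nhds
  obtain ⟨ε, hε, hε0⟩ := (hc.and self_mem_nhdsWithin).exists
  have hε0' : (0 : ℝ) < ε := hε0
  rw [← dirDeriv_add_smul] at hε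
  have h1 := h.dirDeriv_nonpos hg hΩ hy h' hε.le hε.ne'
  rw [dirDeriv_add_smul, h0] at h1
  nlinarith

theorem IsDefiningFunctionAt.dirDeriv_neg_of_neg (hg : IsComplete g) (hΩ : IsClosed Ω)
    (hy : y ∈ frontier Ω) {ρ ρ' : X → ℝ} (h : IsDefiningFunctionAt n Ω y ρ)
    (h' : IsDefiningFunctionAt n Ω y ρ') {v : TangentSpace (𝓡 n) y} (hv : dirDeriv ρ' y v < 0) :
    dirDeriv ρ y v < 0 := by
  have := h.dirDeriv_pos hg hΩ hy h' (v := -v) (by rw [dirDeriv_neg]; linarith)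
  rw [dirDeriv_neg] at this
  linarith

theorem IsDefiningFunctionAt.mem_boundaryTangent_iff (hg : IsComplete g) (hΩ : IsClosed Ω)
    (hy : y ∈ frontier Ω) {ρ : X → ℝ} (h : IsDefiningFunctionAt n Ω y ρ)
    {v : TangentSpace (𝓡 n) y} : v ∈ boundaryTangent Ω y ↔ dirDeriv ρ y v = 0 := by
  refine ⟨fun ⟨ρ', h', h0⟩ => ?_, fun h0 => ⟨ρ, h, h0⟩⟩
  by_contra hne
  rcases lt_or_gt_of_ne hne with hlt | hgt
  · exact (h'.dirDeriv_neg_of_neg hg hΩ hy h hlt).ne h0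
  · exact (h'.dirDeriv_pos hg hΩ hy h hgt).ne' h0

theorem exists_gradient (g : Metric n X) (ρ : X → ℝ) (y : X) :
    ∃ A : TangentSpace (𝓡 n) y, ∀ w, g.inner y A w = dirDeriv ρ y w := by
  have hinv : (innerForm g y).IsInvertible :=
    isInvertible_of_pos fun u hu => g.pos y u hu
  obtain ⟨e, he⟩ := hinv
  refine ⟨e.symm (mfderiv (𝓡 n) 𝓘(ℝ, ℝ) ρ y), fun w => ?_⟩
  have h1 : innerForm g y (e.symm (mfderiv (𝓡 n) 𝓘(ℝ, ℝ) ρ y)) =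
      mfderiv (𝓡 n) 𝓘(ℝ, ℝ) ρ y := by
    rw [← he]; exact e.apply_symm_apply _
  exact congrArg (fun L : Euc n →L[ℝ] ℝ => L w) h1

theorem inner_sub_smul (g : Metric n X) (y : X) (u v w : TangentSpace (𝓡 n) y) (c : ℝ) :
    g.inner y u (v - c • w) = g.inner y u v - c * g.inner y u w := by
  rw [map_sub, map_smul, smul_eq_mul]

theorem inner_sub_smul_left (g : Metric n X) (y : X) (u v w : TangentSpace (𝓡 n) y) (c : ℝ) :
    g.inner y (v - c • w) u = g.inner y v u - c * g.inner y w u := by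
  rw [g.symm, inner_sub_smul, g.symm y u v, g.symm y u w]

theorem dirDeriv_sub_smul (ρ : X → ℝ) (y : X) (v w : TangentSpace (𝓡 n) y) (c : ℝ) :
    dirDeriv ρ y (v - c • w) = dirDeriv ρ y v - c * dirDeriv ρ y w := by
  rw [sub_eq_add_neg, ← neg_smul, dirDeriv_add_smul]
  ring

theorem IsDefiningFunctionAt.exists_isInwardNormal (hg : IsComplete g) (hΩ : IsClosed Ω)
    (hy : y ∈ frontier Ω) {ρ : X → ℝ} (h : IsDefiningFunctionAt n Ω y ρ) :
    ∃ ν, IsInwardNormal g Ω y ν := by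
  obtain ⟨A, hA⟩ := exists_gradient g ρ y
  have hA0 : A ≠ 0 := by
    rintro rfl
    refine h.2 (ContinuousLinearMap.ext fun w => ?_)
    have := hA w
    rw [map_zero] at this
    exact this.symm
  have hpos := g.pos y A hA0
  have hs := Real.sqrt_pos.2 hpos
  refine ⟨(-(√(g.inner y A A))⁻¹) • A, ?_, fun u hu => ?_, ρ, h, ?_⟩
  · simp only [map_smul, smul_apply, smul_eq_mul]
    have := Real.mul_self_sqrt hpos.le
    field_simp
    nlinarith
  · simp only [map_smul, smul_apply, smul_eq_mul]
    rw [hA u, (h.mem_boundaryTangent_iff hg hΩ hy).1 hu, mul_zero]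
  · rw [dirDeriv_smul, ← hA]
    have := mul_pos (inv_pos.2 hs) hpos
    linarith

/-- The characteristic properties of the inward unit normal. -/
theorem IsDefiningFunctionAt.inwardNormal_spec (hg : IsComplete g) (hΩ : IsClosed Ω)
    (hy : y ∈ frontier Ω) {ρ : X → ℝ} (h : IsDefiningFunctionAt n Ω y ρ) :
    g.inner y (inwardNormal g Ω y) (inwardNormal g Ω y) = 1 ∧
      dirDeriv ρ y (inwardNormal g Ω y) < 0 ∧
      ∀ v, g.inner y v (inwardNormal g Ω y) * dirDeriv ρ y (inwardNormal g Ω y) =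
        dirDeriv ρ y v := by
  have hex := h.exists_isInwardNormal hg hΩ hy
  have hspec : IsInwardNormal g Ω y (inwardNormal g Ω y) := by
    rw [inwardNormal, dif_pos hex]
    exact hex.choose_spec
  obtain ⟨h1, h2, ρ', h', h3⟩ := hspec
  have h4 := h.dirDeriv_neg_of_neg hg hΩ hy h' h3
  refine ⟨h1, h4, fun v => ?_⟩
  set ν := inwardNormal g Ω y
  have h5 : v - (dirDeriv ρ y v / dirDeriv ρ y ν) • ν ∈ boundaryTangent Ω y := by
    rw [h.mem_boundaryTangent_iff hg hΩ hy, dirDeriv_sub_smul, div_mul_cancel₀ _ h4.ne, sub_self]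
  have h6 := h2 _ h5
  rw [inner_sub_smul, h1, mul_one, sub_eq_zero] at h6
  rw [g.symm, h6, div_mul_cancel₀ _ h4.ne]

theorem IsObstacle.inwardNormal_unit (hg : IsComplete g) (hΩ : IsObstacle n Ω)
    (hy : y ∈ frontier Ω) : g.inner y (inwardNormal g Ω y) (inwardNormal g Ω y) = 1 := by
  obtain ⟨ρ, h⟩ := hΩ.2 y hy
  exact (h.inwardNormal_spec hg hΩ.1 hy).1

theorem IsDefiningFunctionAt.inner_pos_iff (hg : IsComplete g) (hΩ : IsClosed Ω)
    (hy : y ∈ frontier Ω) {ρ : X → ℝ} (h : IsDefiningFunctionAt n Ω y ρ)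
    (v : TangentSpace (𝓡 n) y) : 0 < g.inner y v (inwardNormal g Ω y) ↔ dirDeriv ρ y v < 0 := by
  obtain ⟨-, h1, h2⟩ := h.inwardNormal_spec hg hΩ hy
  rw [← h2 v]
  exact ⟨fun h => mul_neg_of_pos_of_neg h h1, fun h => pos_of_mul_neg_left h h1.le⟩

theorem IsDefiningFunctionAt.inner_neg_iff (hg : IsComplete g) (hΩ : IsClosed Ω)
    (hy : y ∈ frontier Ω) {ρ : X → ℝ} (h : IsDefiningFunctionAt n Ω y ρ)
    (v : TangentSpace (𝓡 n) y) : g.inner y v (inwardNormal g Ω y) < 0 ↔ 0 < dirDeriv ρ y v := by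
  obtain ⟨-, h1, h2⟩ := h.inwardNormal_spec hg hΩ hy
  rw [← h2 v]
  exact ⟨fun h => mul_pos_of_neg_of_neg h h1, fun h => neg_of_mul_pos_left h h1.le⟩

/-- The normal `ν` is a multiple of the gradient `A`: subtracting the multiple with the same value
of `dρ` leaves a tangent vector `z`, orthogonal to `ν` and `A` and hence to itself. Unlike the left
side, the right side keeps its meaning off the boundary, wherever `dρ ≠ 0`. -/
theorem mul_eq_of_gradient (hg : IsComplete g) (hΩ : IsClosed Ω)
    (hy : y ∈ frontier Ω) {ρ : X → ℝ} (h : IsDefiningFunctionAt n Ω y ρ)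
    {A : TangentSpace (𝓡 n) y} (hA : ∀ w, g.inner y A w = dirDeriv ρ y w)
    (v : TangentSpace (𝓡 n) y) :
    (2 * g.inner y v (inwardNormal g Ω y)) • inwardNormal g Ω y =
      (2 * dirDeriv ρ y v / dirDeriv ρ y A) • A := by
  obtain ⟨h1, h2, h3⟩ := h.inwardNormal_spec hg hΩ hy
  set ν := inwardNormal g Ω y
  have hA0 : A ≠ 0 := by
    rintro rfl
    have := hA ν
    rw [map_zero] at this
    exact h2.ne this.symm
  have hpos : 0 < dirDeriv ρ y A := by rw [← hA]; exact g.pos y A hA0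
  have hz : ν - (dirDeriv ρ y ν / dirDeriv ρ y A) • A = 0 := by
    by_contra hne
    have h4 := g.pos y _ hne
    set z := ν - (dirDeriv ρ y ν / dirDeriv ρ y A) • A with hz
    have h5 : dirDeriv ρ y z = 0 := by
      rw [hz, dirDeriv_sub_smul, div_mul_cancel₀ _ hpos.ne', sub_self]
    have h6 : g.inner y z ν = 0 := by
      have := h3 z
      rw [h5] at this
      exact (mul_eq_zero.1 this).resolve_right h2.ne
    have h7 : g.inner y z z = 0 := by
      conv_lhs => rw [show g.inner y z z = g.inner y z (ν - (dirDeriv ρ y ν / dirDeriv ρ y A) • A)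
        from rfl]
      rw [inner_sub_smul, h6, g.symm y z A, hA, h5]
      simp
    exact h4.ne' h7
  have hν : ν = (dirDeriv ρ y ν / dirDeriv ρ y A) • A := sub_eq_zero.1 hz
  rw [← h3 v]
  nth_rewrite 2 [hν]
  rw [smul_smul]
  congr 1
  ring

/-- The outward boundary. -/
def outBoundary (g : Metric n X) (Ω : Set X) : Set (TangentBundle (𝓡 n) X) :=
  {p | p ∈ phaseBoundary g Ω ∧ g.inner p.proj p.snd (inwardNormal g Ω p.proj) < 0}

theorem phaseBoundary_diff_grazingBoundary (hg : IsComplete g) (hΩ : IsObstacle n Ω) :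
    phaseBoundary g Ω \ grazingBoundary g Ω = inBoundary g Ω ∪ outBoundary g Ω := by
  ext p
  have key : p ∈ phaseBoundary g Ω → (p.snd ∈ boundaryTangent Ω p.proj ↔
      ¬ (0 < g.inner p.proj p.snd (inwardNormal g Ω p.proj) ∨
        g.inner p.proj p.snd (inwardNormal g Ω p.proj) < 0)) := by
    intro hp
    obtain ⟨ρ, h⟩ := hΩ.2 p.proj hp.2
    rw [h.mem_boundaryTangent_iff hg hΩ.1 hp.2, h.inner_pos_iff hg hΩ.1 hp.2,
      h.inner_neg_iff hg hΩ.1 hp.2]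
    constructor
    · intro h0; simp [h0]
    · intro h0; push Not at h0; exact le_antisymm h0.2 h0.1
  simp only [grazingBoundary, inBoundary, outBoundary, Set.mem_sdiff, mem_ofPred_eq, mem_union]
  constructor
  · rintro ⟨h1, h2⟩
    have h3 : ¬ p.snd ∈ boundaryTangent Ω p.proj := fun h => h2 ⟨h1, h⟩
    rw [key h1, not_not] at h3
    exact h3.imp (fun h => ⟨h1, h⟩) (fun h => ⟨h1, h⟩)
  · rintro (⟨h1, h2⟩ | ⟨h1, h2⟩)
    · exact ⟨h1, fun h => (key h1).1 h.2 (Or.inl h2)⟩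
    · exact ⟨h1, fun h => (key h1).1 h.2 (Or.inr h2)⟩

theorem inner_reflect (hg : IsComplete g) (hΩ : IsObstacle n Ω) {p : TangentBundle (𝓡 n) X}
    (hp : p.proj ∈ frontier Ω) :
    g.inner p.proj (reflect g Ω p).snd (inwardNormal g Ω p.proj) =
      -g.inner p.proj p.snd (inwardNormal g Ω p.proj) := by
  have h1 := hΩ.inwardNormal_unit hg hp
  refine (inner_sub_smul_left g p.proj _ p.snd _ _).trans ?_
  rw [h1]
  ring

theorem reflect_reflect (hg : IsComplete g) (hΩ : IsObstacle n Ω) {p : TangentBundle (𝓡 n) X}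
    (hp : p.proj ∈ frontier Ω) : reflect g Ω (reflect g Ω p) = p := by
  have h1 := inner_reflect hg hΩ hp
  obtain ⟨x, v⟩ := p
  change (⟨x, _ - (2 * g.inner x (reflect g Ω ⟨x, v⟩).snd (inwardNormal g Ω x)) •
    inwardNormal g Ω x⟩ : TangentBundle (𝓡 n) X) = ⟨x, v⟩
  congr 1
  rw [h1]
  change v - _ • _ - _ • _ = v
  rw [sub_sub, ← add_smul]
  simp

theorem reflect_mem_unitBundle (hg : IsComplete g) (hΩ : IsObstacle n Ω)
    {p : TangentBundle (𝓡 n) X} (hp : p ∈ phaseBoundary g Ω) : reflect g Ω p ∈ unitBundle g := by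
  have h1 := hΩ.inwardNormal_unit hg hp.2
  have h2 : g.inner p.proj p.snd p.snd = 1 := hp.1
  change g.inner p.proj (p.snd - _ • _) (p.snd - _ • _) = 1
  rw [inner_sub_smul, inner_sub_smul_left, inner_sub_smul_left, h1, h2,
    g.symm p.proj (inwardNormal g Ω p.proj)]
  ring

theorem reflect_mem_outBoundary (hg : IsComplete g) (hΩ : IsObstacle n Ω)
    {p : TangentBundle (𝓡 n) X} (hp : p ∈ inBoundary g Ω) : reflect g Ω p ∈ outBoundary g Ω := by
  refine ⟨⟨reflect_mem_unitBundle hg hΩ hp.1, hp.1.2⟩, ?_⟩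
  have h1 := hp.2
  change g.inner p.proj (reflect g Ω p).snd (inwardNormal g Ω p.proj) < 0
  rw [inner_reflect hg hΩ hp.1.2]
  linarith

theorem reflect_mem_inBoundary (hg : IsComplete g) (hΩ : IsObstacle n Ω)
    {p : TangentBundle (𝓡 n) X} (hp : p ∈ outBoundary g Ω) : reflect g Ω p ∈ inBoundary g Ω := by
  refine ⟨⟨reflect_mem_unitBundle hg hΩ hp.1, hp.1.2⟩, ?_⟩
  have h1 := hp.2
  change 0 < g.inner p.proj (reflect g Ω p).snd (inwardNormal g Ω p.proj)
  rw [inner_reflect hg hΩ hp.1.2]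
  linarith

variable {g' : Metric n X}

theorem rescale_mem_phaseBoundary (g' : Metric n X) {p : TangentBundle (𝓡 n) X}
    (hp : p ∈ phaseBoundary g Ω) : rescale g' p ∈ phaseBoundary g' Ω :=
  ⟨rescale_mem_unitBundle g' (snd_ne_zero_of_mem_unitBundle hp.1), hp.2⟩

theorem rescale_mem_inBoundary (hg : IsComplete g) (hg' : IsComplete g') (hΩ : IsObstacle n Ω)
    {p : TangentBundle (𝓡 n) X} (hp : p ∈ inBoundary g Ω) : rescale g' p ∈ inBoundary g' Ω := by
  refine ⟨rescale_mem_phaseBoundary g' hp.1, ?_⟩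
  obtain ⟨ρ, h⟩ := hΩ.2 p.proj hp.1.2
  obtain ⟨c, hc, heq⟩ := rescale_eq_smul g' (snd_ne_zero_of_mem_unitBundle hp.1.1)
  rw [heq]
  rw [h.inner_pos_iff hg' hΩ.1 hp.1.2, dirDeriv_smul]
  exact mul_neg_of_pos_of_neg hc ((h.inner_pos_iff hg hΩ.1 hp.1.2 _).1 hp.2)

theorem rescale_mem_outBoundary (hg : IsComplete g) (hg' : IsComplete g') (hΩ : IsObstacle n Ω)
    {p : TangentBundle (𝓡 n) X} (hp : p ∈ outBoundary g Ω) : rescale g' p ∈ outBoundary g' Ω := by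
  refine ⟨rescale_mem_phaseBoundary g' hp.1, ?_⟩
  obtain ⟨ρ, h⟩ := hΩ.2 p.proj hp.1.2
  obtain ⟨c, hc, heq⟩ := rescale_eq_smul g' (snd_ne_zero_of_mem_unitBundle hp.1.1)
  rw [heq]
  rw [h.inner_neg_iff hg' hΩ.1 hp.1.2, dirDeriv_smul]
  exact mul_pos hc ((h.inner_neg_iff hg hΩ.1 hp.1.2 _).1 hp.2)

/-- The tangential reflection has smooth local extensions. -/
theorem exists_smoothNear_reflect (hg : IsComplete g) (hΩ : IsObstacle n Ω)
    {p : TangentBundle (𝓡 n) X} (hp : p.proj ∈ frontier Ω) :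
    ∃ h : TangentBundle (𝓡 n) X → TangentBundle (𝓡 n) X,
      SmoothNear (𝓡 n).tangent (𝓡 n).tangent h p ∧
        ∀ᶠ q : TangentBundle (𝓡 n) X in 𝓝 p, q.proj ∈ frontier Ω → h q = reflect g Ω q := by
  obtain ⟨ρ, U, hpU, hρ⟩ := hΩ.exists_isDefiningOn hp
  set x₀ := p.proj with hx₀
  have hsrc : p.proj ∈ (extChartAt (𝓡 n) x₀).source := mem_extChartAt_source _
  let r : Euc n → ℝ := ρ ∘ (extChartAt (𝓡 n) x₀).symm
  -- `a` is the gradient of `ρ` in the chart, and `k` is the reflection as rewritten by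
  -- `mul_eq_of_gradient`, which is smooth on both sides of the boundary.
  let a : Euc n → Euc n := fun y => (metricForm g x₀ y).inverse (fderiv ℝ r y)
  let k : Euc n × Euc n → Euc n × Euc n := fun z =>
    (z.1, z.2 - (2 * fderiv ℝ r z.1 z.2 / fderiv ℝ r z.1 (a z.1)) • a z.1)
  have hgrad : ∀ y ∈ (extChartAt (𝓡 n) x₀).source ∩ U, ∀ A : TangentSpace (𝓡 n) y,
      (∀ w, g.inner y A w = dirDeriv ρ y w) →
      (tanChart (n := n) x₀ ⟨y, A⟩).2 = a (extChartAt (𝓡 n) x₀ y) := by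
    intro y hy A hA
    obtain ⟨e, he⟩ := metricForm_isInvertible g ((extChartAt (𝓡 n) x₀).map_source hy.1)
    have h1 : metricForm g x₀ (extChartAt (𝓡 n) x₀ y) (tanChart (n := n) x₀ ⟨y, A⟩).2 =
        fderiv ℝ r (extChartAt (𝓡 n) x₀ y) := by
      ext w
      obtain ⟨w', rfl⟩ := exists_tanChart_eq hy.1 w
      rw [metricForm_tanChart_pair g hy.1, hA,
        dirDeriv_eq_fderiv hy.1 (hρ.mdifferentiableAt hy.2)]
    simp only [a]
    rw [← h1, ← he, ContinuousLinearMap.inverse_equiv]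
    simp
  have hsm : ∀ᶠ q : TangentBundle (𝓡 n) X in 𝓝 p, ContDiffAt ℝ ∞ k (tanChart x₀ q) := by
    filter_upwards [eventually_proj_mem (isOpen_extChartAt_source x₀) hsrc,
      eventually_proj_mem hρ.isOpen hpU] with q h1 h2
    have ht : extChartAt (𝓡 n) x₀ q.proj ∈ (extChartAt (𝓡 n) x₀).target :=
      (extChartAt (𝓡 n) x₀).map_source h1
    have hr : ContDiffAt ℝ ∞ (fderiv ℝ r) (tanChart x₀ q).1 := by
      rw [tanChart_fst h1]
      have h4 := (contMDiffOn_extChartAt_symm (I := 𝓡 n) (n := ∞) x₀).contMDiffAt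
        ((isOpen_extChartAt_target x₀).mem_nhds ht)
      have h3 : ContMDiffAt 𝓘(ℝ, Euc n) 𝓘(ℝ, ℝ) ∞ r (extChartAt (𝓡 n) x₀ q.proj) := by
        refine ContMDiffAt.comp _ ?_ h4
        rw [(extChartAt (𝓡 n) x₀).left_inv h1]
        exact hρ.contMDiffAt h2
      exact h3.contDiffAt.fderiv_right (by norm_cast)
    have hi : ContDiffAt ℝ ∞ (fun y => (metricForm g x₀ y).inverse) (tanChart x₀ q).1 := by
      rw [tanChart_fst h1]
      exact (contDiffOn_inverse (contDiffOn_metricForm g x₀)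
        fun y hy => metricForm_isInvertible g hy).contDiffAt
          ((isOpen_extChartAt_target x₀).mem_nhds ht)
    have ha : ContDiffAt ℝ ∞ a (tanChart x₀ q).1 := hi.clm_apply hr
    have ha' : ContDiffAt ℝ ∞ (fun z : Euc n × Euc n => a z.1) (tanChart x₀ q) :=
      ha.comp _ contDiffAt_fst
    have hr' : ContDiffAt ℝ ∞ (fun z : Euc n × Euc n => fderiv ℝ r z.1) (tanChart x₀ q) :=
      hr.comp _ contDiffAt_fst
    have hne : fderiv ℝ r (tanChart x₀ q).1 (a (tanChart x₀ q).1) ≠ 0 := by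
      obtain ⟨A, hA⟩ := exists_gradient g ρ q.proj
      have hA0 : A ≠ 0 := by
        rintro rfl
        obtain ⟨w, hw⟩ := hρ.exists_dirDeriv_ne_zero h2
        have := hA w
        rw [map_zero] at this
        exact hw this.symm
      rw [tanChart_fst h1, ← hgrad q.proj ⟨h1, h2⟩ A hA,
        ← dirDeriv_eq_fderiv h1 (hρ.mdifferentiableAt h2), ← hA]
      exact (g.pos _ _ hA0).ne'
    exact contDiffAt_fst.prodMk (contDiffAt_snd.sub
      (((contDiffAt_const.mul (hr'.clm_apply contDiffAt_snd)).div (hr'.clm_apply ha') hne).smul ha'))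
  have hks : SmoothNear (𝓡 n).tangent 𝓘(ℝ, Euc n × Euc n) (fun q => k (tanChart x₀ q)) p := by
    filter_upwards [hsm, smoothNear_tanChart hsrc] with q h1 h2
    exact h1.contMDiffAt.comp q h2
  have htgt : k (tanChart x₀ p) ∈ (tanChart (n := n) x₀).target := by
    refine mem_tanChart_target.2 ?_
    change (tanChart x₀ p).1 ∈ _
    rw [tanChart_fst hsrc]
    exact (extChartAt (𝓡 n) x₀).map_source hsrc
  refine ⟨fun q => (tanChart x₀).symm (k (tanChart x₀ q)), SmoothNear.comp
    ((contMDiffOn_tanChart_symm x₀).smoothNear (isOpen_tanChart_target x₀) htgt) hks, ?_⟩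
  filter_upwards [eventually_proj_mem (isOpen_extChartAt_source x₀) hsrc,
    eventually_proj_mem hρ.isOpen hpU] with q h1 h2 hqf
  have key : tanChart x₀ (reflect g Ω q) = k (tanChart x₀ q) := by
    obtain ⟨A, hA⟩ := exists_gradient g ρ q.proj
    refine Prod.ext ((tanChart_fst (p := reflect g Ω q) h1).trans (tanChart_fst h1).symm) ?_
    have h3 := mul_eq_of_gradient hg hΩ.1 hqf (hρ.isDefiningFunctionAt h2) hA q.snd
    simp only [reflect, h3]
    rw [tanChart_snd_sub_smul h1, hgrad _ ⟨h1, h2⟩ A hA,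
      dirDeriv_eq_fderiv h1 (hρ.mdifferentiableAt h2),
      dirDeriv_eq_fderiv h1 (hρ.mdifferentiableAt h2), hgrad _ ⟨h1, h2⟩ A hA]
    simp only [k, tanChart_fst h1]
    rfl
  rw [← key]
  exact (tanChart x₀).left_inv (mem_tanChart_source.2 h1)

end Boundary

/-! ### The flow near the boundary -/

section Local

/-- A small product neighborhood of `(0, p)` contains with `(t, q)` also `(s, q)` for all `|s| ≤ c
|t|`, once `t` is small. Conditions at single times thus become conditions along whole pieces of
trajectories. -/
theorem eventually_forall_abs_le {Y : Type*} [TopologicalSpace Y] {p : Y} {P : ℝ × Y → Prop}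
    (h : ∀ᶠ w in 𝓝 ((0 : ℝ), p), P w) (c : ℝ) :
    ∀ᶠ w in 𝓝 ((0 : ℝ), p), ∀ s, |s| ≤ c * |w.1| → P (s, w.2) := by
  rw [nhds_prod_eq] at h
  obtain ⟨pa, ha, pb, hb, hab⟩ := eventually_prod_iff.1 h
  obtain ⟨δ, hδ, hball⟩ := Metric.eventually_nhds_iff.1 ha
  have h1 : ∀ᶠ w : ℝ × Y in 𝓝 ((0 : ℝ), p), c * |w.1| < δ := by
    have hc : Continuous fun w : ℝ × Y => c * |w.1| := by fun_prop
    exact hc.continuousAt.eventually (gt_mem_nhds (by simpa using hδ))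
  have h2 : ∀ᶠ w : ℝ × Y in 𝓝 ((0 : ℝ), p), pb w.2 := continuousAt_snd.eventually hb
  filter_upwards [h1, h2] with w hw1 hw2 s hs
  exact hab (hball (by rw [Real.dist_eq, sub_zero]; exact hs.trans_lt hw1)) hw2

theorem sign_of_hasDerivAt_neg {f d : ℝ → ℝ} {t : ℝ}
    (h : ∀ s, |s| ≤ |t| → HasDerivAt f (d s) s ∧ d s < 0) (h0 : f 0 = 0) :
    (0 < t → f t < 0) ∧ (t < 0 → 0 < f t) := by
  have hmem : ∀ s ∈ Icc (-|t|) |t|, |s| ≤ |t| := fun s hs => abs_le.2 hs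
  have hanti : StrictAntiOn f (Icc (-|t|) |t|) := by
    refine strictAntiOn_of_deriv_neg (convex_Icc _ _)
      (fun s hs => (h s (hmem s hs)).1.continuousAt.continuousWithinAt) fun s hs => ?_
    have hs' := h s (hmem s (interior_subset hs))
    rw [hs'.1.deriv]
    exact hs'.2
  have hz : (0 : ℝ) ∈ Icc (-|t|) |t| := by simp
  have ht : t ∈ Icc (-|t|) |t| := ⟨neg_abs_le t, le_abs_self t⟩
  exact ⟨fun hp => h0 ▸ hanti hz ht hp, fun hn => h0 ▸ hanti ht hz hn⟩

variable {n : ℕ} {X : Type*} [TopologicalSpace X] [ChartedSpace (Euc n) X] [IsManifold (𝓡 n) ∞ X]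
  [T2Space X] {g g' : Metric n X} {Ω : Set X} {ρ : X → ℝ} {U : Set X} {y : X}

/-- A zero of `ρ` cannot be interior to `Ω`, since a geodesic along which `ρ` increases leaves `Ω`
at once. -/
theorem IsDefiningOn.mem_frontier_iff (h : IsDefiningOn n Ω ρ U) (hg : IsComplete g)
    (hΩ : IsClosed Ω) (hy : y ∈ U) : y ∈ frontier Ω ↔ ρ y = 0 := by
  refine ⟨(h.isDefiningFunctionAt hy).eq_zero hΩ, fun h0 => ?_⟩
  rw [frontier, hΩ.closure_eq]
  refine ⟨(h.mem_iff y hy).2 h0.le, fun hint => ?_⟩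
  obtain ⟨v, hv⟩ : ∃ v : TangentSpace (𝓡 n) y, 0 < dirDeriv ρ y v := by
    obtain ⟨v, hv⟩ := h.exists_dirDeriv_ne_zero hy
    rcases hv.lt_or_gt with hv | hv
    · exact ⟨-v, by rw [dirDeriv_neg]; linarith⟩
    · exact ⟨v, hv⟩
  have h1 := eventually_pos_geodesic hg (h.mdifferentiableAt hy) h0 hv
  have h2 := eventually_geodesic hg (P := fun z => z ∈ interior Ω ∧ z ∈ U)
    ((show ∀ᶠ z in 𝓝 y, z ∈ interior Ω from isOpen_interior.mem_nhds hint).and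
      (h.isOpen.mem_nhds hy)) v
  obtain ⟨s, hs1, hs2, hs3⟩ := (h1.and h2).exists
  exact absurd ((h.mem_iff _ hs3).1 (interior_subset hs2)) (not_le.2 hs1)

theorem IsDefiningOn.mem_interior_iff (h : IsDefiningOn n Ω ρ U) (hg : IsComplete g)
    (hΩ : IsClosed Ω) (hy : y ∈ U) : y ∈ interior Ω ↔ ρ y < 0 := by
  rw [← self_sdiff_frontier, Set.mem_sdiff, h.mem_frontier_iff hg hΩ hy, h.mem_iff y hy,
    lt_iff_le_and_ne]

/-- Along trajectories near that of `p`, the function `c ρ` has negative derivative, and it vanishes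
at time zero for a boundary starting point. The values `c = 1` and `c = -1` cover inward and outward
vectors. -/
theorem eventually_sign_of_neg (hg : IsComplete g) (hΩ : IsClosed Ω) (h : IsDefiningOn n Ω ρ U)
    {p : TangentBundle (𝓡 n) X} (hp : p.proj ∈ U) {c : ℝ} (hc : c * dirDeriv ρ p.proj p.snd < 0) :
    ∀ᶠ w : ℝ × TangentBundle (𝓡 n) X in 𝓝 (0, p), w.2.proj ∈ frontier Ω →
      (geodesicFlow g w).proj ∈ U ∧ (0 < w.1 → c * ρ (geodesicFlow g w).proj < 0) ∧
        (w.1 < 0 → 0 < c * ρ (geodesicFlow g w).proj) := by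
  have h0 : ∀ᶠ q : TangentBundle (𝓡 n) X in 𝓝 p,
      q.proj ∈ U ∧ c * dirDeriv ρ q.proj q.snd < 0 := by
    refine (eventually_proj_mem h.isOpen hp).and ?_
    have := (smoothNear_dirDeriv h.isOpen h.contMDiffOn hp).continuousAt.const_mul c
    exact this.eventually (gt_mem_nhds hc)
  have h1 : ∀ᶠ w : ℝ × TangentBundle (𝓡 n) X in 𝓝 (0, p), (geodesicFlow g w).proj ∈ U ∧
      c * dirDeriv ρ (geodesicFlow g w).proj (geodesicFlow g w).snd < 0 := by
    refine (continuous_geodesicFlow hg).continuousAt.eventually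
      (p := fun q => q.proj ∈ U ∧ c * dirDeriv ρ q.proj q.snd < 0) ?_
    rw [geodesicFlow_zero hg]
    exact h0
  filter_upwards [eventually_forall_abs_le h1 1] with w hw hwf
  have hU0 := (hw 0 (by simp)).1
  have h2 := sign_of_hasDerivAt_neg (t := w.1)
    (f := fun s => c * ρ (geodesicFlow g (s, w.2)).proj)
    (d := fun s => c * dirDeriv ρ (geodesicFlow g (s, w.2)).proj (geodesicFlow g (s, w.2)).snd)
    (fun s hs => ⟨(hasDerivAt_comp_geodesicFlow hg
      (h.mdifferentiableAt (hw s (by rwa [one_mul])).1)).const_mul c, (hw s (by rwa [one_mul])).2⟩)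
    (by
      rw [geodesicFlow_zero hg] at hU0 ⊢
      rw [(h.mem_frontier_iff hg hΩ hU0).1 hwf, mul_zero])
  exact ⟨(hw w.1 (by rw [one_mul])).1, h2⟩

/-- Trajectories enter `Ω` at the inward boundary. -/
theorem eventually_sign_inBoundary (hg : IsComplete g) (hΩ : IsObstacle n Ω)
    {p : TangentBundle (𝓡 n) X} (hp : p ∈ inBoundary g Ω) :
    ∀ᶠ w : ℝ × TangentBundle (𝓡 n) X in 𝓝 (0, p), w.2.proj ∈ frontier Ω →
      (0 < w.1 → (geodesicFlow g w).proj ∈ interior Ω) ∧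
        (w.1 < 0 → (geodesicFlow g w).proj ∉ Ω) := by
  obtain ⟨ρ, U, hpU, h⟩ := hΩ.exists_isDefiningOn hp.1.2
  have h1 := ((h.isDefiningFunctionAt hpU).inner_pos_iff hg hΩ.1 hp.1.2 _).1 hp.2
  filter_upwards [eventually_sign_of_neg hg hΩ.1 h hpU (c := 1) (by rwa [one_mul])] with w hw hwf
  obtain ⟨hU, h2, h3⟩ := hw hwf
  rw [one_mul] at h2 h3
  exact ⟨fun ht => (h.mem_interior_iff hg hΩ.1 hU).2 (h2 ht),
    fun ht hm => absurd ((h.mem_iff _ hU).1 hm) (not_le.2 (h3 ht))⟩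

/-- Trajectories leave `Ω` at the outward boundary. -/
theorem eventually_sign_outBoundary (hg : IsComplete g) (hΩ : IsObstacle n Ω)
    {p : TangentBundle (𝓡 n) X} (hp : p ∈ outBoundary g Ω) :
    ∀ᶠ w : ℝ × TangentBundle (𝓡 n) X in 𝓝 (0, p), w.2.proj ∈ frontier Ω →
      (w.1 < 0 → (geodesicFlow g w).proj ∈ interior Ω) ∧
        (0 < w.1 → (geodesicFlow g w).proj ∉ Ω) := by
  obtain ⟨ρ, U, hpU, h⟩ := hΩ.exists_isDefiningOn hp.1.2
  have h1 := ((h.isDefiningFunctionAt hpU).inner_neg_iff hg hΩ.1 hp.1.2 _).1 hp.2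
  filter_upwards [eventually_sign_of_neg hg hΩ.1 h hpU (c := -1) (by linarith)] with w hw hwf
  obtain ⟨hU, h2, h3⟩ := hw hwf
  exact ⟨fun ht => (h.mem_interior_iff hg hΩ.1 hU).2 (by linarith [h3 ht]),
    fun ht hm => absurd ((h.mem_iff _ hU).1 hm) (not_le.2 (by linarith [h2 ht]))⟩

theorem eventually_mem_inBoundary (hg : IsComplete g) (hΩ : IsObstacle n Ω)
    {p : TangentBundle (𝓡 n) X} (hp : p ∈ inBoundary g Ω) :
    ∀ᶠ q in 𝓝 p, q ∈ phaseBoundary g Ω → q ∈ inBoundary g Ω := by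
  obtain ⟨ρ, U, hpU, h⟩ := hΩ.exists_isDefiningOn hp.1.2
  have h1 := ((h.isDefiningFunctionAt hpU).inner_pos_iff hg hΩ.1 hp.1.2 _).1 hp.2
  filter_upwards [eventually_proj_mem h.isOpen hpU, (smoothNear_dirDeriv h.isOpen h.contMDiffOn
    hpU).continuousAt.eventually (gt_mem_nhds h1)] with q h2 h3 hq
  exact ⟨hq, ((h.isDefiningFunctionAt h2).inner_pos_iff hg hΩ.1 hq.2 _).2 h3⟩

theorem eventually_mem_outBoundary (hg : IsComplete g) (hΩ : IsObstacle n Ω)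
    {p : TangentBundle (𝓡 n) X} (hp : p ∈ outBoundary g Ω) :
    ∀ᶠ q in 𝓝 p, q ∈ phaseBoundary g Ω → q ∈ outBoundary g Ω := by
  obtain ⟨ρ, U, hpU, h⟩ := hΩ.exists_isDefiningOn hp.1.2
  have h1 := ((h.isDefiningFunctionAt hpU).inner_neg_iff hg hΩ.1 hp.1.2 _).1 hp.2
  filter_upwards [eventually_proj_mem h.isOpen hpU, (smoothNear_dirDeriv h.isOpen h.contMDiffOn
    hpU).continuousAt.eventually (lt_mem_nhds h1)] with q h2 h3 hq
  exact ⟨hq, ((h.isDefiningFunctionAt h2).inner_neg_iff hg hΩ.1 hq.2 _).2 h3⟩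

theorem notMem_outBoundary {p : TangentBundle (𝓡 n) X} (hp : p ∈ inBoundary g Ω) :
    p ∉ outBoundary g Ω := fun h => lt_asymm hp.2 h.2

/-- The hitting time of the boundary. -/
theorem exists_hitting_time (hg : IsComplete g) (hΩ : IsClosed Ω) (h : IsDefiningOn n Ω ρ U)
    {p : TangentBundle (𝓡 n) X} (hp : p.proj ∈ U) (hpf : p.proj ∈ frontier Ω)
    (hD : dirDeriv ρ p.proj p.snd ≠ 0) :
    ∃ T : TangentBundle (𝓡 n) X → ℝ, SmoothNear (𝓡 n).tangent 𝓘(ℝ, ℝ) T p ∧ T p = 0 ∧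
      (∀ᶠ z in 𝓝 p, (geodesicFlow g (-T z, z)).proj ∈ frontier Ω) ∧
      ∀ᶠ w : ℝ × TangentBundle (𝓡 n) X in 𝓝 (0, p), w.2.proj ∈ frontier Ω →
        T (geodesicFlow g w) = w.1 := by
  have hsrc : p.proj ∈ (extChartAt (𝓡 n) p.proj).source := mem_extChartAt_source _
  set K := tanChart (n := n) p.proj with hK
  have hpK : p ∈ K.source := mem_tanChart_source.2 hsrc
  have hKs : SmoothNear (𝓡 n).tangent 𝓘(ℝ, Euc n × Euc n) K p := smoothNear_tanChart hsrc
  -- `T z` is to be the signed time elapsed since the trajectory through `z` crossed the boundary,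
  -- that is, the solution `s` of `ρ(φ_{-s}(z)) = 0`. At `(p, 0)` the derivative in `s` is `-dρ(v)`,
  -- nonzero by transversality.
  let F : (Euc n × Euc n) × ℝ → ℝ := fun e => ρ (geodesicFlow g (-e.2, K.symm e.1)).proj
  let u : (Euc n × Euc n) × ℝ := (K p, 0)
  have hKp : K.symm (K p) = p := K.left_inv hpK
  have hFz : ∀ z s, z ∈ K.source → F (K z, s) = ρ (geodesicFlow g (-s, z)).proj :=
    fun z s hz => by simp only [F, K.left_inv hz]
  have hu : F u = 0 := by
    rw [hFz p 0 hpK, neg_zero, geodesicFlow_zero hg]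
    exact (h.mem_frontier_iff hg hΩ hp).1 hpf
  have hF : ∀ᶠ v in 𝓝 u, ContDiffAt ℝ ∞ F v := by
    have h1 : SmoothNear 𝓘(ℝ, (Euc n × Euc n) × ℝ) (𝓡 n).tangent
        (fun e : (Euc n × Euc n) × ℝ => K.symm e.1) u :=
      SmoothNear.comp (f := fun e : (Euc n × Euc n) × ℝ => e.1)
        ((contMDiffOn_tanChart_symm p.proj).smoothNear (isOpen_tanChart_target p.proj)
          (K.map_source hpK)) contDiff_fst.contMDiff.smoothNear
    have h2 : SmoothNear 𝓘(ℝ, (Euc n × Euc n) × ℝ) 𝓘(ℝ, ℝ)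
        (fun e : (Euc n × Euc n) × ℝ => -e.2) u := contDiff_snd.neg.contMDiff.smoothNear
    have h3 := SmoothNear.comp (k := geodesicFlow g)
      (f := fun e : (Euc n × Euc n) × ℝ => (-e.2, K.symm e.1))
      (smoothNear_geodesicFlow hg _) (h2.prodMk h1)
    have h4 : SmoothNear (𝓡 n).tangent 𝓘(ℝ, ℝ) (fun q : TangentBundle (𝓡 n) X => ρ q.proj)
        (geodesicFlow g (-u.2, K.symm u.1)) := by
      have hu' : geodesicFlow g (-u.2, K.symm u.1) = p := by
        simp only [u, hKp, neg_zero, geodesicFlow_zero hg]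
      rw [hu']
      exact SmoothNear.comp (k := ρ) (f := fun q : TangentBundle (𝓡 n) X => q.proj)
        (h.contMDiffOn.smoothNear h.isOpen hp) (contMDiff_proj (TangentSpace (𝓡 n))).smoothNear
    exact (SmoothNear.comp (k := fun q : TangentBundle (𝓡 n) X => ρ q.proj)
      (f := fun e : (Euc n × Euc n) × ℝ => geodesicFlow g (-e.2, K.symm e.1)) h4 h3).mono
      fun v hv => hv.contDiffAt
  have hinv : (fderiv ℝ F u ∘L .inr ℝ (Euc n × Euc n) ℝ).IsInvertible := by
    have h1 : HasDerivAt (fun s => F (K p, s)) ((fderiv ℝ F u ∘L .inr ℝ (Euc n × Euc n) ℝ) 1) 0 :=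
      ((hF.self_of_nhds.differentiableAt (by simp)).hasFDerivAt.comp (0 : ℝ)
        (hasFDerivAt_prodMk_right (𝕜 := ℝ) (K p) (0 : ℝ))).hasDerivAt
    have h2 : HasDerivAt (fun s => F (K p, s)) (-dirDeriv ρ p.proj p.snd) 0 := by
      have h3 := hasDerivAt_comp_geodesicFlow hg (t := -0) (p := p) (ρ := ρ)
        (by rw [neg_zero, geodesicFlow_zero hg]; exact h.mdifferentiableAt hp)
      have h4 := h3.scomp (0 : ℝ) (hasDerivAt_neg (0 : ℝ))
      rw [neg_zero, geodesicFlow_zero hg] at h4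
      refine (h4.congr_deriv (by simp)).congr_of_eventuallyEq (Eventually.of_forall fun s => ?_)
      exact hFz p s hpK
    have h3 := h1.unique h2
    refine ⟨ContinuousLinearEquiv.unitsEquivAut ℝ
      (Units.mk0 (-dirDeriv ρ p.proj p.snd) (neg_ne_zero.2 hD)), ?_⟩
    ext
    rw [h3]
    simp
  obtain ⟨ψ, hψu, hψ, hiff⟩ := eventually_contDiffAt_implicitFunction hF hinv
  have hψu' : ψ (K p) = 0 := hψu
  have hT : SmoothNear (𝓡 n).tangent 𝓘(ℝ, ℝ) (fun z => ψ (K z)) p :=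
    SmoothNear.comp (k := ψ) (f := K)
      (show SmoothNear 𝓘(ℝ, Euc n × Euc n) 𝓘(ℝ, ℝ) ψ (K p) from
        hψ.mono fun x hx => hx.contMDiffAt) hKs
  have hKsrc : ∀ᶠ z in 𝓝 p, z ∈ K.source := (isOpen_tanChart_source p.proj).mem_nhds hpK
  refine ⟨fun z => ψ (K z), hT, hψu', ?_, ?_⟩
  · have h1 : ContinuousAt (fun z => (K z, ψ (K z))) p := hKs.continuousAt.prodMk hT.continuousAt
    have h2 := h1.eventually (p := fun v => F v = F u ↔ ψ v.1 = v.2) (by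
      beta_reduce
      rw [hψu']
      exact hiff)
    have h3 : ContinuousAt (fun z => (geodesicFlow g (-ψ (K z), z)).proj) p :=
      continuous_proj_tangentBundle.continuousAt.comp
        ((continuous_geodesicFlow hg).continuousAt.comp
          (hT.continuousAt.neg.prodMk continuousAt_id))
    have h4 := h3.preimage_mem_nhds (h.isOpen.mem_nhds (by
      rw [hψu', neg_zero, geodesicFlow_zero hg]
      exact hp))
    filter_upwards [h2, h4, hKsrc] with z hz1 hz2 hz3
    rw [h.mem_frontier_iff hg hΩ hz2, ← hFz z _ hz3, hz1.2 rfl, hu]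
  · have h1 : ContinuousAt (fun w : ℝ × TangentBundle (𝓡 n) X => geodesicFlow g w) (0, p) :=
      (continuous_geodesicFlow hg).continuousAt
    have h0 : geodesicFlow g (0, p) = p := geodesicFlow_zero hg p
    have h2 : ContinuousAt (fun w : ℝ × TangentBundle (𝓡 n) X => (K (geodesicFlow g w), w.1))
        (0, p) := by
      refine ContinuousAt.prodMk (ContinuousAt.comp (g := K) ?_ h1) continuousAt_fst
      rw [h0]
      exact hKs.continuousAt
    have h3 := h2.eventually (p := fun v => F v = F u ↔ ψ v.1 = v.2) (by
      beta_reduce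
      rw [h0]
      exact hiff)
    have h4 := h1.eventually (p := fun z => z ∈ K.source) (by
      beta_reduce
      rw [h0]
      exact hKsrc)
    have h5 : ∀ᶠ w : ℝ × TangentBundle (𝓡 n) X in 𝓝 (0, p), w.2.proj ∈ U :=
      continuousAt_snd.eventually (eventually_proj_mem h.isOpen hp)
    filter_upwards [h3, h4, h5] with w hw1 hw2 hw3 hwf
    refine hw1.1 ?_
    rw [hu]
    change F (K (geodesicFlow g (w.1, w.2)), w.1) = 0
    rw [hFz _ _ hw2, geodesicFlow_neg hg]
    exact (h.mem_frontier_iff hg hΩ hw3).1 hwf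

/-- The smooth local inverse of the geodesic flow `ℝ × (∂M \ ∂_g M) → SX`. -/
theorem exists_flow_inverse (hg : IsComplete g) (hΩ : IsObstacle n Ω)
    {w₀ : ℝ × TangentBundle (𝓡 n) X} (hw₀ : w₀.2 ∈ inBoundary g Ω ∪ outBoundary g Ω) :
    ∃ k : TangentBundle (𝓡 n) X → ℝ × TangentBundle (𝓡 n) X,
      SmoothNear (𝓡 n).tangent (timeModel n) k (geodesicFlow g w₀) ∧
      k (geodesicFlow g w₀) = w₀ ∧ (∀ z, geodesicFlow g (k z) = z) ∧
      (∀ᶠ z in 𝓝 (geodesicFlow g w₀), z ∈ unitBundle g → (k z).2 ∈ phaseBoundary g Ω) ∧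
      ∀ᶠ w in 𝓝 w₀, w.2.proj ∈ frontier Ω → k (geodesicFlow g w) = w := by
  obtain ⟨t₀, p⟩ := w₀
  have hpf : p.proj ∈ frontier Ω := by rcases hw₀ with h | h <;> exact h.1.2
  obtain ⟨ρ, U, hpU, h⟩ := hΩ.exists_isDefiningOn hpf
  have hD : dirDeriv ρ p.proj p.snd ≠ 0 := by
    rcases hw₀ with h1 | h1
    · exact (((h.isDefiningFunctionAt hpU).inner_pos_iff hg hΩ.1 hpf _).1 h1.2).ne
    · exact (((h.isDefiningFunctionAt hpU).inner_neg_iff hg hΩ.1 hpf _).1 h1.2).ne'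
  obtain ⟨T, hT, hT0, hTf, hTinv⟩ := exists_hitting_time hg hΩ.1 h hpU hpf hD
  -- Flowing back by `t₀` reduces to times near zero. The inverse then flows back by a further `T`;
  -- that the flow undoes it at every `z` is the group law, whatever the values of `T`.
  let b : TangentBundle (𝓡 n) X → TangentBundle (𝓡 n) X := fun z => geodesicFlow g (-t₀, z)
  have hb0 : b (geodesicFlow g (t₀, p)) = p := geodesicFlow_neg hg t₀ p
  have hb : SmoothNear (𝓡 n).tangent (𝓡 n).tangent b (geodesicFlow g (t₀, p)) :=
    SmoothNear.comp (k := geodesicFlow g) (f := fun z : TangentBundle (𝓡 n) X => (-t₀, z))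
      (smoothNear_geodesicFlow hg _) (contMDiff_const.prodMk contMDiff_id).smoothNear
  have hTb : SmoothNear (𝓡 n).tangent 𝓘(ℝ, ℝ) (fun z => T (b z)) (geodesicFlow g (t₀, p)) :=
    SmoothNear.comp (by rw [hb0]; exact hT) hb
  have hnegT : SmoothNear (𝓡 n).tangent 𝓘(ℝ, ℝ) (fun z => -T (b z)) (geodesicFlow g (t₀, p)) :=
    SmoothNear.comp (k := fun x : ℝ => -x) contDiff_neg.contMDiff.smoothNear hTb
  have haddT : SmoothNear (𝓡 n).tangent 𝓘(ℝ, ℝ) (fun z => t₀ + T (b z)) (geodesicFlow g (t₀, p)) :=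
    SmoothNear.comp (k := fun x : ℝ => t₀ + x)
      (contDiff_const.add contDiff_id).contMDiff.smoothNear hTb
  refine ⟨fun z => (t₀ + T (b z), geodesicFlow g (-T (b z), b z)), ?_, ?_, ?_, ?_, ?_⟩
  · exact haddT.prodMk (SmoothNear.comp (k := geodesicFlow g) (f := fun z => (-T (b z), b z))
      (smoothNear_geodesicFlow hg _) (hnegT.prodMk hb))
  · simp only [hb0, hT0, add_zero, neg_zero, geodesicFlow_zero hg]
  · intro z
    simp only
    rw [geodesicFlow_add hg, geodesicFlow_neg' hg, geodesicFlow_neg' hg]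
  · have h1 := hb.continuousAt.eventually (p := fun z =>
      (geodesicFlow g (-T z, z)).proj ∈ frontier Ω) (by rw [hb0]; exact hTf)
    filter_upwards [h1] with z hz hzu
    refine ⟨?_, hz⟩
    rwa [geodesicFlow_mem_unitBundle hg, geodesicFlow_mem_unitBundle hg]
  · have h1 : ContinuousAt (fun w : ℝ × TangentBundle (𝓡 n) X => (w.1 - t₀, w.2)) (t₀, p) := by
      fun_prop
    have h2 := h1.eventually (p := fun w : ℝ × TangentBundle (𝓡 n) X => w.2.proj ∈ frontier Ω →
      T (geodesicFlow g w) = w.1) (by simpa using hTinv)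
    filter_upwards [h2] with w hw hwf
    have hbw : b (geodesicFlow g w) = geodesicFlow g (w.1 - t₀, w.2) := by
      change geodesicFlow g (-t₀, geodesicFlow g (w.1, w.2)) = _
      rw [← geodesicFlow_add hg, neg_add_eq_sub]
    simp only [hbw, hw hwf]
    rw [geodesicFlow_neg hg]
    simp

end Local

/-! ### Neighborhoods of `{0} × B` in `ℝ × B` -/

section OpenNhd

variable {W : Type*} [TopologicalSpace W] {B : Set W} {N : Set (ℝ × W)}

theorem isOpenNhdZero_iff : IsOpenNhdZero B N ↔ (∀ w ∈ N, w.2 ∈ B) ∧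
    (∀ w ∈ N, ∀ᶠ w' in 𝓝 w, w'.2 ∈ B → w' ∈ N) ∧ ∀ p ∈ B, ((0 : ℝ), p) ∈ N := by
  constructor
  · rintro ⟨⟨V, hV, rfl⟩, h0⟩
    refine ⟨fun w hw => hw.2.2, fun w hw => ?_, h0⟩
    filter_upwards [hV.mem_nhds hw.1] with w' hw' hB
    exact ⟨hw', mem_univ _, hB⟩
  · rintro ⟨h1, h2, h3⟩
    refine ⟨⟨interior {w | w.2 ∈ B → w ∈ N}, isOpen_interior, ?_⟩, h3⟩
    ext w
    refine ⟨fun hw => ⟨?_, mem_univ _, h1 w hw⟩, fun hw => ?_⟩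
    · exact mem_interior_iff_mem_nhds.2 (h2 w hw)
    · exact interior_subset (s := {w : ℝ × W | w.2 ∈ B → w ∈ N}) hw.1 hw.2.2

theorem IsOpenNhdZero.snd_mem (h : IsOpenNhdZero B N) {w : ℝ × W} (hw : w ∈ N) : w.2 ∈ B :=
  (isOpenNhdZero_iff.1 h).1 w hw

theorem IsOpenNhdZero.eventually_mem (h : IsOpenNhdZero B N) {w : ℝ × W} (hw : w ∈ N) :
    ∀ᶠ w' in 𝓝 w, w'.2 ∈ B → w' ∈ N := (isOpenNhdZero_iff.1 h).2.1 w hw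

theorem IsOpenNhdZero.zero_mem (h : IsOpenNhdZero B N) {p : W} (hp : p ∈ B) : ((0 : ℝ), p) ∈ N :=
  h.2 p hp

/-- The set of points of `ℝ × B` near which `P` holds. -/
def relInterior (B : Set W) (P : ℝ × W → Prop) : Set (ℝ × W) :=
  {w | w.2 ∈ B ∧ ∀ᶠ w' in 𝓝 w, w'.2 ∈ B → P w'}

theorem of_mem_relInterior {P : ℝ × W → Prop} {w : ℝ × W} (hw : w ∈ relInterior B P) : P w :=
  hw.2.self_of_nhds hw.1

/-- Conditions that hold near every `(0, p)` can thereby be imposed on a whole neighborhood of `{0}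
× B`; flow chart domains and regular neighborhoods arise in this way. -/
theorem isOpenNhdZero_relInterior {P : ℝ × W → Prop}
    (h : ∀ p ∈ B, ∀ᶠ w in 𝓝 ((0 : ℝ), p), w.2 ∈ B → P w) : IsOpenNhdZero B (relInterior B P) := by
  refine isOpenNhdZero_iff.2 ⟨fun w hw => hw.1, fun w hw => ?_, fun p hp => ⟨hp, h p hp⟩⟩
  filter_upwards [hw.2.eventually_nhds] with w' hw' hB
  exact ⟨hB, hw'⟩

end OpenNhd

section Model

variable {n : ℕ} {X : Type*} [TopologicalSpace X] [ChartedSpace (Euc n) X] [IsManifold (𝓡 n) ∞ X]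
  {g g' : Metric n X} {Ω : Set X} {N : Set (ℝ × TangentBundle (𝓡 n) X)}

/-! ### Transport between the unit tangent bundles -/

theorem mem_transport_iff (hN : ∀ w ∈ N, w.2 ∈ unitBundle g) {w : ℝ × TangentBundle (𝓡 n) X} :
    w ∈ transport g' N ↔ w.2 ∈ unitBundle g' ∧ (w.1, rescale g w.2) ∈ N := by
  constructor
  · rintro ⟨w₀, h₀, rfl⟩
    refine ⟨rescale_mem_unitBundle g' (snd_ne_zero_of_mem_unitBundle (hN w₀ h₀)), ?_⟩
    simp only
    rwa [rescale_rescale_of_mem (hN w₀ h₀)]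
  · rintro ⟨h1, h2⟩
    exact ⟨_, h2, Prod.ext rfl (rescale_rescale_of_mem h1)⟩

theorem IsOpenNhdZero.transport {B B' : Set (TangentBundle (𝓡 n) X)} (hN : IsOpenNhdZero B N)
    (hB : B ⊆ unitBundle g) (hB' : B' ⊆ unitBundle g') (h : MapsTo (rescale g') B B')
    (h' : MapsTo (rescale g) B' B) : IsOpenNhdZero B' (transport g' N) := by
  have hNu : ∀ w ∈ N, w.2 ∈ unitBundle g := fun w hw => hB (hN.snd_mem hw)
  refine isOpenNhdZero_iff.2 ⟨?_, ?_, ?_⟩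
  · rintro _ ⟨w, hw, rfl⟩
    exact h (hN.snd_mem hw)
  · intro w hw
    have hw' := (mem_transport_iff hNu).1 hw
    have hc : ContinuousAt (fun z : ℝ × TangentBundle (𝓡 n) X => (z.1, rescale g z.2)) w :=
      continuousAt_fst.prodMk (ContinuousAt.comp (g := rescale g)
        (smoothNear_rescale g (snd_ne_zero_of_mem_unitBundle hw'.1)).continuousAt continuousAt_snd)
    filter_upwards [hc.eventually (hN.eventually_mem hw'.2)] with z hz hzB
    exact (mem_transport_iff hNu).2 ⟨hB' hzB, hz (h' hzB)⟩
  · intro p hp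
    exact (mem_transport_iff hNu).2 ⟨hB' hp, hN.zero_mem (h' hp)⟩

/-! ### The boundary without its grazing part -/

/-- The boundary without its grazing part, `∂M \ ∂_g M`. -/
def regularBoundary (g : Metric n X) (Ω : Set X) : Set (TangentBundle (𝓡 n) X) :=
  inBoundary g Ω ∪ outBoundary g Ω

theorem mem_phaseBoundary_of_mem_regular {p : TangentBundle (𝓡 n) X}
    (hp : p ∈ regularBoundary g Ω) : p ∈ phaseBoundary g Ω := by
  rcases hp with h | h <;> exact h.1

theorem inBoundary_subset_regular : inBoundary g Ω ⊆ regularBoundary g Ω := subset_union_left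

theorem outBoundary_subset_regular : outBoundary g Ω ⊆ regularBoundary g Ω := subset_union_right

/-- `B` is an open subset of `∂M \ ∂_g M`. -/
def IsOpenInRegular (g : Metric n X) (Ω : Set X) (B : Set (TangentBundle (𝓡 n) X)) : Prop :=
  B ⊆ regularBoundary g Ω ∧ ∀ p ∈ B, ∀ᶠ q in 𝓝 p, q ∈ phaseBoundary g Ω → q ∈ B

variable [T2Space X]

theorem isOpenInRegular_inBoundary (hg : IsComplete g) (hΩ : IsObstacle n Ω) :
    IsOpenInRegular g Ω (inBoundary g Ω) :=
  ⟨inBoundary_subset_regular, fun _ hp => eventually_mem_inBoundary hg hΩ hp⟩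

theorem isOpenInRegular_outBoundary (hg : IsComplete g) (hΩ : IsObstacle n Ω) :
    IsOpenInRegular g Ω (outBoundary g Ω) :=
  ⟨outBoundary_subset_regular, fun _ hp => eventually_mem_outBoundary hg hΩ hp⟩

theorem isOpenInRegular_regularBoundary (hg : IsComplete g) (hΩ : IsObstacle n Ω) :
    IsOpenInRegular g Ω (regularBoundary g Ω) := by
  refine ⟨Subset.rfl, fun p hp => ?_⟩
  rcases hp with hp | hp
  · filter_upwards [eventually_mem_inBoundary hg hΩ hp] with q hq h using Or.inl (hq h)
  · filter_upwards [eventually_mem_outBoundary hg hΩ hp] with q hq h using Or.inr (hq h)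

theorem rescale_mem_regularBoundary (hg : IsComplete g) (hg' : IsComplete g')
    (hΩ : IsObstacle n Ω) : MapsTo (rescale g') (regularBoundary g Ω) (regularBoundary g' Ω) :=
  fun _ hp => hp.imp (rescale_mem_inBoundary hg hg' hΩ) (rescale_mem_outBoundary hg hg' hΩ)

theorem reflect_mem_phaseBoundary (hg : IsComplete g) (hΩ : IsObstacle n Ω)
    {p : TangentBundle (𝓡 n) X} (hp : p ∈ phaseBoundary g Ω) :
    reflect g Ω p ∈ phaseBoundary g Ω := ⟨reflect_mem_unitBundle hg hΩ hp, hp.2⟩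

theorem transport_regular (hg : IsComplete g) (hg' : IsComplete g') (hΩ : IsObstacle n Ω)
    (hN : IsOpenNhdZero (regularBoundary g Ω) N) :
    IsOpenNhdZero (regularBoundary g' Ω) (transport g' N) :=
  hN.transport (fun _ h => (mem_phaseBoundary_of_mem_regular h).1)
    (fun _ h => (mem_phaseBoundary_of_mem_regular h).1) (rescale_mem_regularBoundary hg hg' hΩ)
    (rescale_mem_regularBoundary hg' hg hΩ)

theorem notMem_of_phaseBoundary {p : TangentBundle (𝓡 n) X} (hΩ : IsClosed Ω)
    (hp : p.proj ∉ Ω) : p ∉ phaseBoundary g Ω := fun h => hp (hΩ.frontier_subset h.2)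

theorem mem_phaseSpace_of_regular (hg : IsComplete g) (hΩ : IsObstacle n Ω)
    {p : TangentBundle (𝓡 n) X} (hp : p ∈ regularBoundary g Ω) :
    p ∈ phaseSpace g Ω \ grazingBoundary g Ω := by
  have h : p ∈ phaseBoundary g Ω \ grazingBoundary g Ω := by
    rwa [phaseBoundary_diff_grazingBoundary hg hΩ]
  exact ⟨⟨h.1.1, h.1.2.2⟩, h.2⟩

theorem mem_phaseSpace_of_interior (hΩ : IsClosed Ω) {p : TangentBundle (𝓡 n) X}
    (hp : p ∈ phaseInterior g Ω) : p ∈ phaseSpace g Ω \ grazingBoundary g Ω :=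
  ⟨⟨hp.1, fun h => hp.2 (interior_subset h)⟩, fun h => notMem_of_phaseBoundary hΩ hp.2 h.1⟩

/-! ### The model space -/

/-- The reflection is an involution of the boundary, so the gluing relation together with equality
is already an equivalence relation. -/
theorem Model.proj_eq_iff (hg : IsComplete g) (hΩ : IsObstacle n Ω) {p q : NonGrazing g Ω} :
    Model.proj g Ω p = Model.proj g Ω q ↔
      p = q ∨ p.1 ∈ phaseBoundary g Ω ∧ q.1 = reflect g Ω p.1 := by
  constructor
  · intro h
    have h' := Quot.eq.1 h
    clear h
    induction h' with
    | rel p q h => exact Or.inr h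
    | refl p => exact Or.inl rfl
    | symm p q _ ih =>
      rcases ih with rfl | ⟨h1, h2⟩
      · exact Or.inl rfl
      · exact Or.inr ⟨h2 ▸ reflect_mem_phaseBoundary hg hΩ h1,
          by rw [h2, reflect_reflect hg hΩ h1.2]⟩
    | trans p q r _ _ ih1 ih2 =>
      rcases ih1 with rfl | ⟨h3, h4⟩
      · exact ih2
      · rcases ih2 with rfl | ⟨h5, h6⟩
        · exact Or.inr ⟨h3, h4⟩
        · refine Or.inl (Subtype.ext ?_)
          rw [h6, h4, reflect_reflect hg hΩ h3.2]
  · rintro (rfl | h)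
    · rfl
    · exact Quot.sound h

theorem Model.proj_eq_iff_of_notMem (hg : IsComplete g) (hΩ : IsObstacle n Ω) {p q : NonGrazing g Ω}
    (hp : p.1.proj ∉ Ω) : Model.proj g Ω p = Model.proj g Ω q ↔ p.1 = q.1 := by
  rw [Model.proj_eq_iff hg hΩ, Subtype.ext_iff]
  exact or_iff_left fun h => notMem_of_phaseBoundary hΩ.1 hp h.1

/-! ### The geometric reflection -/

/-- For unit vectors `z` the inverse has boundary vectors as second components; close to `w` these
lie in `B`, and then `k z` lies in `N`, as both sets are relatively open. -/
theorem exists_flow_inverse_mem (hg : IsComplete g) (hΩ : IsObstacle n Ω)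
    {B : Set (TangentBundle (𝓡 n) X)} (hB : IsOpenInRegular g Ω B) (hN : IsOpenNhdZero B N)
    {w : ℝ × TangentBundle (𝓡 n) X} (hw : w ∈ N) :
    ∃ k : TangentBundle (𝓡 n) X → ℝ × TangentBundle (𝓡 n) X,
      SmoothNear (𝓡 n).tangent (timeModel n) k (geodesicFlow g w) ∧
      k (geodesicFlow g w) = w ∧ (∀ z, geodesicFlow g (k z) = z) ∧
      ∀ᶠ z in 𝓝 (geodesicFlow g w), z ∈ unitBundle g → k z ∈ N := by
  obtain ⟨k, hk, hkw, hinv, hbd, -⟩ := exists_flow_inverse hg hΩ (hB.1 (hN.snd_mem hw))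
  have h1 : ∀ᶠ w' in 𝓝 w, w'.2 ∈ phaseBoundary g Ω → w'.2 ∈ B :=
    continuousAt_snd.eventually (hB.2 _ (hN.snd_mem hw))
  have h2 := hk.continuousAt.eventually
    (p := fun w' => (w'.2 ∈ phaseBoundary g Ω → w'.2 ∈ B) ∧ (w'.2 ∈ B → w' ∈ N))
    (by rw [hkw]; exact h1.and (hN.eventually_mem hw))
  refine ⟨k, hk, hkw, hinv, ?_⟩
  filter_upwards [hbd, h2] with z hz1 hz2 hz
  exact hz2.2 (hz2.1 (hz1 hz))

theorem geodesicFlow_mem_unit (hg : IsComplete g) {w : ℝ × TangentBundle (𝓡 n) X}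
    (hw : w.2 ∈ unitBundle g) : geodesicFlow g w ∈ unitBundle g :=
  (geodesicFlow_mem_unitBundle hg (t := w.1) (p := w.2)).2 hw

/-- The geodesic flow on a neighborhood of `{0} × (∂M \ ∂_g M)` on which it is injective. -/
theorem isDiffeoOntoOpenImage_geodesicFlow (hg : IsComplete g) (hΩ : IsObstacle n Ω)
    (hN : IsOpenNhdZero (regularBoundary g Ω) N) (hinj : InjOn (geodesicFlow g) N) :
    IsDiffeoOntoOpenImage (timeModel n) (𝓡 n).tangent (geodesicFlow g) N (unitBundle g) := by
  have hB := isOpenInRegular_regularBoundary hg hΩ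
  have hu : ∀ w ∈ N, geodesicFlow g w ∈ unitBundle g := fun w hw =>
    geodesicFlow_mem_unit hg (mem_phaseBoundary_of_mem_regular (hN.snd_mem hw)).1
  refine ⟨smoothOn_iff.2 fun w _ => ⟨_, smoothNear_geodesicFlow hg w,
    Eventually.of_forall fun _ _ => rfl⟩, ?_, ?_⟩
  · refine ⟨interior {z | z ∈ unitBundle g → z ∈ geodesicFlow g '' N}, isOpen_interior, ?_⟩
    ext z
    constructor
    · rintro ⟨w, hw, rfl⟩
      refine ⟨mem_interior_iff_mem_nhds.2 ?_, hu w hw⟩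
      obtain ⟨k, -, -, hinv, hk⟩ := exists_flow_inverse_mem hg hΩ hB hN hw
      filter_upwards [hk] with z hz hzu
      exact ⟨k z, hz hzu, hinv z⟩
    · rintro ⟨h1, h2⟩
      exact interior_subset (s := {z | z ∈ unitBundle g → z ∈ geodesicFlow g '' N}) h1 h2
  · classical
    rcases N.eq_empty_or_nonempty with rfl | ⟨w₀, -⟩
    · exact ⟨fun p => (0, p), fun w hw => hw.elim, fun z hz => by simp at hz⟩
    have : Nonempty (ℝ × TangentBundle (𝓡 n) X) := ⟨w₀⟩
    have hl : ∀ w ∈ N, Function.invFunOn (geodesicFlow g) N (geodesicFlow g w) = w :=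
      fun w hw => hinj.leftInvOn_invFunOn hw
    refine ⟨Function.invFunOn (geodesicFlow g) N, hl, smoothOn_iff.2 ?_⟩
    rintro _ ⟨w, hw, rfl⟩
    obtain ⟨k, hk, -, hinv, hkN⟩ := exists_flow_inverse_mem hg hΩ hB hN hw
    -- The local inverse takes unit vectors into `N`, so it agrees with the global one on the image
    -- of `N` by injectivity.
    refine ⟨k, hk, ?_⟩
    filter_upwards [hkN] with z hz
    rintro ⟨w', hw', rfl⟩
    rw [hl w' hw']
    exact hinj (hz (hu w' hw')) hw' (hinv _)

theorem geometricReflection_geodesicFlow (hinj : InjOn (geodesicFlow g) N)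
    {w : ℝ × TangentBundle (𝓡 n) X} (hw : w ∈ N) :
    geometricReflection g Ω N (geodesicFlow g w) = geodesicFlow g (w.1, reflect g Ω w.2) := by
  have h : ∃ w' ∈ N, geodesicFlow g w' = geodesicFlow g w := ⟨w, hw, rfl⟩
  rw [geometricReflection, dif_pos h, hinj h.choose_spec.1 hw h.choose_spec.2]

theorem exists_smoothNear_reflect_snd (hg : IsComplete g) (hΩ : IsObstacle n Ω)
    {w : ℝ × TangentBundle (𝓡 n) X} (hw : w.2.proj ∈ frontier Ω) :
    ∃ h : ℝ × TangentBundle (𝓡 n) X → ℝ × TangentBundle (𝓡 n) X,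
      SmoothNear (timeModel n) (timeModel n) h w ∧
        ∀ᶠ z in 𝓝 w, z.2.proj ∈ frontier Ω → h z = (z.1, reflect g Ω z.2) := by
  obtain ⟨h, hs, he⟩ := exists_smoothNear_reflect hg hΩ hw
  refine ⟨fun z => (z.1, h z.2), ?_, ?_⟩
  · exact SmoothNear.prodMk contMDiff_fst.smoothNear
      (SmoothNear.comp (f := fun z : ℝ × TangentBundle (𝓡 n) X => z.2) hs contMDiff_snd.smoothNear)
  · have h1 : ∀ᶠ z : ℝ × TangentBundle (𝓡 n) X in 𝓝 w,
        z.2.proj ∈ frontier Ω → h z.2 = reflect g Ω z.2 := continuousAt_snd.eventually he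
    filter_upwards [h1] with z hz hzf
    rw [hz hzf]

theorem exists_smoothNear_geometricReflection (hg : IsComplete g) (hΩ : IsObstacle n Ω)
    (hN : IsOpenNhdZero (regularBoundary g Ω) N) (hinj : InjOn (geodesicFlow g) N)
    {w : ℝ × TangentBundle (𝓡 n) X} (hw : w ∈ N) :
    ∃ h : TangentBundle (𝓡 n) X → TangentBundle (𝓡 n) X,
      SmoothNear (𝓡 n).tangent (𝓡 n).tangent h (geodesicFlow g w) ∧
        ∀ᶠ z in 𝓝 (geodesicFlow g w), z ∈ unitBundle g → h z = geometricReflection g Ω N z := by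
  obtain ⟨k, hk, hkw, hinv, hkN⟩ :=
    exists_flow_inverse_mem hg hΩ (isOpenInRegular_regularBoundary hg hΩ) hN hw
  obtain ⟨h, hs, he⟩ := exists_smoothNear_reflect_snd hg hΩ
    (mem_phaseBoundary_of_mem_regular (hN.snd_mem hw)).2
  refine ⟨fun z => geodesicFlow g (h (k z)), ?_, ?_⟩
  · exact SmoothNear.comp (k := geodesicFlow g) (f := fun z => h (k z))
      (smoothNear_geodesicFlow hg _) (SmoothNear.comp (by rw [hkw]; exact hs) hk)
  · have h1 := hk.continuousAt.eventually
      (p := fun z => z.2.proj ∈ frontier Ω → h z = (z.1, reflect g Ω z.2)) (by rw [hkw]; exact he)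
    filter_upwards [h1, hkN] with z hz1 hz2 hzu
    have h2 := hz2 hzu
    rw [hz1 (mem_phaseBoundary_of_mem_regular (hN.snd_mem h2)).2,
      ← geometricReflection_geodesicFlow hinj h2, hinv]

/-! ### The local billiard flow -/

theorem localFlow_of_nonpos {w : ℝ × TangentBundle (𝓡 n) X} (h : w.1 ≤ 0) :
    localFlow g Ω w = geodesicFlow g w := if_pos h

theorem localFlow_of_pos {w : ℝ × TangentBundle (𝓡 n) X} (h : 0 < w.1) :
    localFlow g Ω w = geodesicFlow g (w.1, reflect g Ω w.2) := if_neg h.not_ge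

theorem localFlow_zero (hg : IsComplete g) {w : ℝ × TangentBundle (𝓡 n) X} (h : w.1 = 0) :
    localFlow g Ω w = w.2 := by
  rw [localFlow_of_nonpos h.le]
  obtain ⟨t, p⟩ := w
  obtain rfl : t = 0 := h
  exact geodesicFlow_zero hg p

theorem localFlow_mem_unitBundle (hg : IsComplete g) (hΩ : IsObstacle n Ω)
    {w : ℝ × TangentBundle (𝓡 n) X} (hw : w.2 ∈ phaseBoundary g Ω) :
    localFlow g Ω w ∈ unitBundle g := by
  rcases le_or_gt w.1 0 with h | h
  · rw [localFlow_of_nonpos h]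
    exact geodesicFlow_mem_unit hg hw.1
  · rw [localFlow_of_pos h]
    exact geodesicFlow_mem_unit hg (reflect_mem_unitBundle hg hΩ hw)

theorem exists_smoothNear_localFlow (hg : IsComplete g) (hΩ : IsObstacle n Ω)
    {w : ℝ × TangentBundle (𝓡 n) X} (hw : w.2.proj ∈ frontier Ω) (h0 : w.1 ≠ 0) :
    ∃ h : ℝ × TangentBundle (𝓡 n) X → TangentBundle (𝓡 n) X,
      SmoothNear (timeModel n) (𝓡 n).tangent h w ∧
        ∀ᶠ z in 𝓝 w, z.2.proj ∈ frontier Ω → h z = localFlow g Ω z := by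
  rcases h0.lt_or_gt with h0 | h0
  · refine ⟨geodesicFlow g, smoothNear_geodesicFlow hg w, ?_⟩
    filter_upwards [continuousAt_fst.eventually (gt_mem_nhds h0)] with z hz _
    rw [localFlow_of_nonpos (le_of_lt hz)]
  · obtain ⟨h, hs, he⟩ := exists_smoothNear_reflect_snd hg hΩ hw
    refine ⟨fun z => geodesicFlow g (h z), SmoothNear.comp (smoothNear_geodesicFlow hg _) hs, ?_⟩
    filter_upwards [continuousAt_fst.eventually (lt_mem_nhds h0), he] with z hz1 hz2 hzf
    rw [localFlow_of_pos hz1, hz2 hzf]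

/-- At nonzero times the local flow has no kink: it is the geodesic flow, or the geodesic flow after
a reflection, which is its own inverse. Both are inverted by `exists_flow_inverse`. -/
theorem exists_localFlow_inverse (hg : IsComplete g) (hΩ : IsObstacle n Ω)
    (hN : IsOpenNhdZero (inBoundary g Ω) N) {w : ℝ × TangentBundle (𝓡 n) X} (hw : w ∈ N)
    (h0 : w.1 ≠ 0) :
    ∃ κ : TangentBundle (𝓡 n) X → ℝ × TangentBundle (𝓡 n) X,
      SmoothNear (𝓡 n).tangent (timeModel n) κ (localFlow g Ω w) ∧ κ (localFlow g Ω w) = w ∧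
        ∀ᶠ z in 𝓝 (localFlow g Ω w), z ∈ unitBundle g → κ z ∈ N ∧ localFlow g Ω (κ z) = z := by
  have hwin := hN.snd_mem hw
  rcases h0.lt_or_gt with h0 | h0
  · obtain ⟨k, hk, hkw, hinv, hkN⟩ :=
      exists_flow_inverse_mem hg hΩ (isOpenInRegular_inBoundary hg hΩ) hN hw
    rw [localFlow_of_nonpos h0.le]
    refine ⟨k, hk, hkw, ?_⟩
    have h1 := hk.continuousAt.eventually (p := fun z => z.1 < 0)
      (by rw [hkw]; exact continuousAt_fst.eventually (gt_mem_nhds h0))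
    filter_upwards [hkN, h1] with z hz1 hz2 hzu
    exact ⟨hz1 hzu, by rw [localFlow_of_nonpos (le_of_lt hz2), hinv]⟩
  · rw [localFlow_of_pos h0]
    have hout := reflect_mem_outBoundary hg hΩ hwin
    obtain ⟨k, hk, hkw, hinv, hbd, -⟩ := exists_flow_inverse hg hΩ
      (w₀ := (w.1, reflect g Ω w.2)) (Or.inr hout)
    obtain ⟨h, hs, he⟩ := exists_smoothNear_reflect_snd hg hΩ (w := (w.1, reflect g Ω w.2))
      hout.1.2
    have hh : h (w.1, reflect g Ω w.2) = w := by
      rw [he.self_of_nhds hout.1.2]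
      exact Prod.ext rfl (reflect_reflect hg hΩ hwin.1.2)
    have hsk : SmoothNear (𝓡 n).tangent (timeModel n) (fun z => h (k z))
        (geodesicFlow g (w.1, reflect g Ω w.2)) := SmoothNear.comp (by rw [hkw]; exact hs) hk
    refine ⟨fun z => h (k z), hsk, by beta_reduce; rw [hkw, hh], ?_⟩
    have h1 := hk.continuousAt.eventually (p := fun z => (0 < z.1 ∧
        (z.2 ∈ phaseBoundary g Ω → z.2 ∈ outBoundary g Ω)) ∧
        (z.2.proj ∈ frontier Ω → h z = (z.1, reflect g Ω z.2)))
      (by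
        rw [hkw]
        have hfst : ContinuousAt Prod.fst (w.1, reflect g Ω w.2) := continuousAt_fst
        have hsnd : ContinuousAt Prod.snd (w.1, reflect g Ω w.2) := continuousAt_snd
        exact ((hfst.eventually (lt_mem_nhds h0)).and
          (hsnd.eventually (eventually_mem_outBoundary hg hΩ hout))).and he)
    have h2 := hsk.continuousAt.eventually (p := fun z => z.2 ∈ inBoundary g Ω → z ∈ N)
      (by beta_reduce; rw [hkw, hh]; exact hN.eventually_mem hw)
    filter_upwards [hbd, h1, h2] with z hz1 ⟨⟨hz2, hz3⟩, hz4⟩ hz5 hzu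
    have h3 := hz1 hzu
    rw [hz4 h3.2] at hz5 ⊢
    refine ⟨hz5 (reflect_mem_inBoundary hg hΩ (hz3 h3)), ?_⟩
    rw [localFlow_of_pos (by exact hz2)]
    simp only
    rw [reflect_reflect hg hΩ h3.2]
    exact hinv z

/-! ### Flow charts -/

theorem IsFlowChartDomain.localFlow_notMem (h : IsFlowChartDomain g Ω N)
    {w : ℝ × TangentBundle (𝓡 n) X} (hw : w ∈ N) (h0 : w.1 ≠ 0) :
    (localFlow g Ω w).proj ∉ Ω := h.2.1 w hw w.1 h0 right_mem_uIcc

theorem IsFlowChartDomain.localFlow_mem (hg : IsComplete g) (hΩ : IsObstacle n Ω)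
    (h : IsFlowChartDomain g Ω N) {w : ℝ × TangentBundle (𝓡 n) X} (hw : w ∈ N) :
    localFlow g Ω w ∈ phaseSpace g Ω \ grazingBoundary g Ω := by
  have hin := h.1.snd_mem hw
  by_cases h0 : w.1 = 0
  · rw [localFlow_zero hg h0]
    exact mem_phaseSpace_of_regular hg hΩ (Or.inl hin)
  · exact mem_phaseSpace_of_interior hΩ.1
      ⟨localFlow_mem_unitBundle hg hΩ hin.1, h.localFlow_notMem hw h0⟩

theorem exists_isFlowChartDomain (hg : IsComplete g) (hΩ : IsObstacle n Ω) :
    ∃ N, IsFlowChartDomain g Ω N := by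
  -- The factor `2` serves injectivity: if trajectories with times of opposite signs meet, one
  -- starting point lies over the other trajectory at a time difference `|t₁| + |t₂|`, at most twice
  -- the larger of the two, which `P` excludes.
  let P : ℝ × TangentBundle (𝓡 n) X → Prop := fun w =>
    ∀ s, |s| ≤ 2 * |w.1| → s ≠ 0 → (localFlow g Ω (s, w.2)).proj ∉ Ω
  have hcl := hΩ.1
  have hnhd : IsOpenNhdZero (inBoundary g Ω) (relInterior (inBoundary g Ω) P) := by
    refine isOpenNhdZero_relInterior fun p hp => ?_
    have hout := reflect_mem_outBoundary hg hΩ hp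
    obtain ⟨h, hs, he⟩ := exists_smoothNear_reflect_snd hg hΩ (w := ((0 : ℝ), p)) hp.1.2
    have hh : h (0, p) = (0, reflect g Ω p) := he.self_of_nhds hp.1.2
    have h1 := hs.continuousAt.eventually (p := fun w => w.2.proj ∈ frontier Ω →
      0 < w.1 → (geodesicFlow g w).proj ∉ Ω) (by
        rw [hh]
        exact (eventually_sign_outBoundary hg hΩ hout).mono fun w hw hwf => (hw hwf).2)
    have h2 : ∀ᶠ w : ℝ × TangentBundle (𝓡 n) X in 𝓝 (0, p), w.2 ∈ inBoundary g Ω → w.1 ≠ 0 →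
        (localFlow g Ω w).proj ∉ Ω := by
      filter_upwards [h1, he, eventually_sign_inBoundary hg hΩ hp] with w hw1 hw2 hw3 hin h0
      rcases h0.lt_or_gt with h0 | h0
      · rw [localFlow_of_nonpos h0.le]
        exact (hw3 hin.1.2).2 h0
      · rw [localFlow_of_pos h0]
        rw [hw2 hin.1.2] at hw1
        exact hw1 hin.1.2 h0
    filter_upwards [eventually_forall_abs_le h2 2] with w hw hin s hs h0
    exact hw s hs hin h0
  have hP : ∀ w ∈ relInterior (inBoundary g Ω) P, P w := fun w hw => of_mem_relInterior hw
  have hself : ∀ w ∈ relInterior (inBoundary g Ω) P, w.1 ≠ 0 → (localFlow g Ω w).proj ∉ Ω :=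
    fun w hw h0 => hP w hw w.1 (by linarith [abs_nonneg w.1]) h0
  have hfr : ∀ p ∈ inBoundary g Ω, p.proj ∈ Ω := fun p hp => hcl.frontier_subset hp.1.2
  have hneg : ∀ w ∈ relInterior (inBoundary g Ω) P, ∀ s < 0, |s| ≤ 2 * |w.1| →
      (geodesicFlow g (s, w.2)).proj ∉ Ω := fun w hw s hs hle => by
    have := hP w hw s hle hs.ne
    rwa [localFlow_of_nonpos (by exact hs.le)] at this
  have hpos : ∀ w ∈ relInterior (inBoundary g Ω) P, ∀ s > 0, |s| ≤ 2 * |w.1| →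
      (geodesicFlow g (s, reflect g Ω w.2)).proj ∉ Ω := fun w hw s hs hle => by
    have := hP w hw s hle hs.ne'
    rwa [localFlow_of_pos (by exact hs)] at this
  have hshift : ∀ {s t : ℝ} {p q : TangentBundle (𝓡 n) X},
      geodesicFlow g (s, p) = geodesicFlow g (t, q) → geodesicFlow g (s - t, p) = q := by
    intro s t p q h
    rw [sub_eq_neg_add, geodesicFlow_add hg, h, geodesicFlow_neg hg]
  refine ⟨relInterior (inBoundary g Ω) P, hnhd, fun w hw s h0 hs => hP w hw s ?_ h0, ?_⟩
  · have := abs_sub_left_of_mem_uIcc hs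
    rw [sub_zero, sub_zero] at this
    linarith [abs_nonneg w.1]
  · have key : ∀ w₁ ∈ relInterior (inBoundary g Ω) P, ∀ w₂ ∈ relInterior (inBoundary g Ω) P,
        w₁.1 ≤ w₂.1 → localFlow g Ω w₁ = localFlow g Ω w₂ → w₁ = w₂ := by
      intro w₁ hw₁ w₂ hw₂ hle heq
      by_cases h1 : w₁.1 = 0
      · have h2 : w₂.1 = 0 := by
          by_contra h2
          refine hself w₂ hw₂ h2 ?_
          rw [← heq, localFlow_zero hg h1]
          exact hfr _ hw₁.1
        rw [localFlow_zero hg h1, localFlow_zero hg h2] at heq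
        exact Prod.ext (h1.trans h2.symm) heq
      by_cases h2 : w₂.1 = 0
      · refine absurd ?_ (hself w₁ hw₁ h1)
        rw [heq, localFlow_zero hg h2]
        exact hfr _ hw₂.1
      obtain ⟨t₁, p₁⟩ := w₁
      obtain ⟨t₂, p₂⟩ := w₂
      simp only at hle h1 h2
      rcases lt_or_gt_of_ne h1 with h1 | h1 <;> rcases lt_or_gt_of_ne h2 with h2 | h2
      · rw [localFlow_of_nonpos (by exact h1.le), localFlow_of_nonpos (by exact h2.le)] at heq
        have h3 := hshift heq
        rcases hle.lt_or_eq with h4 | rfl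
        · refine absurd (hfr p₂ hw₂.1) (h3 ▸ hneg _ hw₁ (t₁ - t₂) (by linarith) ?_)
          simp only
          rw [abs_of_neg (by linarith), abs_of_neg h1]
          linarith
        · rw [sub_self, geodesicFlow_zero hg] at h3
          rw [h3]
      · rw [localFlow_of_nonpos (by exact h1.le), localFlow_of_pos (by exact h2)] at heq
        rcases le_total |t₁| |t₂| with h4 | h4
        · refine absurd (hfr p₁ hw₁.1) ((hshift heq.symm) ▸ hpos _ hw₂ (t₂ - t₁) (by linarith) ?_)
          simp only
          rw [abs_of_neg h1] at h4
          rw [abs_of_pos (by linarith), abs_of_pos h2] at *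
          linarith
        · refine absurd (hfr _ (show p₂ ∈ _ from hw₂.1)) ?_
          have h5 := hneg _ hw₁ (t₁ - t₂) (by linarith) (by
            simp only
            rw [abs_of_pos h2] at h4
            rw [abs_of_neg (by linarith), abs_of_neg h1] at *
            linarith)
          rw [hshift heq] at h5
          exact h5
      · linarith
      · rw [localFlow_of_pos (by exact h1), localFlow_of_pos (by exact h2)] at heq
        rcases hle.lt_or_eq with h4 | rfl
        · refine absurd (hfr p₁ hw₁.1) ?_
          have h5 := hpos _ hw₂ (t₂ - t₁) (by linarith) (by
            simp only
            rw [abs_of_pos (by linarith), abs_of_pos h2]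
            linarith)
          rw [hshift heq.symm] at h5
          exact h5
        · have h3 := hshift heq
          rw [sub_self, geodesicFlow_zero hg] at h3
          rw [← reflect_reflect hg hΩ (p := p₁) hw₁.1.1.2, h3, reflect_reflect hg hΩ hw₂.1.1.2]
    have key' : ∀ w₁ ∈ relInterior (inBoundary g Ω) P, ∀ w₂ ∈ relInterior (inBoundary g Ω) P,
        localFlow g Ω w₁ = localFlow g Ω w₂ → w₁ = w₂ := fun w₁ h₁ w₂ h₂ heq =>
      (le_total w₁.1 w₂.1).elim (fun h => key w₁ h₁ w₂ h₂ h heq)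
        fun h => (key w₂ h₂ w₁ h₁ h heq.symm).symm
    rintro w₁ w₂ q ⟨hw₁, m₁, hq₁⟩ ⟨hw₂, m₂, hq₂⟩
    -- Glued but distinct values lie over the boundary, so both times would be zero; then one inward
    -- vector would be the reflection of another, which points outward.
    rcases (Model.proj_eq_iff hg hΩ).1 (hq₁.symm.trans hq₂) with h | ⟨h1, h2⟩
    · exact key' w₁ hw₁ w₂ hw₂ (Subtype.ext_iff.1 h)
    · exfalso
      simp only at h1 h2
      have h3 : w₁.1 = 0 := by
        by_contra h
        exact notMem_of_phaseBoundary hcl (hself w₁ hw₁ h) h1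
      have h4 : w₂.1 = 0 := by
        by_contra h
        refine notMem_of_phaseBoundary (g := g) hcl (hself w₂ hw₂ h) ?_
        rw [h2]
        exact reflect_mem_phaseBoundary hg hΩ h1
      rw [localFlow_zero hg h3, localFlow_zero hg h4] at h2
      have h5 := reflect_mem_outBoundary hg hΩ hw₁.1
      rw [← h2] at h5
      exact notMem_outBoundary hw₂.1 h5

end Model

section Regular

variable {n : ℕ} {X : Type*} [TopologicalSpace X] [ChartedSpace (Euc n) X] [IsManifold (𝓡 n) ∞ X]
  [T2Space X] {g g' : Metric n X} {Ω : Set X} {N N' : Set (ℝ × TangentBundle (𝓡 n) X)}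

/-! ### The mixed map at positive times -/

theorem mixedMap_of_nonpos {w : ℝ × TangentBundle (𝓡 n) X} (h : w.1 ≤ 0) :
    mixedMap g g' Ω N' w = geodesicFlow g w := if_pos h

theorem mixedMap_of_pos {w : ℝ × TangentBundle (𝓡 n) X} (h : 0 < w.1) :
    mixedMap g g' Ω N' w = rescale g (geometricReflection g' Ω N'
      (rescale g' (geodesicFlow g (w.1, reflect g Ω w.2)))) := if_neg h.not_ge

/-- The formula for positive times is a composition of smoothly extendable maps wherever it is
defined. No sign of `w.1` is required, so it can also be evaluated at time zero. -/
theorem exists_smoothNear_mixedMap (hg : IsComplete g) (hg' : IsComplete g') (hΩ : IsObstacle n Ω)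
    (hN' : IsOpenNhdZero (regularBoundary g' Ω) N') (hinj' : InjOn (geodesicFlow g') N')
    {w : ℝ × TangentBundle (𝓡 n) X} (hw : w.2 ∈ phaseBoundary g Ω)
    (hmem : rescale g' (geodesicFlow g (w.1, reflect g Ω w.2)) ∈ geodesicFlow g' '' N') :
    ∃ h : ℝ × TangentBundle (𝓡 n) X → TangentBundle (𝓡 n) X,
      SmoothNear (timeModel n) (𝓡 n).tangent h w ∧
        ∀ᶠ z in 𝓝 w, z.2 ∈ phaseBoundary g Ω → h z = rescale g (geometricReflection g' Ω N'
          (rescale g' (geodesicFlow g (z.1, reflect g Ω z.2)))) := by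
  obtain ⟨v, hv, hvw⟩ := hmem
  obtain ⟨r, hr, hre⟩ := exists_smoothNear_reflect_snd hg hΩ hw.2
  have hrw : r w = (w.1, reflect g Ω w.2) := hre.self_of_nhds hw.2
  have hunit : ∀ z : ℝ × TangentBundle (𝓡 n) X, z.2 ∈ phaseBoundary g Ω →
      geodesicFlow g (z.1, reflect g Ω z.2) ∈ unitBundle g := fun z hz =>
    geodesicFlow_mem_unit hg (reflect_mem_unitBundle hg hΩ hz)
  have ha : SmoothNear (timeModel n) (𝓡 n).tangent (fun z => rescale g' (geodesicFlow g (r z))) w :=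
    SmoothNear.comp (k := rescale g') (f := fun z => geodesicFlow g (r z))
      (smoothNear_rescale g' (by rw [hrw]; exact snd_ne_zero_of_mem_unitBundle (hunit w hw)))
      (SmoothNear.comp (smoothNear_geodesicFlow hg _) hr)
  have haw : rescale g' (geodesicFlow g (r w)) = geodesicFlow g' v := by rw [hrw, hvw]
  obtain ⟨h, hs, he⟩ := exists_smoothNear_geometricReflection hg' hΩ hN' hinj' hv
  have hvb := mem_phaseBoundary_of_mem_regular (hN'.snd_mem hv)
  have hhv : h (geodesicFlow g' v) ∈ unitBundle g' := by
    rw [he.self_of_nhds (geodesicFlow_mem_unit hg' hvb.1),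
      geometricReflection_geodesicFlow hinj' hv]
    exact geodesicFlow_mem_unit hg' (reflect_mem_unitBundle hg' hΩ hvb)
  refine ⟨fun z => rescale g (h (rescale g' (geodesicFlow g (r z)))),
    SmoothNear.comp (k := rescale g) (f := fun z => h (rescale g' (geodesicFlow g (r z))))
      (smoothNear_rescale g (by rw [haw]; exact snd_ne_zero_of_mem_unitBundle hhv))
      (SmoothNear.comp (by rw [haw]; exact hs) ha), ?_⟩
  have h1 := ha.continuousAt.eventually
    (p := fun z => z ∈ unitBundle g' → h z = geometricReflection g' Ω N' z)
    (by beta_reduce; rw [haw]; exact he)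
  filter_upwards [h1, hre] with z hz1 hz2 hz
  rw [hz2 hz.2] at hz1 ⊢
  rw [hz1 (rescale_mem_unitBundle g' (snd_ne_zero_of_mem_unitBundle (hunit z hz)))]

/-! ### Agreement of the reflections -/

/-- The tangential reflections of `g` and `g'` agree on `∂M \ ∂_g M`. -/
def ReflectionsAgree (g g' : Metric n X) (Ω : Set X) : Prop :=
  ∀ p ∈ phaseBoundary g Ω \ grazingBoundary g Ω,
    rescale g' (reflect g Ω p) = reflect g' Ω (rescale g' p)

theorem ReflectionsAgree.symm (hg : IsComplete g) (hg' : IsComplete g') (hΩ : IsObstacle n Ω)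
    (h : ReflectionsAgree g g' Ω) : ReflectionsAgree g' g Ω := by
  intro p hp
  have hq : rescale g p ∈ phaseBoundary g Ω \ grazingBoundary g Ω := by
    rw [phaseBoundary_diff_grazingBoundary hg hΩ]
    rw [phaseBoundary_diff_grazingBoundary hg' hΩ] at hp
    exact rescale_mem_regularBoundary hg' hg hΩ hp
  have h1 := h _ hq
  rw [rescale_rescale_of_mem hp.1.1] at h1
  rw [← h1, rescale_rescale_of_mem (reflect_mem_unitBundle hg hΩ hq.1)]

/-- At `(0, p)` the mixed map has the value `p`, while the branch for positive times tends to
`R_{g'} R_g p`, up to rescaling. Continuity forces equality for inward `p`; outward vectors follow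
because reflections are involutions. -/
theorem reflectionsAgree_of_mixedMapRegular (hg : IsComplete g) (hg' : IsComplete g')
    (hΩ : IsObstacle n Ω) (hN : IsOpenNhdZero (regularBoundary g Ω) N)
    (hN' : IsOpenNhdZero (regularBoundary g' Ω) N') (hinj' : InjOn (geodesicFlow g') N')
    (hreg : MixedMapRegular g g' Ω N N') : ReflectionsAgree g g' Ω := by
  have key : ∀ p ∈ inBoundary g Ω, rescale g' (reflect g Ω p) = reflect g' Ω (rescale g' p) := by
    intro p hp
    have hR := reflect_mem_outBoundary hg hΩ hp
    have hR' := rescale_mem_outBoundary hg hg' hΩ hR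
    have h0 : rescale g' (geodesicFlow g (0, reflect g Ω p)) =
        geodesicFlow g' (0, rescale g' (reflect g Ω p)) := by
      rw [geodesicFlow_zero hg, geodesicFlow_zero hg']
    have hmN' : ((0 : ℝ), rescale g' (reflect g Ω p)) ∈ N' := hN'.zero_mem (Or.inr hR')
    obtain ⟨h, hs, he⟩ := exists_smoothNear_mixedMap hg hg' hΩ hN' hinj' (w := (0, p)) hp.1
      ⟨_, hmN', h0.symm⟩
    have hpN : ((0 : ℝ), p) ∈ N ∩ (univ ×ˢ inBoundary g Ω) :=
      ⟨hN.zero_mem (Or.inl hp), mem_univ _, hp⟩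
    obtain ⟨m, hm, hme⟩ := smoothOn_iff.1 hreg.2 _ hpN
    have hc : Tendsto (fun t : ℝ => (t, p)) (𝓝[>] 0) (𝓝 (0, p)) :=
      (Continuous.prodMk_left p).continuousAt.tendsto.mono_left nhdsWithin_le_nhds
    have heq : ∀ᶠ t in 𝓝[>] (0 : ℝ), m (t, p) = h (t, p) := by
      filter_upwards [hc.eventually hme, hc.eventually he,
        hc.eventually (hN.eventually_mem hpN.1), self_mem_nhdsWithin] with t h1 h2 h3 h4
      rw [h1 ⟨h3 (Or.inl hp), mem_univ _, hp⟩, h2 hp.1, mixedMap_of_pos (by exact h4)]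
    have h1 : m (0, p) = h (0, p) := tendsto_nhds_unique_of_eventuallyEq
      (hm.continuousAt.tendsto.comp hc) (hs.continuousAt.tendsto.comp hc) heq
    rw [hme.self_of_nhds hpN, mixedMap_of_nonpos le_rfl, he.self_of_nhds hp.1] at h1
    simp only at h1
    rw [h0, geometricReflection_geodesicFlow hinj' hmN', geodesicFlow_zero hg,
      geodesicFlow_zero hg'] at h1
    rw [h1, rescale_rescale_of_mem (reflect_mem_unitBundle hg' hΩ hR'.1), ← h1,
      reflect_reflect hg' hΩ hR'.1.2]
  intro p hp
  rw [phaseBoundary_diff_grazingBoundary hg hΩ] at hp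
  rcases hp with hp | hp
  · exact key p hp
  · have h1 := key _ (reflect_mem_inBoundary hg hΩ hp)
    rw [reflect_reflect hg hΩ hp.1.2] at h1
    rw [h1, reflect_reflect hg' hΩ (p := rescale g' (reflect g Ω p)) hp.1.2]

/-! ### The map between the model spaces -/

theorem identify_identify (p : NonGrazing g Ω) : identify g' g Ω (identify g g' Ω p) = p :=
  Subtype.ext (rescale_rescale_of_mem p.2.1.1)

theorem continuous_identify : Continuous (identify g g' Ω) := by
  refine Continuous.subtype_mk (continuous_iff_continuousAt.2 fun p => ?_) _
  exact ContinuousAt.comp (g := rescale g') (smoothNear_rescale g'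
    (snd_ne_zero_of_mem_unitBundle p.2.1.1)).continuousAt continuous_subtype_val.continuousAt

/-- The map `𝓜_g → 𝓜_{g'}` which is compatible with the projections. -/
def modelMap (h : ReflectionsAgree g g' Ω) : Model g Ω → Model g' Ω :=
  Quot.map (identify g g' Ω) fun p q hpq => ⟨rescale_mem_phaseBoundary g' hpq.1, by
    change rescale g' q.1 = _
    rw [hpq.2, h _ ⟨hpq.1, p.2.2⟩]
    rfl⟩

theorem modelMap_proj (h : ReflectionsAgree g g' Ω) (p : NonGrazing g Ω) :
    modelMap h (Model.proj g Ω p) = Model.proj g' Ω (identify g g' Ω p) := rfl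

theorem continuous_modelMap (h : ReflectionsAgree g g' Ω) : Continuous (modelMap h) :=
  isQuotientMap_quot_mk.continuous_iff.2 (continuous_quot_mk.comp continuous_identify)

theorem modelMap_modelMap (h : ReflectionsAgree g g' Ω) (h' : ReflectionsAgree g' g Ω)
    (q : Model g Ω) : modelMap h' (modelMap h q) = q := by
  induction q using Quot.ind with
  | mk p => exact congrArg (Model.proj g Ω) (identify_identify p)

/-- The bijection `𝓜_g → 𝓜_{g'}` which is compatible with the projections. -/
def modelEquiv (h : ReflectionsAgree g g' Ω) (h' : ReflectionsAgree g' g Ω) :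
    Model g Ω ≃ Model g' Ω :=
  ⟨modelMap h, modelMap h', modelMap_modelMap h h', modelMap_modelMap h' h⟩

/-! ### Smoothness of the map between the model spaces -/

variable {F : Model g Ω → Model g' Ω}

theorem flowParam_of_localFlow_eq
    (hF : ∀ p, F (Model.proj g Ω p) = Model.proj g' Ω (identify g g' Ω p))
    {v : ℝ × TangentBundle (𝓡 n) X} {p : TangentBundle (𝓡 n) X} (hv : v ∈ N')
    (h : localFlow g' Ω v = rescale g' p) (m : p ∈ phaseSpace g Ω \ grazingBoundary g Ω) :
    flowParam g' Ω N' v (F (Model.proj g Ω ⟨p, m⟩)) :=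
  ⟨hv, h ▸ rescale_mem g g' Ω m,
    (hF _).trans (congrArg (Model.proj g' Ω) (Subtype.ext h.symm))⟩

/-- Off `Ω` nothing is glued, so the equation in the quotient lifts to vectors; time zero is
excluded because it yields boundary points. -/
theorem localFlow_eq_of_flowParam (hg' : IsComplete g') (hΩ : IsObstacle n Ω)
    (hF : ∀ p, F (Model.proj g Ω p) = Model.proj g' Ω (identify g g' Ω p))
    (hN' : IsOpenNhdZero (inBoundary g' Ω) N')
    {v : ℝ × TangentBundle (𝓡 n) X} {p : TangentBundle (𝓡 n) X} (hp : p.proj ∉ Ω)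
    {m : p ∈ phaseSpace g Ω \ grazingBoundary g Ω}
    (h : flowParam g' Ω N' v (F (Model.proj g Ω ⟨p, m⟩))) :
    localFlow g' Ω v = rescale g' p ∧ v.1 ≠ 0 := by
  obtain ⟨hv, m', hq⟩ := h
  have h1 : rescale g' p = localFlow g' Ω v :=
    (Model.proj_eq_iff_of_notMem hg' hΩ (p := identify g g' Ω ⟨p, m⟩) hp).1 ((hF _).symm.trans hq)
  refine ⟨h1.symm, fun h0 => hp ?_⟩
  rw [localFlow_zero hg' h0] at h1
  have h2 : (rescale g' p).proj ∈ frontier Ω := h1 ▸ (hN'.snd_mem hv).1.2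
  exact hΩ.1.frontier_subset h2

theorem readsSmoothly_interior_interior (hg' : IsComplete g') (hΩ : IsObstacle n Ω)
    (hF : ∀ p, F (Model.proj g Ω p) = Model.proj g' Ω (identify g g' Ω p)) :
    ReadsSmoothly (𝓡 n).tangent (𝓡 n).tangent (interiorParam g Ω) (interiorParam g' Ω) F := by
  refine readsSmoothly_iff.2 ?_
  rintro w q w' ⟨hw, m, rfl⟩ ⟨hw', m', hq⟩
  have h1 : w' = rescale g' w :=
    (Model.proj_eq_iff_of_notMem hg' hΩ (p := ⟨w', m'⟩) hw'.2).1 (hq.symm.trans (hF _))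
  refine ⟨rescale g', smoothNear_rescale g' (snd_ne_zero_of_mem_unitBundle hw.1), h1.symm,
    Eventually.of_forall ?_⟩
  rintro z _ ⟨hz, mz, rfl⟩
  exact ⟨⟨rescale_mem_unitBundle g' (snd_ne_zero_of_mem_unitBundle hz.1), hz.2⟩,
    rescale_mem g g' Ω mz, hF _⟩

theorem readsSmoothly_interior_flow (hg' : IsComplete g') (hΩ : IsObstacle n Ω)
    (hF : ∀ p, F (Model.proj g Ω p) = Model.proj g' Ω (identify g g' Ω p))
    (hN' : IsFlowChartDomain g' Ω N') :
    ReadsSmoothly (𝓡 n).tangent (timeModel n) (interiorParam g Ω) (flowParam g' Ω N') F := by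
  refine readsSmoothly_iff.2 ?_
  rintro w q w' ⟨hw, m, rfl⟩ hw'
  obtain ⟨h1, h2⟩ := localFlow_eq_of_flowParam hg' hΩ hF hN'.1 hw.2 hw'
  obtain ⟨κ, hκ, hκw, hκe⟩ := exists_localFlow_inverse hg' hΩ hN'.1 hw'.1 h2
  rw [h1] at hκ hκw hκe
  have hs := smoothNear_rescale g' (snd_ne_zero_of_mem_unitBundle hw.1)
  refine ⟨fun z => κ (rescale g' z), SmoothNear.comp hκ hs, hκw, ?_⟩
  filter_upwards [hs.continuousAt.eventually hκe] with z hz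
  rintro _ ⟨hzi, mz, rfl⟩
  obtain ⟨h3, h4⟩ := hz (rescale_mem_unitBundle g' (snd_ne_zero_of_mem_unitBundle hzi.1))
  exact flowParam_of_localFlow_eq hF h3 h4 mz

theorem readsSmoothly_flow_interior (hg : IsComplete g) (hg' : IsComplete g') (hΩ : IsObstacle n Ω)
    (hF : ∀ p, F (Model.proj g Ω p) = Model.proj g' Ω (identify g g' Ω p))
    (hN : IsFlowChartDomain g Ω N) :
    ReadsSmoothly (timeModel n) (𝓡 n).tangent (flowParam g Ω N) (interiorParam g' Ω) F := by
  refine readsSmoothly_iff.2 ?_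
  rintro w q w' ⟨hw, m, rfl⟩ ⟨hw', m', hq⟩
  have h1 : w' = rescale g' (localFlow g Ω w) :=
    (Model.proj_eq_iff_of_notMem hg' hΩ (p := ⟨w', m'⟩) hw'.2).1 (hq.symm.trans (hF _))
  have hwb := (hN.1.snd_mem hw).1
  have h0 : w.1 ≠ 0 := by
    intro h0
    have h2 := hw'.2
    rw [h1, localFlow_zero hg h0] at h2
    exact h2 (hΩ.1.frontier_subset hwb.2)
  obtain ⟨a, ha, hae⟩ := exists_smoothNear_localFlow hg hΩ hwb.2 h0
  have haw := hae.self_of_nhds hwb.2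
  refine ⟨fun z => rescale g' (a z), SmoothNear.comp (smoothNear_rescale g' ?_) ha,
    by beta_reduce; rw [h1, haw], ?_⟩
  · rw [haw]
    exact snd_ne_zero_of_mem_unitBundle m.1.1
  · filter_upwards [hae, continuousAt_fst.eventually (isOpen_ne.mem_nhds h0)] with z hz1 hz2
    rintro _ ⟨hz, mz, rfl⟩
    rw [hz1 (hN.1.snd_mem hz).1.2]
    exact ⟨⟨rescale_mem_unitBundle g' (snd_ne_zero_of_mem_unitBundle mz.1.1),
      hN.localFlow_notMem hz hz2⟩, rescale_mem g g' Ω mz, hF _⟩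

/-- The map between the model spaces is smooth along the gluing region. -/
theorem exists_smoothNear_flow_flow (hg : IsComplete g) (hg' : IsComplete g') (hΩ : IsObstacle n Ω)
    {D D' : Set (ℝ × TangentBundle (𝓡 n) X)} (hD : IsFlowChartDomain g Ω D)
    (hD' : IsFlowChartDomain g' Ω D') (hN : IsOpenNhdZero (regularBoundary g Ω) N)
    (hN' : IsOpenNhdZero (regularBoundary g' Ω) N') (hinj' : InjOn (geodesicFlow g') N')
    (hreg : MixedMapRegular g g' Ω N N') {y : TangentBundle (𝓡 n) X} (hy : y ∈ inBoundary g Ω) :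
    ∃ θ : ℝ × TangentBundle (𝓡 n) X → ℝ × TangentBundle (𝓡 n) X,
      SmoothNear (timeModel n) (timeModel n) θ (0, y) ∧ θ (0, y) = (0, rescale g' y) ∧
      ∀ᶠ z in 𝓝 ((0 : ℝ), y), z ∈ D → θ z ∈ D' ∧
        localFlow g' Ω (θ z) = rescale g' (localFlow g Ω z) := by
  have hy' := rescale_mem_inBoundary hg hg' hΩ hy
  have hR := reflect_mem_outBoundary hg hΩ hy
  have hR' := rescale_mem_outBoundary hg hg' hΩ hR
  have hagree := reflectionsAgree_of_mixedMapRegular hg hg' hΩ hN hN' hinj' hreg y (by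
    rw [phaseBoundary_diff_grazingBoundary hg hΩ]; exact Or.inl hy)
  have hyN : ((0 : ℝ), y) ∈ N ∩ (univ ×ˢ inBoundary g Ω) :=
    ⟨hN.zero_mem (Or.inl hy), mem_univ _, hy⟩
  obtain ⟨m, hm, hme⟩ := smoothOn_iff.1 hreg.2 _ hyN
  have hmy : m (0, y) = y := by
    rw [hme.self_of_nhds hyN, mixedMap_of_nonpos le_rfl, geodesicFlow_zero hg]
  have hb : SmoothNear (timeModel n) (𝓡 n).tangent (fun z => rescale g' (m z)) (0, y) :=
    SmoothNear.comp (smoothNear_rescale g' (by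
      rw [hmy]; exact snd_ne_zero_of_mem_unitBundle hy.1.1)) hm
  -- local inverses of the flow of `g'` near the two limit points
  obtain ⟨k, hk, hk0, hkinv, hkbd, hkl⟩ := exists_flow_inverse hg' hΩ
    (w₀ := ((0 : ℝ), rescale g' y)) (Or.inl hy')
  obtain ⟨l, hl, hl0, hlinv, hlN⟩ := exists_flow_inverse_mem hg' hΩ
    (isOpenInRegular_regularBoundary hg' hΩ) hN'
    (w := ((0 : ℝ), rescale g' (reflect g Ω y))) (hN'.zero_mem (Or.inr hR'))
  rw [geodesicFlow_zero hg'] at hk hk0 hkbd hl hl0 hlN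
  have hθ0 : k (rescale g' (m (0, y))) = (0, rescale g' y) := by rw [hmy, hk0]
  have hθ : SmoothNear (timeModel n) (timeModel n) (fun z => k (rescale g' (m z))) (0, y) :=
    SmoothNear.comp (f := fun z => rescale g' (m z)) (by rw [hmy]; exact hk) hb
  obtain ⟨ρ, hρ, hρe⟩ := exists_smoothNear_reflect_snd hg hΩ (w := ((0 : ℝ), y)) hy.1.2
  have hρ0 : ρ (0, y) = (0, reflect g Ω y) := hρe.self_of_nhds hy.1.2
  have hc : SmoothNear (timeModel n) (𝓡 n).tangent (fun z => rescale g' (geodesicFlow g (ρ z)))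
      (0, y) :=
    SmoothNear.comp (k := rescale g') (f := fun z => geodesicFlow g (ρ z))
      (smoothNear_rescale g' (by
        rw [hρ0, geodesicFlow_zero hg]; exact snd_ne_zero_of_mem_unitBundle hR.1.1))
      (SmoothNear.comp (smoothNear_geodesicFlow hg _) hρ)
  have hc0 : rescale g' (geodesicFlow g (ρ (0, y))) = rescale g' (reflect g Ω y) := by
    rw [hρ0, geodesicFlow_zero hg]
  have hl' : ContinuousAt (fun z => l (rescale g' (geodesicFlow g (ρ z)))) (0, y) :=
    (SmoothNear.comp (f := fun z => rescale g' (geodesicFlow g (ρ z)))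
      (by rw [hc0]; exact hl) hc).continuousAt
  have hl'0 : l (rescale g' (geodesicFlow g (ρ (0, y)))) = (0, rescale g' (reflect g Ω y)) := by
    rw [hc0, hl0]
  obtain ⟨ρ', hρ', hρ'e⟩ := exists_smoothNear_reflect_snd hg' hΩ
    (w := ((0 : ℝ), rescale g' (reflect g Ω y))) hR'.1.2
  have hρ'0 : ρ' (0, rescale g' (reflect g Ω y)) = (0, rescale g' y) := by
    rw [hρ'e.self_of_nhds hR'.1.2]
    simp only
    rw [hagree, reflect_reflect hg' hΩ hy'.1.2]
  -- the neighborhood conditions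
  have e1 := hb.continuousAt.eventually
    (p := fun z => z ∈ unitBundle g' → (k z).2 ∈ phaseBoundary g' Ω)
    (by beta_reduce; rw [hmy]; exact hkbd)
  have e2 := hθ.continuousAt.eventually
    (p := fun w => (w.2 ∈ phaseBoundary g' Ω → w.2 ∈ inBoundary g' Ω) ∧
      (w.2 ∈ inBoundary g' Ω → w ∈ D') ∧
      (w.2.proj ∈ frontier Ω → (0 < w.1 → (geodesicFlow g' w).proj ∈ interior Ω) ∧
        (w.1 < 0 → (geodesicFlow g' w).proj ∉ Ω)))
    (by
      beta_reduce
      rw [hθ0]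
      have hsnd : ContinuousAt Prod.snd ((0 : ℝ), rescale g' y) := continuousAt_snd
      exact (hsnd.eventually (eventually_mem_inBoundary hg' hΩ hy')).and
        ((hD'.1.eventually_mem (hD'.1.zero_mem hy')).and
          (eventually_sign_inBoundary hg' hΩ hy')))
  have e3 := hc.continuousAt.eventually (p := fun z => z ∈ unitBundle g' → l z ∈ N')
    (by beta_reduce; rw [hc0]; exact hlN)
  -- `v` is the `g'`-flow coordinate of the reflected `g`-trajectory, close to `(0, R_g y)`
  -- rescaled. Reflecting it gives a point close to `(0, y)` rescaled, where `k` inverts the flow of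
  -- `g'`.
  have e4 : ∀ᶠ z in 𝓝 ((0 : ℝ), y), ∀ v, l (rescale g' (geodesicFlow g (ρ z))) = v → v ∈ N' →
      (v.1, reflect g' Ω v.2).2.proj ∈ frontier Ω ∧
      k (geodesicFlow g' (v.1, reflect g' Ω v.2)) = (v.1, reflect g' Ω v.2) ∧
      (v.1 < 0 → (geodesicFlow g' v).proj ∈ interior Ω) := by
    have h1 := hl'.eventually (p := fun v =>
      (v.2.proj ∈ frontier Ω → ρ' v = (v.1, reflect g' Ω v.2)) ∧
      (((ρ' v).2.proj ∈ frontier Ω → k (geodesicFlow g' (ρ' v)) = ρ' v) ∧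
      (v.2.proj ∈ frontier Ω → (v.1 < 0 → (geodesicFlow g' v).proj ∈ interior Ω) ∧
        (0 < v.1 → (geodesicFlow g' v).proj ∉ Ω)))) (by
      beta_reduce
      rw [hl'0]
      refine hρ'e.and (Eventually.and ?_ (eventually_sign_outBoundary hg' hΩ hR'))
      exact hρ'.continuousAt.eventually
        (p := fun v => v.2.proj ∈ frontier Ω → k (geodesicFlow g' v) = v)
        (by rw [hρ'0]; exact hkl))
    filter_upwards [h1] with z hz v hv hvN
    rw [hv] at hz
    obtain ⟨h2, h3, h4⟩ := hz
    have hf := (mem_phaseBoundary_of_mem_regular (hN'.snd_mem hvN)).2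
    rw [h2 hf] at h3
    exact ⟨hf, h3 hf, (h4 hf).1⟩
  -- The reading is the mixed map in flow coordinates of `g'`.
  refine ⟨fun z => k (rescale g' (m z)), hθ, hθ0, ?_⟩
  filter_upwards [hme, hN.eventually_mem hyN.1, hρe, e1, e2, e3, e4] with z z1 z2 z3 z4 z5 z6 z7 hz
  have hzin := hD.1.snd_mem hz
  have hzN : z ∈ N ∩ (univ ×ˢ inBoundary g Ω) := ⟨z2 (Or.inl hzin), mem_univ _, hzin⟩
  replace z1 := z1 hzN
  replace z3 := z3 hzin.1.2
  rw [z3] at z6 z7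
  rcases le_or_gt z.1 0 with ht | ht
  · rw [mixedMap_of_nonpos ht] at z1
    have hu := geodesicFlow_mem_unit hg hzin.1.1
    have h1 := z4 (by rw [z1]; exact rescale_mem_unitBundle g' (snd_ne_zero_of_mem_unitBundle hu))
    have h2 := z5.2.1 (z5.1 h1)
    refine ⟨h2, ?_⟩
    -- A positive time from an inward vector would lead into the interior of `Ω`, where the
    -- `g`-trajectory is not.
    have h3 : (k (rescale g' (m z))).1 ≤ 0 := by
      by_contra h3
      have h4 := (z5.2.2 h1.2).1 (not_le.1 h3)
      rw [hkinv, z1] at h4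
      have h5 : (localFlow g Ω z).proj ∉ interior Ω := (hD.localFlow_mem hg hΩ hz).1.2
      rw [localFlow_of_nonpos ht] at h5
      exact h5 h4
    rw [localFlow_of_nonpos h3, localFlow_of_nonpos ht, hkinv, z1]
  · obtain ⟨v, hvN, hv⟩ := hreg.1 z hzN ht
    rw [mixedMap_of_pos ht, ← hv, geometricReflection_geodesicFlow hinj' hvN] at z1
    have hvb := mem_phaseBoundary_of_mem_regular (hN'.snd_mem hvN)
    have hvu := geodesicFlow_mem_unit hg' hvb.1
    -- Well-definedness of the mixed map gives some `v` in `N'`, a priori far from the limit point.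
    -- Injectivity of the flow on `N'` identifies it with the value of the local inverse `l`.
    have hlv : l (geodesicFlow g' v) = v := hinj' (by
      have := z6 (by rw [← hv]; exact hvu)
      rwa [← hv] at this) hvN (hlinv _)
    obtain ⟨-, h2, h3⟩ := z7 v (by rw [← hv, hlv]) hvN
    have hRu : geodesicFlow g' (v.1, reflect g' Ω v.2) ∈ unitBundle g' :=
      geodesicFlow_mem_unit hg' (reflect_mem_unitBundle hg' hΩ hvb)
    have h4 : rescale g' (m z) = geodesicFlow g' (v.1, reflect g' Ω v.2) := by
      rw [z1, rescale_rescale_of_mem hRu]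
    rw [h4] at z4
    have h5 := z4 hRu
    rw [h4] at z5 ⊢
    have h6 := z5.2.1 (z5.1 h5)
    refine ⟨h6, ?_⟩
    have h7 : (localFlow g Ω z).proj ∉ Ω := hD.localFlow_notMem hz ht.ne'
    have h8 : rescale g' (localFlow g Ω z) = geodesicFlow g' v := by rw [localFlow_of_pos ht, hv]
    have h9 : (geodesicFlow g' v).proj ∉ Ω := by
      rw [← h8]; exact h7
    -- Time zero would put the trajectory on `∂Ω`, and a negative time in the interior of `Ω`.
    have h10 : 0 < v.1 := by
      rcases lt_trichotomy v.1 0 with h | h | h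
      · exact absurd (interior_subset (h3 h)) h9
      · refine absurd (hΩ.1.frontier_subset hvb.2) ?_
        obtain ⟨t, p⟩ := v
        obtain rfl : t = 0 := h
        rwa [geodesicFlow_zero hg'] at h9
      · exact h
    rw [h2, h8, localFlow_of_pos (by exact h10)]
    simp only
    rw [reflect_reflect hg' hΩ hvb.2]

/-- Only time zero requires the regularity of the mixed map. At other times the local flow of `g`,
the rescaling and the inverse local flow of `g'` compose smoothly. -/
theorem readsSmoothly_flow_flow (hg : IsComplete g) (hg' : IsComplete g') (hΩ : IsObstacle n Ω)
    (hF : ∀ p, F (Model.proj g Ω p) = Model.proj g' Ω (identify g g' Ω p))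
    {D D' : Set (ℝ × TangentBundle (𝓡 n) X)} (hD : IsFlowChartDomain g Ω D)
    (hD' : IsFlowChartDomain g' Ω D') (hN : IsOpenNhdZero (regularBoundary g Ω) N)
    (hN' : IsOpenNhdZero (regularBoundary g' Ω) N') (hinj' : InjOn (geodesicFlow g') N')
    (hreg : MixedMapRegular g g' Ω N N') :
    ReadsSmoothly (timeModel n) (timeModel n) (flowParam g Ω D) (flowParam g' Ω D') F := by
  refine readsSmoothly_iff.2 ?_
  rintro w q w' ⟨hw, m, rfl⟩ hw'
  have hwin := hD.1.snd_mem hw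
  by_cases h0 : w.1 = 0
  · obtain ⟨t, y⟩ := w
    obtain rfl : t = 0 := h0
    obtain ⟨θ, hθ, hθ0, hθe⟩ :=
      exists_smoothNear_flow_flow hg hg' hΩ hD hD' hN hN' hinj' hreg hwin
    have h1 := hθe.self_of_nhds hw
    refine ⟨θ, hθ, hD'.2.2 _ _ _ (flowParam_of_localFlow_eq hF h1.1 h1.2 m) hw', ?_⟩
    filter_upwards [hθe] with z hz
    rintro _ ⟨hzD, mz, rfl⟩
    exact flowParam_of_localFlow_eq hF (hz hzD).1 (hz hzD).2 mz
  · obtain ⟨h1, h2⟩ := localFlow_eq_of_flowParam hg' hΩ hF hD'.1 (hD.localFlow_notMem hw h0) hw'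
    obtain ⟨a, ha, hae⟩ := exists_smoothNear_localFlow hg hΩ hwin.1.2 h0
    have haw := hae.self_of_nhds hwin.1.2
    obtain ⟨κ, hκ, hκw, hκe⟩ := exists_localFlow_inverse hg' hΩ hD'.1 hw'.1 h2
    rw [h1, ← haw] at hκ hκw hκe
    have hs : SmoothNear (timeModel n) (𝓡 n).tangent (fun z => rescale g' (a z)) w :=
      SmoothNear.comp (smoothNear_rescale g' (by
        rw [haw]; exact snd_ne_zero_of_mem_unitBundle m.1.1)) ha
    refine ⟨fun z => κ (rescale g' (a z)),
      SmoothNear.comp (f := fun z => rescale g' (a z)) hκ hs, hκw, ?_⟩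
    filter_upwards [hs.continuousAt.eventually hκe, hae] with z hz1 hz2
    rintro _ ⟨hz, mz, rfl⟩
    rw [hz2 (hD.1.snd_mem hz).1.2] at hz1 ⊢
    obtain ⟨h3, h4⟩ := hz1 (rescale_mem_unitBundle g' (snd_ne_zero_of_mem_unitBundle mz.1.1))
    exact flowParam_of_localFlow_eq hF h3 h4 mz

theorem isSmoothMap_of_mixedMapRegular (hg : IsComplete g) (hg' : IsComplete g')
    (hΩ : IsObstacle n Ω) (hFc : Continuous F)
    (hF : ∀ p, F (Model.proj g Ω p) = Model.proj g' Ω (identify g g' Ω p))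
    (hN : IsOpenNhdZero (regularBoundary g Ω) N)
    (hN' : IsOpenNhdZero (regularBoundary g' Ω) N') (hinj' : InjOn (geodesicFlow g') N')
    (hreg : MixedMapRegular g g' Ω N N') : IsSmoothMap g g' Ω F :=
  ⟨hFc, readsSmoothly_interior_interior hg' hΩ hF,
    fun _ h => readsSmoothly_interior_flow hg' hΩ hF h,
    fun _ h => readsSmoothly_flow_interior hg hg' hΩ hF h,
    fun _ _ h h' => readsSmoothly_flow_flow hg hg' hΩ hF h h' hN hN' hinj' hreg⟩

theorem IsDiffeoOntoOpenImage.injOn {D : Set (ℝ × TangentBundle (𝓡 n) X)}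
    {S : Set (TangentBundle (𝓡 n) X)} {f : ℝ × TangentBundle (𝓡 n) X → TangentBundle (𝓡 n) X}
    (h : IsDiffeoOntoOpenImage (timeModel n) (𝓡 n).tangent f D S) : InjOn f D := by
  obtain ⟨-, -, k, hk, -⟩ := h
  intro w hw w' hw' heq
  rw [← hk w hw, heq, hk w' hw']

theorem exists_isCompatibleDiffeo (hg : IsComplete g) (hg' : IsComplete g') (hΩ : IsObstacle n Ω)
    (h : IsRegularNhd g g' Ω N) : ∃ F : Model g Ω ≃ Model g' Ω, IsCompatibleDiffeo g g' Ω F := by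
  obtain ⟨hN, h1, h2, h3, h4⟩ := h
  rw [phaseBoundary_diff_grazingBoundary hg hΩ] at hN
  have hN' := transport_regular hg hg' hΩ hN
  have ha := reflectionsAgree_of_mixedMapRegular hg hg' hΩ hN hN' h2.injOn h3
  have ha' := ha.symm hg hg' hΩ
  exact ⟨modelEquiv ha ha',
    isSmoothMap_of_mixedMapRegular hg hg' hΩ (continuous_modelMap ha) (modelMap_proj ha) hN hN'
      h2.injOn h3,
    isSmoothMap_of_mixedMapRegular hg' hg hΩ (continuous_modelMap ha') (modelMap_proj ha') hN' hN
      h1.injOn h4, modelMap_proj ha⟩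

end Regular

section Converse

variable {n : ℕ} {X : Type*} [TopologicalSpace X] [ChartedSpace (Euc n) X] [IsManifold (𝓡 n) ∞ X]
  [T2Space X] {g g' : Metric n X} {Ω : Set X} {N N' : Set (ℝ × TangentBundle (𝓡 n) X)}
  {F : Model g Ω → Model g' Ω}

/-! ### The mixed maps of a compatible diffeomorphism -/

/-- If `θ` is the reading of `F` in flow charts, the smooth map `rescale g ∘ φ^{g'} ∘ θ` extends the
mixed map: for `t > 0` and `θ z = (s, q)`, the geometric reflection sends `φ^{g'}(s, R_{g'} q)` to
`φ^{g'}(s, q)`. -/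
theorem exists_smoothNear_mixedMap_zero (hg : IsComplete g) (hg' : IsComplete g')
    (hΩ : IsObstacle n Ω)
    (hF : ∀ p, F (Model.proj g Ω p) = Model.proj g' Ω (identify g g' Ω p))
    (hFs : ∀ D D', IsFlowChartDomain g Ω D → IsFlowChartDomain g' Ω D' →
      ReadsSmoothly (timeModel n) (timeModel n) (flowParam g Ω D) (flowParam g' Ω D') F)
    (hN' : IsOpenNhdZero (regularBoundary g' Ω) N') (hinj' : InjOn (geodesicFlow g') N')
    {y : TangentBundle (𝓡 n) X} (hy : y ∈ inBoundary g Ω) :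
    ∃ h : ℝ × TangentBundle (𝓡 n) X → TangentBundle (𝓡 n) X,
      SmoothNear (timeModel n) (𝓡 n).tangent h (0, y) ∧
        ∀ᶠ z in 𝓝 ((0 : ℝ), y), z.2 ∈ inBoundary g Ω → h z = mixedMap g g' Ω N' z := by
  obtain ⟨D, hD⟩ := exists_isFlowChartDomain hg hΩ
  obtain ⟨D', hD'⟩ := exists_isFlowChartDomain hg' hΩ
  have hy' := rescale_mem_inBoundary hg hg' hΩ hy
  have hR := reflect_mem_outBoundary hg hΩ hy
  have hR' := rescale_mem_outBoundary hg hg' hΩ hR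
  have hR'y := reflect_mem_outBoundary hg' hΩ hy'
  have hyD : ((0 : ℝ), y) ∈ D := hD.1.zero_mem hy
  have hchart : ∀ z ∈ D, ∀ hz : localFlow g Ω z ∈ phaseSpace g Ω \ grazingBoundary g Ω, z.1 = 0 →
      flowParam g' Ω D' (0, rescale g' z.2) (F (Model.proj g Ω ⟨localFlow g Ω z, hz⟩)) :=
    fun z hzD hz h0 => flowParam_of_localFlow_eq hF
      (hD'.1.zero_mem (rescale_mem_inBoundary hg hg' hΩ (hD.1.snd_mem hzD)))
      (by rw [localFlow_zero hg' rfl, localFlow_zero hg h0]) hz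
  have hym := hD.localFlow_mem hg hΩ hyD
  obtain ⟨θ, hθ, hθ0, hθe⟩ := readsSmoothly_iff.1 (hFs D D' hD hD') (0, y)
    (Model.proj g Ω ⟨_, hym⟩) (0, rescale g' y) ⟨hyD, hym, rfl⟩ (hchart _ hyD hym rfl)
  obtain ⟨ρ, hρ, hρe⟩ := exists_smoothNear_reflect_snd hg hΩ (w := ((0 : ℝ), y)) hy.1.2
  have hρ0 : ρ (0, y) = (0, reflect g Ω y) := hρe.self_of_nhds hy.1.2
  obtain ⟨ρ', hρ', hρ'e⟩ := exists_smoothNear_reflect_snd hg' hΩ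
    (w := ((0 : ℝ), rescale g' y)) hy'.1.2
  have hρ'0 : ρ' (0, rescale g' y) = (0, reflect g' Ω (rescale g' y)) :=
    hρ'e.self_of_nhds hy'.1.2
  have hρθ : ContinuousAt (fun z => ρ' (θ z)) (0, y) :=
    ContinuousAt.comp (by rw [hθ0]; exact hρ'.continuousAt) hθ.continuousAt
  have hflow : SmoothNear (timeModel n) (𝓡 n).tangent (fun z => geodesicFlow g' (θ z)) (0, y) :=
    SmoothNear.comp (smoothNear_geodesicFlow hg' _) hθ
  have hflow0 : geodesicFlow g' (θ (0, y)) = rescale g' y := by rw [hθ0, geodesicFlow_zero hg']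
  have hres : ∀ {f : ℝ × TangentBundle (𝓡 n) X → ℝ × TangentBundle (𝓡 n) X}
      {p : TangentBundle (𝓡 n) X}, ContinuousAt f (0, y) → f (0, y) = (0, p) →
      p ∈ unitBundle g →
      ContinuousAt (fun z => rescale g' (geodesicFlow g (f z))) (0, y) := by
    intro f p hf h0 hp
    have h1 : ContinuousAt (fun z => geodesicFlow g (f z)) (0, y) :=
      ContinuousAt.comp (continuous_geodesicFlow hg).continuousAt hf
    have h2 : geodesicFlow g (f (0, y)) = p := by rw [h0, geodesicFlow_zero hg]
    exact ContinuousAt.comp (g := rescale g') (by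
      rw [h2]
      exact (smoothNear_rescale g' (snd_ne_zero_of_mem_unitBundle hp)).continuousAt) h1
  have hne : ∀ {p q}, p ∈ inBoundary g' Ω → q ∈ outBoundary g' Ω → p ≠ q := by
    rintro p q hp hq rfl
    exact notMem_outBoundary hp hq
  -- The chart relation alone does not say that `z` and `θ z` have times of the same sign. `e1` and
  -- `e2` exclude the other cases: the two sides are near an inward and an outward vector,
  -- respectively.
  have e1 : ∀ᶠ z in 𝓝 ((0 : ℝ), y),
      rescale g' (geodesicFlow g z) ≠ geodesicFlow g' (ρ' (θ z)) := by
    refine ((hres continuousAt_id rfl hy.1.1).ne_iff_eventually_ne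
      (ContinuousAt.comp (g := geodesicFlow g') (continuous_geodesicFlow hg').continuousAt
        hρθ)).1 ?_
    simp only [Function.comp_apply, id_eq, hθ0, hρ'0, geodesicFlow_zero hg, geodesicFlow_zero hg']
    exact hne hy' hR'y
  have e2 : ∀ᶠ z in 𝓝 ((0 : ℝ), y),
      geodesicFlow g' (θ z) ≠ rescale g' (geodesicFlow g (ρ z)) := by
    refine (hflow.continuousAt.ne_iff_eventually_ne (hres hρ.continuousAt hρ0 hR.1.1)).1 ?_
    rw [hflow0, hρ0, geodesicFlow_zero hg]
    exact hne hy' hR'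
  have e3 := hρθ.eventually (p := fun v => v.2 ∈ regularBoundary g' Ω → v ∈ N') (by
    beta_reduce
    rw [hθ0, hρ'0]
    exact hN'.eventually_mem (hN'.zero_mem (Or.inr hR'y)))
  have e4 := hθ.continuousAt.eventually
    (p := fun v => v.2.proj ∈ frontier Ω → ρ' v = (v.1, reflect g' Ω v.2))
    (by rw [hθ0]; exact hρ'e)
  refine ⟨fun z => rescale g (geodesicFlow g' (θ z)), SmoothNear.comp (smoothNear_rescale g (by
    rw [hflow0]; exact snd_ne_zero_of_mem_unitBundle hy'.1.1)) hflow, ?_⟩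
  filter_upwards [hθe, hρe, hD.1.eventually_mem hyD, e1, e2, e3, e4] with z z0 z1 z2 z3 z4 z5 z6 hz
  have hzD := z2 hz
  have hzm := hD.localFlow_mem hg hΩ hzD
  have hfp := z0 _ ⟨hzD, hzm, rfl⟩
  have hθin := hD'.1.snd_mem hfp.1
  rw [z1 hz.1.2] at z4
  rw [z6 hθin.1.2] at z3 z5
  have hzu := geodesicFlow_mem_unit hg hz.1.1
  rcases lt_trichotomy z.1 0 with ht | ht | ht
  · obtain ⟨h1, -⟩ := localFlow_eq_of_flowParam hg' hΩ hF hD'.1 (hD.localFlow_notMem hzD ht.ne) hfp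
    rw [localFlow_of_nonpos (w := z) ht.le] at h1
    rw [mixedMap_of_nonpos ht.le]
    rcases le_or_gt (θ z).1 0 with hs | hs
    · rw [localFlow_of_nonpos hs] at h1
      rw [h1, rescale_rescale_of_mem hzu]
    · rw [localFlow_of_pos hs] at h1
      exact absurd h1.symm z3
  · have h1 := hD'.2.2 _ _ _ hfp (hchart z hzD hzm ht)
    rw [h1, geodesicFlow_zero hg', rescale_rescale_of_mem hz.1.1, mixedMap_of_nonpos ht.le,
      ← localFlow_of_nonpos (Ω := Ω) ht.le, localFlow_zero hg ht]
  · obtain ⟨h1, -⟩ := localFlow_eq_of_flowParam hg' hΩ hF hD'.1 (hD.localFlow_notMem hzD ht.ne') hfp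
    rw [localFlow_of_pos (w := z) ht] at h1
    rcases le_or_gt (θ z).1 0 with hs | hs
    · rw [localFlow_of_nonpos hs] at h1
      exact absurd h1 z4
    · rw [localFlow_of_pos hs] at h1
      have h2 := z5 (Or.inr (reflect_mem_outBoundary hg' hΩ hθin))
      rw [mixedMap_of_pos ht, ← h1, geometricReflection_geodesicFlow hinj' h2]
      simp only
      rw [reflect_reflect hg' hΩ hθin.1.2]

/-- The smoothness of `F` enters at time zero only; at other times a single smooth branch is in
force. -/
theorem mixedMapRegular_of_readsSmoothly (hg : IsComplete g) (hg' : IsComplete g')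
    (hΩ : IsObstacle n Ω)
    (hF : ∀ p, F (Model.proj g Ω p) = Model.proj g' Ω (identify g g' Ω p))
    (hFs : ∀ D D', IsFlowChartDomain g Ω D → IsFlowChartDomain g' Ω D' →
      ReadsSmoothly (timeModel n) (timeModel n) (flowParam g Ω D) (flowParam g' Ω D') F)
    (hN' : IsOpenNhdZero (regularBoundary g' Ω) N') (hinj' : InjOn (geodesicFlow g') N')
    (hmem : ∀ w ∈ N ∩ (univ ×ˢ inBoundary g Ω), 0 < w.1 →
      rescale g' (geodesicFlow g (w.1, reflect g Ω w.2)) ∈ geodesicFlow g' '' N') :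
    MixedMapRegular g g' Ω N N' := by
  refine ⟨hmem, smoothOn_iff.2 fun w hw => ?_⟩
  have hwin : w.2 ∈ inBoundary g Ω := hw.2.2
  rcases lt_trichotomy w.1 0 with h0 | h0 | h0
  · refine ⟨geodesicFlow g, smoothNear_geodesicFlow hg w, ?_⟩
    filter_upwards [continuousAt_fst.eventually (gt_mem_nhds h0)] with z hz _
    rw [mixedMap_of_nonpos (le_of_lt hz)]
  · obtain ⟨t, y⟩ := w
    obtain rfl : t = 0 := h0
    obtain ⟨h, hs, he⟩ := exists_smoothNear_mixedMap_zero hg hg' hΩ hF hFs hN' hinj' hwin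
    exact ⟨h, hs, he.mono fun z hz hzN => hz hzN.2.2⟩
  · obtain ⟨h, hs, he⟩ := exists_smoothNear_mixedMap hg hg' hΩ hN' hinj' hwin.1 (hmem w hw h0)
    refine ⟨h, hs, ?_⟩
    filter_upwards [he, continuousAt_fst.eventually (lt_mem_nhds h0)] with z hz1 hz2 hz
    rw [hz1 hz.2.2.1, mixedMap_of_pos hz2]

/-! ### Existence of regular neighborhoods -/

/-- The trajectory of `w.2` does not meet the boundary up to twice the time `w.1` in either
direction. -/
def IsFree (g : Metric n X) (Ω : Set X) (w : ℝ × TangentBundle (𝓡 n) X) : Prop :=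
  ∀ s : ℝ, |s| ≤ 2 * |w.1| → s ≠ 0 → (geodesicFlow g (s, w.2)).proj ∉ frontier Ω

theorem eventually_isFree (hg : IsComplete g) (hΩ : IsObstacle n Ω) {p : TangentBundle (𝓡 n) X}
    (hp : p ∈ regularBoundary g Ω) :
    ∀ᶠ w in 𝓝 ((0 : ℝ), p), w.2.proj ∈ frontier Ω → IsFree g Ω w := by
  have h : ∀ᶠ w : ℝ × TangentBundle (𝓡 n) X in 𝓝 (0, p), w.2.proj ∈ frontier Ω → w.1 ≠ 0 →
      (geodesicFlow g w).proj ∉ frontier Ω := by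
    rcases hp with hp | hp
    · filter_upwards [eventually_sign_inBoundary hg hΩ hp] with w hw hwf h0 hf
      rcases h0.lt_or_gt with h0 | h0
      · exact (hw hwf).2 h0 (hΩ.1.frontier_subset hf)
      · exact hf.2 ((hw hwf).1 h0)
    · filter_upwards [eventually_sign_outBoundary hg hΩ hp] with w hw hwf h0 hf
      rcases h0.lt_or_gt with h0 | h0
      · exact hf.2 ((hw hwf).1 h0)
      · exact (hw hwf).2 h0 (hΩ.1.frontier_subset hf)
  filter_upwards [eventually_forall_abs_le h 2] with w hw hwf s hs h0
  exact hw s hs hwf h0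

/-- If two values of the flow agree, one starting vector lies on the other trajectory at time `t₁ -
t₂`. With `|t₁|` the larger, this is at most `2 |t₁|` in absolute value, so freeness forces `t₁ =
t₂`. -/
theorem injOn_of_isFree (hg : IsComplete g)
    (hN : ∀ w ∈ N, w.2.proj ∈ frontier Ω ∧ IsFree g Ω w) : InjOn (geodesicFlow g) N := by
  have key : ∀ w₁ ∈ N, ∀ w₂ ∈ N, |w₂.1| ≤ |w₁.1| → geodesicFlow g w₁ = geodesicFlow g w₂ →
      w₁ = w₂ := by
    rintro ⟨t₁, p₁⟩ h₁ ⟨t₂, p₂⟩ h₂ hle heq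
    have h3 : geodesicFlow g (t₁ - t₂, p₁) = p₂ := by
      rw [sub_eq_neg_add, geodesicFlow_add hg, heq, geodesicFlow_neg hg]
    have h4 : t₁ - t₂ = 0 := by
      by_contra h0
      refine (hN _ h₁).2 (t₁ - t₂) ?_ h0 ?_
      · simp only at hle ⊢
        linarith [abs_sub t₁ t₂]
      · simp only
        rw [h3]
        exact (hN _ h₂).1
    rw [h4, geodesicFlow_zero hg] at h3
    rw [h3, sub_eq_zero.1 h4]
  intro w₁ h₁ w₂ h₂ heq
  exact (le_total |w₂.1| |w₁.1|).elim (fun h => key w₁ h₁ w₂ h₂ h heq)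
    fun h => (key w₂ h₂ w₁ h₁ h heq.symm).symm

/-- The reflected trajectory starts at an outward vector, near which the flow of `g'` has a local
inverse with values in `N'`. -/
theorem eventually_rescale_mem_image (hg : IsComplete g) (hg' : IsComplete g')
    (hΩ : IsObstacle n Ω) (hN' : IsOpenNhdZero (outBoundary g' Ω) N')
    {p : TangentBundle (𝓡 n) X} (hp : p ∈ inBoundary g Ω) :
    ∀ᶠ w in 𝓝 ((0 : ℝ), p), w.2 ∈ inBoundary g Ω →
      rescale g' (geodesicFlow g (w.1, reflect g Ω w.2)) ∈ geodesicFlow g' '' N' := by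
  have hR := reflect_mem_outBoundary hg hΩ hp
  have hR' := rescale_mem_outBoundary hg hg' hΩ hR
  obtain ⟨k, -, -, hinv, hk⟩ := exists_flow_inverse_mem hg' hΩ
    (isOpenInRegular_outBoundary hg' hΩ) hN' (hN'.zero_mem hR')
  rw [geodesicFlow_zero hg'] at hk
  obtain ⟨ρ, hρ, hρe⟩ := exists_smoothNear_reflect_snd hg hΩ (w := ((0 : ℝ), p)) hp.1.2
  have hρ0 : ρ (0, p) = (0, reflect g Ω p) := hρe.self_of_nhds hp.1.2
  have h1 : geodesicFlow g (ρ (0, p)) = reflect g Ω p := by rw [hρ0, geodesicFlow_zero hg]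
  have hc : ContinuousAt (fun w => rescale g' (geodesicFlow g (ρ w))) (0, p) :=
    ContinuousAt.comp (g := rescale g') (f := fun w => geodesicFlow g (ρ w)) (by
      rw [h1]
      exact (smoothNear_rescale g' (snd_ne_zero_of_mem_unitBundle hR.1.1)).continuousAt)
      (ContinuousAt.comp (continuous_geodesicFlow hg).continuousAt hρ.continuousAt)
  have h2 := hc.eventually (p := fun z => z ∈ unitBundle g' → k z ∈ N')
    (by beta_reduce; rw [h1]; exact hk)
  filter_upwards [h2, hρe] with w hw1 hw2 hw
  rw [hw2 hw.1.2] at hw1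
  refine ⟨_, hw1 (rescale_mem_unitBundle g' (snd_ne_zero_of_mem_unitBundle
    (geodesicFlow_mem_unit hg (reflect_mem_unitBundle hg hΩ hw.1)))), hinv _⟩

theorem continuousAt_rescale_snd (g' : Metric n X) {w : ℝ × TangentBundle (𝓡 n) X}
    (hw : w.2 ∈ unitBundle g) :
    ContinuousAt (fun z : ℝ × TangentBundle (𝓡 n) X => (z.1, rescale g' z.2)) w :=
  continuousAt_fst.prodMk (ContinuousAt.comp (g := rescale g')
    (smoothNear_rescale g' (snd_ne_zero_of_mem_unitBundle hw)).continuousAt continuousAt_snd)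

theorem exists_regular_nhd (hg : IsComplete g) (hg' : IsComplete g') (hΩ : IsObstacle n Ω) :
    ∃ N, IsOpenNhdZero (regularBoundary g Ω) N ∧
      InjOn (geodesicFlow g) N ∧ InjOn (geodesicFlow g') (transport g' N) ∧
      (∀ w ∈ N ∩ (univ ×ˢ inBoundary g Ω), 0 < w.1 →
        rescale g' (geodesicFlow g (w.1, reflect g Ω w.2)) ∈ geodesicFlow g' '' transport g' N) ∧
      ∀ w ∈ transport g' N ∩ (univ ×ˢ inBoundary g' Ω), 0 < w.1 →
        rescale g (geodesicFlow g' (w.1, reflect g' Ω w.2)) ∈ geodesicFlow g '' N := by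
  let P : ℝ × TangentBundle (𝓡 n) X → Prop := fun w =>
    IsFree g Ω w ∧ IsFree g' Ω (w.1, rescale g' w.2)
  have hP : ∀ p ∈ regularBoundary g Ω, ∀ᶠ w in 𝓝 ((0 : ℝ), p),
      w.2.proj ∈ frontier Ω → P w := by
    intro p hp
    have h1 := (continuousAt_rescale_snd g' (w := ((0 : ℝ), p))
      (mem_phaseBoundary_of_mem_regular hp).1).eventually
        (eventually_isFree hg' hΩ (rescale_mem_regularBoundary hg hg' hΩ hp))
    filter_upwards [eventually_isFree hg hΩ hp, h1] with w hw1 hw2 hwf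
    exact ⟨hw1 hwf, hw2 hwf⟩
  -- The conditions on `N` refer to the images of `N` itself. To break the circle, a neighborhood
  -- `A` of the outward part is fixed first, and the inward part of `N` is then made so small that
  -- its reflected trajectories land in the images of `A`.
  set A := relInterior (outBoundary g Ω) P with hA
  have hAo : IsOpenNhdZero (outBoundary g Ω) A := isOpenNhdZero_relInterior fun p hp =>
    (hP p (Or.inr hp)).mono fun w hw hwo => hw hwo.1.2
  have hAo' : IsOpenNhdZero (outBoundary g' Ω) (transport g' A) :=
    hAo.transport (fun _ h => h.1.1) (fun _ h => h.1.1)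
      (fun _ h => rescale_mem_outBoundary hg hg' hΩ h)
      fun _ h => rescale_mem_outBoundary hg' hg hΩ h
  let Q : ℝ × TangentBundle (𝓡 n) X → Prop := fun w => w.2 ∈ inBoundary g Ω →
    rescale g' (geodesicFlow g (w.1, reflect g Ω w.2)) ∈ geodesicFlow g' '' transport g' A ∧
    rescale g (geodesicFlow g' (w.1, reflect g' Ω (rescale g' w.2))) ∈ geodesicFlow g '' A
  have hNo : IsOpenNhdZero (regularBoundary g Ω)
      (relInterior (regularBoundary g Ω) fun w => P w ∧ Q w) := by
    refine isOpenNhdZero_relInterior fun p hp => ?_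
    have h1 : ∀ᶠ w in 𝓝 ((0 : ℝ), p), w.2 ∈ regularBoundary g Ω → Q w := by
      rcases hp with hp | hp
      · have hp' := rescale_mem_inBoundary hg hg' hΩ hp
        have h2 := (continuousAt_rescale_snd g' (w := ((0 : ℝ), p)) hp.1.1).eventually
          (eventually_rescale_mem_image hg' hg hΩ hAo hp')
        filter_upwards [eventually_rescale_mem_image hg hg' hΩ hAo' hp, h2] with w hw1 hw2 _ hw
        exact ⟨hw1 hw, hw2 (rescale_mem_inBoundary hg hg' hΩ hw)⟩
      · have h2 : ∀ᶠ w : ℝ × TangentBundle (𝓡 n) X in 𝓝 ((0 : ℝ), p),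
            w.2 ∈ phaseBoundary g Ω → w.2 ∈ outBoundary g Ω :=
          continuousAt_snd.eventually (eventually_mem_outBoundary hg hΩ hp)
        filter_upwards [h2] with w hw _ hwin
        exact absurd (hw hwin.1) (notMem_outBoundary hwin)
    filter_upwards [hP p hp, h1] with w hw1 hw2 hw
    exact ⟨hw1 (mem_phaseBoundary_of_mem_regular hw).2, hw2 hw⟩
  set N := relInterior (regularBoundary g Ω) fun w => P w ∧ Q w with hN
  -- Close to an outward vector there are no inward boundary vectors, so `Q` is vacuous there.
  have hAN : A ⊆ N := by
    intro w hw
    refine ⟨Or.inr hw.1, ?_⟩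
    have h2 : ∀ᶠ z : ℝ × TangentBundle (𝓡 n) X in 𝓝 w,
        z.2 ∈ phaseBoundary g Ω → z.2 ∈ outBoundary g Ω :=
      continuousAt_snd.eventually (eventually_mem_outBoundary hg hΩ hw.1)
    filter_upwards [h2, hw.2] with z hz1 hz2 hz
    have h3 := hz1 (mem_phaseBoundary_of_mem_regular hz)
    exact ⟨hz2 h3, fun h => absurd h3 (notMem_outBoundary h)⟩
  have hNP : ∀ w ∈ N, P w ∧ Q w := fun w hw => of_mem_relInterior hw
  have hfr : ∀ w ∈ N, w.2.proj ∈ frontier Ω := fun w hw =>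
    (mem_phaseBoundary_of_mem_regular (hNo.snd_mem hw)).2
  refine ⟨N, hNo, injOn_of_isFree hg fun w hw => ⟨hfr w hw, (hNP w hw).1.1⟩, ?_, ?_, ?_⟩
  · refine injOn_of_isFree (Ω := Ω) hg' ?_
    rintro _ ⟨w, hw, rfl⟩
    exact ⟨hfr w hw, (hNP w hw).1.2⟩
  · intro w hw _
    exact image_mono (image_mono hAN) ((hNP w hw.1).2 hw.2.2).1
  · rintro _ ⟨⟨w, hw, rfl⟩, -, hwin⟩ _
    refine image_mono hAN ((hNP w hw).2 ?_).2
    have h := rescale_mem_inBoundary hg' hg hΩ hwin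
    simp only at h
    rwa [rescale_rescale_of_mem (mem_phaseBoundary_of_mem_regular (hNo.snd_mem hw)).1] at h

/-- The inverse of `F` is compatible with the projections in the other direction, so the second
mixed map is treated like the first with the metrics exchanged. -/
theorem exists_isRegularNhd (hg : IsComplete g) (hg' : IsComplete g') (hΩ : IsObstacle n Ω)
    {F : Model g Ω ≃ Model g' Ω} (h : IsCompatibleDiffeo g g' Ω F) :
    ∃ N, IsRegularNhd g g' Ω N := by
  obtain ⟨N, hN, hinj, hinj', hmem, hmem'⟩ := exists_regular_nhd hg hg' hΩ
  have hN' := transport_regular hg hg' hΩ hN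
  have hFsymm : ∀ p, F.symm (Model.proj g' Ω p) = Model.proj g Ω (identify g' g Ω p) := by
    intro p
    rw [Equiv.symm_apply_eq, h.2.2, identify_identify]
  refine ⟨N, by rwa [phaseBoundary_diff_grazingBoundary hg hΩ],
    isDiffeoOntoOpenImage_geodesicFlow hg hΩ hN hinj,
    isDiffeoOntoOpenImage_geodesicFlow hg' hΩ hN' hinj',
    mixedMapRegular_of_readsSmoothly hg hg' hΩ h.2.2 h.1.2.2.2.2 hN' hinj' hmem,
    mixedMapRegular_of_readsSmoothly hg' hg hΩ hFsymm h.2.1.2.2.2.2 hN hinj hmem'⟩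

theorem IsCompatibleDiffeo.unique {F₁ F₂ : Model g Ω ≃ Model g' Ω}
    (h₁ : IsCompatibleDiffeo g g' Ω F₁) (h₂ : IsCompatibleDiffeo g g' Ω F₂) : F₁ = F₂ := by
  ext q
  induction q using Quot.ind with
  | mk p => exact (h₁.2.2 p).trans (h₂.2.2 p).symm

end Converse

end Billiard

end

theorem mainTheorem11 {n : ℕ} (hn : 1 ≤ n) {X : Type*} [TopologicalSpace X]
    [ChartedSpace (EuclideanSpace ℝ (Fin n)) X] [IsManifold (𝓡 n) ∞ X]
    [T2Space X] [SecondCountableTopology X] [ConnectedSpace X]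
    (g g' : Billiard.Metric n X) (hg : Billiard.IsComplete g) (hg' : Billiard.IsComplete g')
    (Ω : Set X) (hΩ : Billiard.IsObstacle n Ω) :
    ((∃ F : Billiard.Model g Ω ≃ Billiard.Model g' Ω, Billiard.IsCompatibleDiffeo g g' Ω F) ↔
      ∃ N : Set (ℝ × TangentBundle (𝓡 n) X), Billiard.IsRegularNhd g g' Ω N) ∧
    ((∃ F : Billiard.Model g Ω ≃ Billiard.Model g' Ω, Billiard.IsCompatibleDiffeo g g' Ω F) →
      ∃! F : Billiard.Model g Ω ≃ Billiard.Model g' Ω, Billiard.IsCompatibleDiffeo g g' Ω F) := by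
  refine ⟨⟨fun ⟨_, h⟩ => Billiard.exists_isRegularNhd hg hg' hΩ h,
    fun ⟨_, h⟩ => Billiard.exists_isCompatibleDiffeo hg hg' hΩ h⟩, ?_⟩
  rintro ⟨F, h⟩
  exact ⟨F, h, fun _ h' => h'.unique h⟩
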